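/- **Setting.** Let $G$ be a connected graph on $n$ vertices with positive edge lengths, vertex set $V$, shortest-path metric $\mathrm{dist}$ and highway dimension at most $h$, where $h\ge 1$. (The highway dimension is the smallest integer $h$ such that for all $r>0$ and $v\in V$ at most $h$ vertices of the ball $\beta_v(8r)$ hit all shortest paths of length more than $r$ that lie in this ball.) Let $0<\rho\le 1/2$ and $0<\varepsilon\le 1$. *Decomposition.* Let $\mathcal D=(\mathcal B_0,\dots,\mathcal B_\lambda)$ be a hierarchical decomposition of a set $W\subseteq V$: each $\mathcal B_i$ is a partition of $W$ refining $\mathcal B_{i+1}$, $\mathcal B_0$ consists of singletons, $\mathcal B_\lambda=\{W\}$, $\lambda=\lambda(W)=\lceil\log_2\mathrm{diam}(W)\rceil$ (read as $0$ if $|W|=1$), and every part of $\mathcal B_i$ has diameter at most $2^{i+5}$. Two points are cut at level $j$ if $j$ is the largest level on which they lie in different parts. Every part $B\in\mathcal B_i$ with $i\ge1$ has an interface $I_B\subseteq V$ that is - concise: $|I_B|\le (h/\rho)^{c}$, for a constant $c\in\mathbb N$, and - precise: for all $u,v\in B$ cut at level $i-1$ there is $p\in I_B$ with $\mathrm{dist}(u,p)+\mathrm{dist}(p,v)\le\mathrm{dist}(u,v)+68\rho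 2^i$. *Instance.* Fix a positive integer $q$. An instance of $k$-Clustering$^q$ consists of facilities $F\subseteq V$, demands $\chi:V\to\mathbb N_0$ and a number $k$; its solutions are the sets $S\subseteq F$ with $|S|\le k$. For Facility Location$^q$ there is no $k$, all $S\subseteq F$ are solutions, and each facility has an opening cost $w_f>0$. Let $X=\max_v\chi(v)$ and assume $X\ge1$. The instance is coarse with respect to $\mathcal D$ (and $\varepsilon$) if $F\cup\{v:\chi(v)>0\}\subseteq W$ and every part of $\mathcal D$ on a level at most $\lfloor\lambda(W)-2\log_2(nX/\varepsilon)\rfloor$ contains at most one facility. *Objective.* Let $\langle x\rangle_i=\min\{(69+\delta)\rho2^i : \delta\in\{1,2,\dots\},\ \rho\delta2^i\ge x\}$. Put $\mathrm{dist}'(v,v)=0$, and for $v\ne u$ in $W$ that are cut at level $i-1$ and lie in the common part $B\in\mathcal B_i$ put $\mathrm{dist}'(v,u)=\min_{p\in I_B}\{\mathrm{dist}(v,p)+\langle\mathrm{dist}(p,u)\rangle_i\}$. Let $\mathrm{dist}'(v,S)=\min_{f\in S}\mathrm{dist}'(v,f)$ (which is $\infty$ if $S=\emptyset$) and $\mathrm{cost}'(S)=\sum_{v}\chi(v)\,\mathrm{dist}'(v,S)^q$,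 where vertices with $\chi(v)=0$ contribute $0$. An optimum rounded interface-respecting solution is a solution $S$ minimizing $\mathrm{cost}'(S)$ for $k$-Clustering$^q$, and minimizing $\mathrm{cost}'(S)+\sum_{f\in S}w_f$ for Facility Location$^q$. **Lemma.** There is an algorithm that, for every instance of $k$-Clustering$^q$ or Facility Location$^q$ that is coarse with respect to such a decomposition $\mathcal D$ with such interfaces, computes an optimum rounded interface-respecting solution exactly in $(nX/\varepsilon)^{(h/\rho)^{O(1)}}$ time. More precisely, there is a single program such that for every $c$ there is a constant $C$ such that for every $q\ge1$ there is a constant $A$ for which, on all inputs as above, the program halts with an optimum rounded interface-respecting solution after at most $A\cdot(nX/\varepsilon)^{(h/\rho)^{C}}$ steps. Here $C$ depends only on $c$, and $A$ only on $c$ and $q$. Time is measured on a real random access machine with unit cost for memory accesses, comparisons, $+,-,\times$ on natural numbers, $+,-,\times,\div$ on real numbers, and conversion of natural numbers to reals (no rounding and no conversion of reals to natural numbers). The input consists of $n$, $q$, the kind of problem, $k$ or the opening costs, $\varepsilon$, $\rho$, the matrix of distances, the sets $W$ and $F$, the demands, and $\mathcal D$ with its interfaces; $\mathcal D$ is given by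 $\lambda$, the numbers $2^i$ for $0\le i\le\lambda$, and, for every two points of $W$, the lowest level on which they lie in a common part, and the interfaces by the truth value of $p\in I_B$ for every $p\in V$, every level $1\le i\le\lambda$ and every part $B\in\mathcal B_i$ (addressed by any of its elements). The value of $h$ is not part of the input. -/

import Mathlib

open scoped ENNReal

namespace ClusterDP

noncomputable section

/-! ### Weighted graphs, shortest-path metrics, highway dimension -/

/-- A connected graph on the vertex set `Fin n` with positive edge lengths. -/
structure WGraph (n : ℕ) where
  graph : SimpleGraph (Fin n)
  len : Sym2 (Fin n) → ℝ
  len_pos : ∀ e ∈ graph.edgeSet, 0 < len e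
  connected : graph.Connected

namespace WGraph

variable {n : ℕ} (G : WGraph n)

/-- The length of a walk: the sum of the lengths of its edges. -/
def walkLen {u v : Fin n} (p : G.graph.Walk u v) : ℝ := (p.edges.map G.len).sum

/-- The shortest-path metric of the graph. -/
def dist (u v : Fin n) : ℝ := ⨅ p : G.graph.Walk u v, G.walkLen p

/-- `h` suffices in the definition of the highway dimension with constant `c`: for every radius
`r > 0` and every vertex `v`, some set of at most `h` vertices of the ball of radius `c * r`
around `v` hits all shortest paths of length more than `r` that lie in this ball. -/
def HighwayBound (c : ℝ) (h : ℕ) : Prop :=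
  ∀ r : ℝ, 0 < r → ∀ v : Fin n, ∃ H : Finset (Fin n), H.card ≤ h ∧
    (∀ x ∈ H, G.dist v x ≤ c * r) ∧
    ∀ (a b : Fin n) (p : G.graph.Walk a b), p.IsPath → G.walkLen p = G.dist a b →
      r < G.walkLen p → (∀ x ∈ p.support, G.dist v x ≤ c * r) → ∃ x ∈ H, x ∈ p.support

/-- The highway dimension (with constant `c`): the smallest such `h`. -/
def highwayDim (c : ℝ) : ℕ := sInf {h | G.HighwayBound c h}

/-- The diameter of a set of vertices. -/
def diam (W : Finset (Fin n)) : ℝ := sSup {d | ∃ u ∈ W, ∃ v ∈ W, d = G.dist u v}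

/-- `⌈log₂ (diam W)⌉`. (A one-point set gets the value `0`.) -/
def topLevel (W : Finset (Fin n)) : ℤ := ⌈Real.logb 2 (G.diam W)⌉

end WGraph

/-! ### Hierarchical decompositions and interfaces -/

/-- A hierarchical decomposition of a set `W` of vertices: partitions `part 0, …, part top` of `W`,
each refining the next one, where `part 0` consists of singletons and `part top` of the single
part `W`. (The values of `part` above `top` are irrelevant.) -/
structure HierDecomp (n : ℕ) where
  W : Finset (Fin n)
  top : ℕ
  part : ℕ → Finpartition W
  part_zero : ∀ B ∈ (part 0).parts, B.card = 1
  part_top : (part top).parts = {W}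
  refines : ∀ i < top, part i ≤ part (i + 1)

namespace HierDecomp

variable {n : ℕ} (D : HierDecomp n)

/-- `u` and `v` lie in a common part of level `i`. -/
def SamePart (i : ℕ) (u v : Fin n) : Prop := ∃ B ∈ (D.part i).parts, u ∈ B ∧ v ∈ B

/-- The decomposition cuts `u` and `v` at level `j`: `j` is the largest level on which they lie
in different parts. -/
def CutAt (j : ℕ) (u v : Fin n) : Prop :=
  IsGreatest {l : ℕ | l ≤ D.top ∧ ¬ D.SamePart l u v} j

/-- The smallest level on which `u` and `v` lie in a common part. -/
def joinLevel (u v : Fin n) : ℕ := sInf {i : ℕ | D.SamePart i u v}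

theorem samePart_succ {i : ℕ} {u v : Fin n} (hi : i < D.top) (h : D.SamePart i u v) :
    D.SamePart (i + 1) u v := by
  obtain ⟨B, hB, hu, hv⟩ := h
  obtain ⟨B', hB', hle⟩ := D.refines i hi hB
  exact ⟨B', hB', hle hu, hle hv⟩

theorem samePart_mono {i j : ℕ} {u v : Fin n} (hij : i ≤ j) (hj : j ≤ D.top)
    (h : D.SamePart i u v) : D.SamePart j u v := by
  induction j, hij using Nat.le_induction with
  | base => exact h
  | succ k hk ih => exact D.samePart_succ (by omega) (ih (by omega))

/-- The level at which two points of `W` are cut is the one just below their `joinLevel`. -/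
theorem cutAt_iff {j : ℕ} {u v : Fin n} (hu : u ∈ D.W) (hv : v ∈ D.W) :
    D.CutAt j u v ↔ D.joinLevel u v = j + 1 := by
  have htop : D.SamePart D.top u v := ⟨D.W, by simp [D.part_top], hu, hv⟩
  have hmem : D.SamePart (D.joinLevel u v) u v := Nat.sInf_mem (s := {i | D.SamePart i u v})
    ⟨_, htop⟩
  have hle : ∀ i, D.SamePart i u v → D.joinLevel u v ≤ i := fun i hi => Nat.sInf_le hi
  have hjt := hle _ htop
  constructor
  · rintro ⟨⟨h1, h2⟩, h3⟩
    have hlt : j < D.joinLevel u v := by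
      by_contra hc
      exact h2 (D.samePart_mono (by omega) h1 hmem)
    by_contra hne
    have h4 : j + 1 ≤ D.top ∧ ¬ D.SamePart (j + 1) u v :=
      ⟨by omega, fun h => by have := hle _ h; omega⟩
    have := h3 h4
    omega
  · intro h
    refine ⟨⟨by omega, fun hs => by have := hle _ hs; omega⟩, ?_⟩
    rintro l ⟨hl, hs⟩
    by_contra hc
    exact hs (D.samePart_mono (by omega) hl hmem)

end HierDecomp

/-- `I i B` is the interface of the part `B` of level `i`. The decomposition `D` has levels
`0, …, ⌈log₂ (diam W)⌉`, every part of level `i` has diameter at most `2 ^ (i + 5)`, and the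
interfaces of the parts of the levels `i ≥ 1` are concise (with exponent `c`) and precise. -/
structure HasInterfaces {n : ℕ} (G : WGraph n) (D : HierDecomp n)
    (I : ℕ → Finset (Fin n) → Finset (Fin n)) (h : ℕ) (ρ : ℝ) (c : ℕ) : Prop where
  levels : (D.top : ℤ) = G.topLevel D.W
  diam_le : ∀ i ≤ D.top, ∀ B ∈ (D.part i).parts, G.diam B ≤ 2 ^ (i + 5)
  concise : ∀ i, 1 ≤ i → i ≤ D.top → ∀ B ∈ (D.part i).parts,
    ((I i B).card : ℝ) ≤ ((h : ℝ) / ρ) ^ c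
  precise : ∀ i, 1 ≤ i → i ≤ D.top → ∀ B ∈ (D.part i).parts, ∀ u ∈ B, ∀ v ∈ B,
    D.CutAt (i - 1) u v →
      ∃ p ∈ I i B, G.dist u p + G.dist p v ≤ G.dist u v + 68 * ρ * 2 ^ i

/-! ### Clustering instances -/

/-- What is to be optimised: `k`-Clustering, or Facility Location with positive opening costs. -/
inductive Objective (n : ℕ) where
  | kClustering (k : ℕ)
  | facilityLocation (w : Fin n → Set.Ioi (0 : ℝ))

/-- An instance on a metric with point set `Fin n`: the set of facilities, the demands, and the
kind of problem with its parameters. -/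
structure Instance (n : ℕ) where
  F : Finset (Fin n)
  demand : Fin n → ℕ
  objective : Objective n

namespace Instance

variable {n : ℕ} (J : Instance n)

/-- The largest demand `X`. -/
def maxDemand : ℕ := Finset.univ.sup J.demand

/-- `⌊⌈log₂ (diam W)⌉ - 2 log₂ (n X / ε)⌋`. -/
def coarseLevel (G : WGraph n) (W : Finset (Fin n)) (ε : ℝ) : ℤ :=
  ⌊(G.topLevel W : ℝ) - 2 * Real.logb 2 ((n : ℝ) * (J.maxDemand : ℝ) / ε)⌋

/-- The instance is coarse with respect to `D`: the decomposed set contains all facilities and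
clients, and the parts of level at most `coarseLevel` contain at most one facility each. -/
structure Coarse (G : WGraph n) (D : HierDecomp n) (ε : ℝ) : Prop where
  facilities : ∀ f ∈ J.F, f ∈ D.W
  clients : ∀ v, 0 < J.demand v → v ∈ D.W
  sparse : ∀ i ≤ D.top, (i : ℤ) ≤ J.coarseLevel G D.W ε →
    ∀ B ∈ (D.part i).parts, (B ∩ J.F).card ≤ 1

end Instance

/-! ### Rounded interface-respecting distances and costs -/

/-- The rounding `⟨x⟩ᵢ = min {(69 + δ) ρ 2ⁱ | δ ∈ {1, 2, …}, ρ δ 2ⁱ ≥ x}`. -/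
def roundUp (ρ : ℝ) (i : ℕ) (x : ℝ) : ℝ :=
  sInf {y | ∃ δ : ℕ, 1 ≤ δ ∧ x ≤ ρ * δ * 2 ^ i ∧ y = (69 + δ) * ρ * 2 ^ i}

/-- The minimum in the definition of `roundUp` is attained. -/
theorem isLeast_roundUp {ρ : ℝ} (hρ : 0 < ρ) (i : ℕ) (x : ℝ) :
    IsLeast {y | ∃ δ : ℕ, 1 ≤ δ ∧ x ≤ ρ * δ * 2 ^ i ∧ y = (69 + δ) * ρ * 2 ^ i}
      (roundUp ρ i x) := by
  classical
  have hs : 0 < ρ * 2 ^ i := by positivity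
  have hex : ∃ δ : ℕ, 1 ≤ δ ∧ x ≤ ρ * δ * 2 ^ i := by
    obtain ⟨m, hm⟩ := exists_nat_ge (x / (ρ * 2 ^ i))
    rw [div_le_iff₀ hs] at hm
    refine ⟨m + 1, by omega, ?_⟩
    push_cast
    nlinarith
  have hleast : IsLeast {y | ∃ δ : ℕ, 1 ≤ δ ∧ x ≤ ρ * δ * 2 ^ i ∧ y = (69 + δ) * ρ * 2 ^ i}
      ((69 + (Nat.find hex : ℝ)) * ρ * 2 ^ i) := by
    refine ⟨⟨_, (Nat.find_spec hex).1, (Nat.find_spec hex).2, rfl⟩, ?_⟩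
    rintro y ⟨δ, h1, h2, rfl⟩
    have : (Nat.find hex : ℝ) ≤ δ := by exact_mod_cast Nat.find_min' hex ⟨h1, h2⟩
    nlinarith
  have : roundUp ρ i x = (69 + (Nat.find hex : ℝ)) * ρ * 2 ^ i := hleast.csInf_eq
  rw [this]
  exact hleast

section Cost

variable {n : ℕ} (G : WGraph n) (D : HierDecomp n) (I : ℕ → Finset (Fin n) → Finset (Fin n))
  (ρ : ℝ)

/-- The rounded interface-respecting distance `dist'(v, u)`: it is `0` if `v = u`, and otherwise
`min {dist(v, p) + ⟨dist(p, u)⟩ᵢ | p ∈ I_B}`, where `v` and `u` are cut at level `i - 1` and `B` is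
the part of level `i` that contains both. (Below, `i = j + 1`.) -/
def rdist (v u : Fin n) : ℝ≥0∞ :=
  if v = u then 0 else
    ⨅ (j : ℕ) (_ : D.CutAt j v u) (B ∈ (D.part (j + 1)).parts) (_ : v ∈ B ∧ u ∈ B)
      (p ∈ I (j + 1) B), ENNReal.ofReal (G.dist v p + roundUp ρ (j + 1) (G.dist p u))

/-- `dist'(v, S)`, which is `∞` for the empty set. -/
def rdistSet (v : Fin n) (S : Finset (Fin n)) : ℝ≥0∞ := ⨅ f ∈ S, rdist G D I ρ v f

/-- `cost'(S) = ∑ v, χ(v) * dist'(v, S) ^ q`. -/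
def rcost (J : Instance n) (q : ℕ) (S : Finset (Fin n)) : ℝ≥0∞ :=
  ∑ v, (J.demand v : ℝ≥0∞) * rdistSet G D I ρ v S ^ q

/-- The solutions of an instance: sets of facilities, at most `k` of them for `k`-Clustering. -/
def IsSolution (J : Instance n) (S : Finset (Fin n)) : Prop :=
  S ⊆ J.F ∧
    match J.objective with
    | .kClustering k => S.card ≤ k
    | .facilityLocation _ => True

/-- `cost'(S)`, plus the opening costs for Facility Location. -/
def rvalue (J : Instance n) (q : ℕ) (S : Finset (Fin n)) : ℝ≥0∞ :=
  match J.objective with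
  | .kClustering _ => rcost G D I ρ J q S
  | .facilityLocation w => rcost G D I ρ J q S + ∑ f ∈ S, ENNReal.ofReal (w f)

/-- `S` is an optimum rounded interface-respecting solution. -/
def IsOptimumRounded (J : Instance n) (q : ℕ) (S : Finset (Fin n)) : Prop :=
  IsSolution J S ∧ ∀ S', IsSolution J S' → rvalue G D I ρ J q S ≤ rvalue G D I ρ J q S'

end Cost

/-! ### The machine model: a real random access machine with unit costs

Programs work on arrays of natural numbers and arrays of real numbers; every array has three
index positions, and array names and indices are natural numbers. The available operations are
addition, truncated subtraction and multiplication of natural numbers, the field operations on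
real numbers, the conversion of a natural number to a real number, and comparisons. There are no
real constants other than these conversions, no rounding and no conversion from real to natural
numbers. Every operation, memory access, comparison and control step costs one unit. -/

/-- A memory state: the contents of cell `(i, j, k)` of array `a`. -/
structure State where
  nat : ℕ → ℕ → ℕ → ℕ → ℕ
  real : ℕ → ℕ → ℕ → ℕ → ℝ

/-- Expressions for natural numbers. -/
inductive NExp where
  | const (m : ℕ)
  | get (a : ℕ) (i j k : NExp)
  | add (x y : NExp)
  | sub (x y : NExp)
  | mul (x y : NExp)

/-- Expressions for real numbers. -/
inductive RExp where
  | ofNat (x : NExp)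
  | get (a : ℕ) (i j k : NExp)
  | add (x y : RExp)
  | sub (x y : RExp)
  | mul (x y : RExp)
  | div (x y : RExp)

/-- Tests. -/
inductive BExp where
  | natLe (x y : NExp)
  | realLe (x y : RExp)
  | neg (b : BExp)
  | conj (b b' : BExp)

/-- Programs. -/
inductive Prog where
  | skip
  | setNat (a : ℕ) (i j k : NExp) (x : NExp)
  | setReal (a : ℕ) (i j k : NExp) (x : RExp)
  | seq (P Q : Prog)
  | ite (b : BExp) (P Q : Prog)
  | while (b : BExp) (P : Prog)

namespace NExp

def eval (s : State) : NExp → ℕ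
  | const m => m
  | get a i j k => s.nat a (i.eval s) (j.eval s) (k.eval s)
  | add x y => x.eval s + y.eval s
  | sub x y => x.eval s - y.eval s
  | mul x y => x.eval s * y.eval s

def cost : NExp → ℕ
  | const _ => 1
  | get _ i j k => 1 + i.cost + j.cost + k.cost
  | add x y => 1 + x.cost + y.cost
  | sub x y => 1 + x.cost + y.cost
  | mul x y => 1 + x.cost + y.cost

end NExp

namespace RExp

def eval (s : State) : RExp → ℝ
  | ofNat x => (x.eval s : ℝ)
  | get a i j k => s.real a (i.eval s) (j.eval s) (k.eval s)
  | add x y => x.eval s + y.eval s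
  | sub x y => x.eval s - y.eval s
  | mul x y => x.eval s * y.eval s
  | div x y => x.eval s / y.eval s

def cost : RExp → ℕ
  | ofNat x => 1 + x.cost
  | get _ i j k => 1 + i.cost + j.cost + k.cost
  | add x y => 1 + x.cost + y.cost
  | sub x y => 1 + x.cost + y.cost
  | mul x y => 1 + x.cost + y.cost
  | div x y => 1 + x.cost + y.cost

end RExp

namespace BExp

def Holds (s : State) : BExp → Prop
  | natLe x y => x.eval s ≤ y.eval s
  | realLe x y => x.eval s ≤ y.eval s
  | neg b => ¬ b.Holds s
  | conj b b' => b.Holds s ∧ b'.Holds s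

def cost : BExp → ℕ
  | natLe x y => 1 + x.cost + y.cost
  | realLe x y => 1 + x.cost + y.cost
  | neg b => 1 + b.cost
  | conj b b' => 1 + b.cost + b'.cost

end BExp

/-- Overwrite one cell of one array. -/
def setCell {α : Type} (m : ℕ → ℕ → ℕ → ℕ → α) (a i j k : ℕ) (x : α) :
    ℕ → ℕ → ℕ → ℕ → α :=
  fun a' i' j' k' => if a' = a ∧ i' = i ∧ j' = j ∧ k' = k then x else m a' i' j' k'

/-- `Exec P s t s'`: started in state `s`, the program `P` halts after exactly `t` steps, in
state `s'`. -/
inductive Exec : Prog → State → ℕ → State → Prop where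
  | skip (s : State) : Exec .skip s 1 s
  | setNat (s : State) (a : ℕ) (i j k x : NExp) :
      Exec (.setNat a i j k x) s (1 + i.cost + j.cost + k.cost + x.cost)
        { s with nat := setCell s.nat a (i.eval s) (j.eval s) (k.eval s) (x.eval s) }
  | setReal (s : State) (a : ℕ) (i j k : NExp) (x : RExp) :
      Exec (.setReal a i j k x) s (1 + i.cost + j.cost + k.cost + x.cost)
        { s with real := setCell s.real a (i.eval s) (j.eval s) (k.eval s) (x.eval s) }
  | seq {P Q : Prog} {s s₁ s₂ : State} {t₁ t₂ : ℕ} :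
      Exec P s t₁ s₁ → Exec Q s₁ t₂ s₂ → Exec (.seq P Q) s (t₁ + t₂) s₂
  | iteTrue {b : BExp} {P Q : Prog} {s s₁ : State} {t : ℕ} :
      b.Holds s → Exec P s t s₁ → Exec (.ite b P Q) s (1 + b.cost + t) s₁
  | iteFalse {b : BExp} {P Q : Prog} {s s₁ : State} {t : ℕ} :
      ¬ b.Holds s → Exec Q s t s₁ → Exec (.ite b P Q) s (1 + b.cost + t) s₁
  | whileFalse {b : BExp} {P : Prog} {s : State} :
      ¬ b.Holds s → Exec (.while b P) s (1 + b.cost) s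
  | whileTrue {b : BExp} {P : Prog} {s s₁ s₂ : State} {t₁ t₂ : ℕ} :
      b.Holds s → Exec P s t₁ s₁ → Exec (.while b P) s₁ t₂ s₂ →
      Exec (.while b P) s (1 + b.cost + t₁ + t₂) s₂

/-! ### Input and output -/

section Encoding

variable {n : ℕ} (G : WGraph n) (D : HierDecomp n) (I : ℕ → Finset (Fin n) → Finset (Fin n))
  (J : Instance n) (q : ℕ) (ε ρ : ℝ)

/-- The vertex `v` of `Fin n` has the number `a`, and `P v` holds. -/
def Vertex (a : ℕ) (P : Fin n → Prop) : Prop := ∃ v : Fin n, (v : ℕ) = a ∧ P v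

open Classical in
/-- The natural-number part of the input.
Array `0`: the numbers `n`, `q`, the kind of problem (`0` or `1`), `k` and the top level.
Array `1`, `2`: membership in `W` and in `F`.
Array `3`: for two vertices of `W`, the smallest level on which they are in a common part (which
determines all partitions).
Array `4`: in cell `(v, i, p)`, whether `p` belongs to the interface of the part of level `i`,
where `1 ≤ i ≤ top`, that contains `v`.
All other cells contain `0`. -/
def inputNat : ℕ → ℕ → ℕ → ℕ → ℕ
  | 0, 0, 0, 0 => n
  | 0, 1, 0, 0 => q
  | 0, 2, 0, 0 =>
      match J.objective with
      | .kClustering _ => 0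
      | .facilityLocation _ => 1
  | 0, 3, 0, 0 =>
      match J.objective with
      | .kClustering k => k
      | .facilityLocation _ => 0
  | 0, 4, 0, 0 => D.top
  | 1, a, 0, 0 => if Vertex a (· ∈ D.W) then 1 else 0
  | 2, a, 0, 0 => if Vertex a (· ∈ J.F) then 1 else 0
  | 3, a, b, 0 =>
      if h : a < n ∧ b < n then
        if (⟨a, h.1⟩ : Fin n) ∈ D.W ∧ (⟨b, h.2⟩ : Fin n) ∈ D.W then
          D.joinLevel ⟨a, h.1⟩ ⟨b, h.2⟩ else 0
      else 0
  | 4, a, i, b =>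
      if 1 ≤ i ∧ i ≤ D.top ∧
        ∃ B ∈ (D.part i).parts, Vertex a (· ∈ B) ∧ Vertex b (· ∈ I i B) then 1 else 0
  | _, _, _, _ => 0

/-- The real-number part of the input.
Array `0`: `ε` and `ρ`.
Array `1`: the distances. Array `2`: the demands. Array `3`: the opening costs.
Array `4`: the scale `2 ^ i` of every level `i`.
All other cells contain `0`. -/
def inputReal : ℕ → ℕ → ℕ → ℕ → ℝ
  | 0, 0, 0, 0 => ε
  | 0, 1, 0, 0 => ρ
  | 1, a, b, 0 => if h : a < n ∧ b < n then G.dist ⟨a, h.1⟩ ⟨b, h.2⟩ else 0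
  | 2, a, 0, 0 => if h : a < n then (J.demand ⟨a, h⟩ : ℝ) else 0
  | 3, a, 0, 0 =>
      if h : a < n then
        match J.objective with
        | .kClustering _ => 0
        | .facilityLocation w => (w ⟨a, h⟩ : ℝ)
      else 0
  | 4, i, 0, 0 => if i ≤ D.top then 2 ^ i else 0
  | _, _, _, _ => 0

/-- The initial memory state. -/
def inputState : State where
  nat := inputNat D I J q
  real := inputReal G D J ε ρ

/-- The set of vertices that a final state stands for: those marked in array `5`. -/
def outputSet (n : ℕ) (s : State) : Finset (Fin n) :=
  Finset.univ.filter fun v => s.nat 5 v 0 0 = 1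

end Encoding

end

end ClusterDP

open ClusterDP

/-! The optimum is a shortest path in a layered graph. The vertices of `W` are listed so that every
part of every level occupies an interval (`IsOrder`, `IsOrder.contiguous`): join levels form an
ultrametric, and always moving on to a closest unvisited point has this effect. A path chooses a
state at each vertex of the list. A state records the number of facilities opened so far, one bit
telling whether the current part of level `L` contains an open facility, and, for each of the `M`
levels above `L` and each interface point of the current part on that level, a claimed rounded
distance to an open facility of the part together with a bit telling whether such a facility has
already been met. Here `L` is chosen so low that a part of level `L` contains at most one facility,
hence one bit settles what is open there. Claims stay fixed within a part and must be witnessed when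
the part ends; witness bits start anew when a part begins.

Soundness (`IsPath.setValue_le`): along an admissible path each claim is realised by an open
facility of its part, so the costs charged are at least those of the set of opened facilities.
Completeness (`exists_path`): for a solution, the smallest correct claims form an admissible path
whose cost is at most the value of the solution. Together with the correctness of the table and of
the backward reconstruction (`tab_le_pathCost`, `path_of_tab`) this gives `optimal_of_tab`.

Two estimates connect this with the rounded distance. A claim on level `i` may be backed by a
facility that is joined to the vertex on a lower level `j`, and the candidate distance must still
not be smaller than `dist'`. Precision and rounding cost at most `68 + 70 = 138` units `ρ 2^j`,
which is at most `69` units `ρ 2^i`, and these are contained in every value rounded on level `i`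
(`inputPar_rd_le`). Conversely, an interface point attaining `dist'` has a multiplier `g` below `101
/ ρ`, because the diameter contributes at most `32 * 2^j` and the additive error at most `138 ρ 2^j
≤ 69 * 2^j` (`inputPar_le_rd`). Hence claims range over `0, …, R` with `R = O(1 / ρ)`.

The number of states is `(n + 1) (R + 2)^(1 + 2 M K)`, where `K` bounds the sizes of the interfaces.
Coarseness gives `M = O(log (n X / ε))` and conciseness gives `K ≤ (h / ρ)^c`, so this is `(n X /
ε)^((h / ρ)^O(1))` (`size_le`).

The machine is handled by closure properties. `CV`, `CB` and `CS` say that a value, a test or a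
change of the data can be compiled into a program running in time polynomial in a size bound `B`
stored in memory; each compiled loop ranges over the numbers below `B`. Instances for arithmetic,
memory access, case distinctions and loops let the compilation be inferred from the formulas of the
dynamic program. By `solve_spec` the final memory satisfies the recurrences of the dynamic program,
and the rest of the argument does not mention the machine's steps. -/

namespace ClusterDP

noncomputable section

open Classical

/-! ### Polynomial time bounds and runs of programs -/

/-- A monotone function that is bounded by a polynomial. -/
def PolyT (T : ℕ → ℕ) : Prop := Monotone T ∧ ∃ c e : ℕ, ∀ b, T b ≤ c * (b + 1) ^ e

theorem PolyT.const (c : ℕ) : PolyT fun _ => c :=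
  ⟨monotone_const, c, 0, fun b => by simp⟩

theorem PolyT.add {T U : ℕ → ℕ} (hT : PolyT T) (hU : PolyT U) : PolyT fun b => T b + U b := by
  obtain ⟨mT, c, e, h⟩ := hT
  obtain ⟨mU, c', e', h'⟩ := hU
  refine ⟨mT.add mU, c + c', e + e', fun b => ?_⟩
  have h1 : (b + 1) ^ e ≤ (b + 1) ^ (e + e') := Nat.pow_le_pow_right (by omega) (by omega)
  have h2 : (b + 1) ^ e' ≤ (b + 1) ^ (e + e') := Nat.pow_le_pow_right (by omega) (by omega)
  calc T b + U b ≤ c * (b + 1) ^ e + c' * (b + 1) ^ e' := Nat.add_le_add (h b) (h' b)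
    _ ≤ c * (b + 1) ^ (e + e') + c' * (b + 1) ^ (e + e') := by gcongr
    _ = (c + c') * (b + 1) ^ (e + e') := by ring

theorem PolyT.id_mul {T : ℕ → ℕ} (hT : PolyT T) : PolyT fun b => b * T b := by
  obtain ⟨mT, c, e, h⟩ := hT
  refine ⟨fun a b hab => Nat.mul_le_mul hab (mT hab), c, e + 1, fun b => ?_⟩
  calc b * T b ≤ (b + 1) * (c * (b + 1) ^ e) := Nat.mul_le_mul (by omega) (h b)
    _ = c * (b + 1) ^ (e + 1) := by ring

/-- Started in `s`, the program halts within `b` steps in a state that satisfies `Q`. -/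
def Runs (P : Prog) (s : State) (Q : State → Prop) (b : ℕ) : Prop :=
  ∃ t s', Exec P s t s' ∧ Q s' ∧ t ≤ b

theorem Runs.mono {P : Prog} {s : State} {Q Q' : State → Prop} {b b' : ℕ} (h : Runs P s Q b)
    (hQ : ∀ s', Q s' → Q' s') (hb : b ≤ b') : Runs P s Q' b' := by
  obtain ⟨t, s', h1, h2, h3⟩ := h
  exact ⟨t, s', h1, hQ _ h2, h3.trans hb⟩

theorem Runs.seq {P P' : Prog} {s : State} {Q R : State → Prop} {b b' : ℕ} (h : Runs P s Q b)
    (h' : ∀ s', Q s' → Runs P' s' R b') : Runs (.seq P P') s R (b + b') := by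
  obtain ⟨t, s', h1, h2, h3⟩ := h
  obtain ⟨t', s'', h1', h2', h3'⟩ := h' s' h2
  exact ⟨_, _, .seq h1 h1', h2', Nat.add_le_add h3 h3'⟩

/-- Both branches are charged: a sum instead of a maximum stays within the closure properties of
`PolyT`. -/
theorem Runs.ite {b : BExp} {P P' : Prog} {s : State} {Q : State → Prop} {c c' : ℕ}
    (h : b.Holds s → Runs P s Q c) (h' : ¬ b.Holds s → Runs P' s Q c') :
    Runs (.ite b P P') s Q (1 + b.cost + (c + c')) := by
  by_cases hb : b.Holds s
  · obtain ⟨t, s', h1, h2, h3⟩ := h hb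
    exact ⟨_, _, .iteTrue hb h1, h2, by omega⟩
  · obtain ⟨t, s', h1, h2, h3⟩ := h' hb
    exact ⟨_, _, .iteFalse hb h1, h2, by omega⟩

/-- The invariant is indexed by the number of completed rounds, so termination and running time come
out together: `N` rounds and one failing test. -/
theorem Runs.while {b : BExp} {P : Prog} {c : ℕ} {N : ℕ} (Inv : ℕ → State → Prop)
    (hstep : ∀ i < N, ∀ s, Inv i s → b.Holds s ∧ Runs P s (Inv (i + 1)) c)
    (hend : ∀ s, Inv N s → ¬ b.Holds s) {s : State} (h0 : Inv 0 s) :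
    Runs (.while b P) s (Inv N) (N * (1 + b.cost + c) + (1 + b.cost)) := by
  suffices H : ∀ k i, i + k = N → ∀ s, Inv i s →
      Runs (.while b P) s (Inv N) (k * (1 + b.cost + c) + (1 + b.cost)) from
    H N 0 (by omega) s h0
  intro k
  induction k with
  | zero =>
    intro i hi s hs
    obtain rfl : i = N := by omega
    exact ⟨_, _, .whileFalse (hend s hs), hs, by omega⟩
  | succ k ih =>
    intro i hi s hs
    obtain ⟨hb, t, s', h1, h2, h3⟩ := hstep i (by omega) s hs
    obtain ⟨t', s'', h1', h2', h3'⟩ := ih (i + 1) (by omega) s' h2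
    refine ⟨_, _, .whileTrue hb h1 h1', h2', ?_⟩
    have : (k + 1) * (1 + b.cost + c) = k * (1 + b.cost + c) + (1 + b.cost + c) := by ring
    omega

/-! ### Data, local variables and values

Array `6` holds the local variables and intermediate results of compiled expressions; all other
arrays are data. -/

/-- The states agree outside of the cells of array `6` with first index at least `m`. -/
def Same (m : ℕ) (s s' : State) : Prop :=
  ∀ a i j k, (a ≠ 6 ∨ i < m) → s'.nat a i j k = s.nat a i j k ∧ s'.real a i j k = s.real a i j k

/-- The states agree on the cells of array `6` with first index below `m`. -/
def Keep (m : ℕ) (s s' : State) : Prop :=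
  ∀ i j k, i < m → s'.nat 6 i j k = s.nat 6 i j k ∧ s'.real 6 i j k = s.real 6 i j k

/-- The states agree on the cells of array `6` with first index different from `m`. -/
def Off (m : ℕ) (s s' : State) : Prop :=
  ∀ i j k, i ≠ m → s'.nat 6 i j k = s.nat 6 i j k ∧ s'.real 6 i j k = s.real 6 i j k

theorem Same.refl (m : ℕ) (s : State) : Same m s s := fun _ _ _ _ _ => ⟨rfl, rfl⟩

theorem Same.trans {m : ℕ} {s s' s'' : State} (h : Same m s s') (h' : Same m s' s'') :
    Same m s s'' := fun a i j k hc =>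
  ⟨(h' a i j k hc).1.trans (h a i j k hc).1, (h' a i j k hc).2.trans (h a i j k hc).2⟩

theorem Same.mono {m m' : ℕ} {s s' : State} (h : Same m' s s') (hm : m ≤ m') : Same m s s' :=
  fun a i j k hc => h a i j k (hc.imp_right fun h => by omega)

theorem Same.zero {m : ℕ} {s s' : State} (h : Same m s s') : Same 0 s s' := h.mono (by omega)

theorem Same.keep {m : ℕ} {s s' : State} (h : Same m s s') : Keep m s s' :=
  fun i j k hi => h 6 i j k (Or.inr hi)

theorem Keep.trans {m : ℕ} {s s' s'' : State} (h : Keep m s s') (h' : Keep m s' s'') :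
    Keep m s s'' := fun i j k hi =>
  ⟨(h' i j k hi).1.trans (h i j k hi).1, (h' i j k hi).2.trans (h i j k hi).2⟩

theorem Keep.mono {m m' : ℕ} {s s' : State} (h : Keep m' s s') (hm : m ≤ m') : Keep m s s' :=
  fun i j k hi => h i j k (by omega)

/-- The types of values that the machine computes with. -/
class Val (α : Type) [LE α] where
  Ex : Type
  eval : State → Ex → α
  cost : Ex → ℕ
  read : State → ℕ → ℕ → ℕ → ℕ → α
  write : State → ℕ → ℕ → ℕ → ℕ → α → State
  getE : ℕ → NExp → NExp → NExp → Ex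
  getE_eval : ∀ s a i j k, eval s (getE a i j k) = read s a (i.eval s) (j.eval s) (k.eval s)
  setP : ℕ → NExp → NExp → NExp → Ex → Prog
  exec : ∀ s a i j k x, Exec (setP a i j k x) s (1 + i.cost + j.cost + k.cost + cost x)
    (write s a (i.eval s) (j.eval s) (k.eval s) (eval s x))
  read_write : ∀ s a i j k x, read (write s a i j k x) a i j k = x
  read_same : ∀ m s s' a i j k, Same m s s' → (a ≠ 6 ∨ i < m) → read s' a i j k = read s a i j k
  read_keep : ∀ m s s' i j k, Keep m s s' → i < m → read s' 6 i j k = read s 6 i j k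
  read_off : ∀ m s s' i j k, Off m s s' → i ≠ m → read s' 6 i j k = read s 6 i j k
  write_off : ∀ s m j k x, Off m s (write s 6 m j k x)
  write_same : ∀ m s i j k x, m ≤ i → Same m s (write s 6 i j k x)
  write_data : ∀ σ s a i j k x, Same 0 σ s → Same 0 (write σ a i j k x) (write s a i j k x)
  write_keep : ∀ m s a i j k x, a ≠ 6 → Keep m s (write s a i j k x)
  leE : Ex → Ex → BExp
  leE_holds : ∀ s x y, (leE x y).Holds s ↔ eval s x ≤ eval s y

instance : Val ℕ where
  Ex := NExp
  eval s x := x.eval s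
  cost := NExp.cost
  read s := s.nat
  write s a i j k x := { s with nat := setCell s.nat a i j k x }
  getE := .get
  getE_eval _ _ _ _ _ := rfl
  setP := .setNat
  exec s a i j k x := .setNat s a i j k x
  read_write s a i j k x := by simp [setCell]
  read_same m s s' a i j k h hc := (h a i j k hc).1
  read_keep m s s' i j k h hc := (h i j k hc).1
  read_off m s s' i j k h hc := (h i j k hc).1
  write_off s m j k x i' j' k' hi := by simp [setCell, hi]
  write_same m s i j k x hm := by
    rintro a i' j' k' hc
    refine ⟨?_, rfl⟩
    simp only [setCell]
    rw [if_neg]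
    rintro ⟨rfl, rfl, -⟩
    rcases hc with hc | hc
    · exact hc rfl
    · omega
  write_data σ s a i j k x h a' i' j' k' hc := by
    refine ⟨?_, (h a' i' j' k' hc).2⟩
    simp only [setCell, (h a' i' j' k' hc).1]
  write_keep m s a i j k x ha i' j' k' hi := by
    refine ⟨?_, rfl⟩
    simp only [setCell]
    rw [if_neg]
    rintro ⟨rfl, -⟩
    exact ha rfl
  leE := .natLe
  leE_holds _ _ _ := Iff.rfl

instance : Val ℝ where
  Ex := RExp
  eval s x := x.eval s
  cost := RExp.cost
  read s := s.real
  write s a i j k x := { s with real := setCell s.real a i j k x }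
  getE := .get
  getE_eval _ _ _ _ _ := rfl
  setP := .setReal
  exec s a i j k x := .setReal s a i j k x
  read_write s a i j k x := by simp [setCell]
  read_same m s s' a i j k h hc := (h a i j k hc).2
  read_keep m s s' i j k h hc := (h i j k hc).2
  read_off m s s' i j k h hc := (h i j k hc).2
  write_off s m j k x i' j' k' hi := by simp [setCell, hi]
  write_same m s i j k x hm := by
    rintro a i' j' k' hc
    refine ⟨rfl, ?_⟩
    simp only [setCell]
    rw [if_neg]
    rintro ⟨rfl, rfl, -⟩
    rcases hc with hc | hc
    · exact hc rfl
    · omega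
  write_data σ s a i j k x h a' i' j' k' hc := by
    refine ⟨(h a' i' j' k' hc).1, ?_⟩
    simp only [setCell, (h a' i' j' k' hc).2]
  write_keep m s a i j k x ha i' j' k' hi := by
    refine ⟨rfl, ?_⟩
    simp only [setCell]
    rw [if_neg]
    rintro ⟨rfl, -⟩
    exact ha rfl
  leE := .realLe
  leE_holds _ _ _ := Iff.rfl

section
variable {α : Type} [LE α] [Val α]

/-- The expression for the cell `(m, 0, 0)` of array `6`. -/
def loc (α : Type) [LE α] [Val α] (m : ℕ) : Val.Ex α :=
  Val.getE 6 (.const m) (.const 0) (.const 0)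

/-- The value of the cell `(m, 0, 0)` of array `6`. -/
def rloc (α : Type) [LE α] [Val α] (m : ℕ) (s : State) : α := Val.read s 6 m 0 0

theorem eval_loc (m : ℕ) (s : State) : Val.eval s (loc α m) = rloc α m s := by
  simp [loc, rloc, Val.getE_eval, NExp.eval]

theorem rloc_same {m k : ℕ} {s s' : State} (h : Same m s s') (hk : k < m) :
    rloc α k s' = rloc α k s := Val.read_same m s s' 6 k 0 0 h (Or.inr hk)

theorem rloc_off {m k : ℕ} {s s' : State} (h : Off m s s') (hk : k ≠ m) :
    rloc α k s' = rloc α k s := Val.read_off m s s' k 0 0 h hk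

theorem rloc_keep {m k : ℕ} {s s' : State} (h : Keep m s s') (hk : k < m) :
    rloc α k s' = rloc α k s := Val.read_keep m s s' k 0 0 h hk

/-- Assign the value of an expression to the local cell `m`. -/
def setLoc (m : ℕ) (x : Val.Ex α) : Prog := Val.setP 6 (.const m) (.const 0) (.const 0) x

/-- `Same m` alone would allow changes above `m`. The stronger `Off m` is what a loop needs when its
counter at `m` is updated next to its accumulator at `m + 1`. -/
theorem Runs.setLoc (m : ℕ) (x : Val.Ex α) (s : State) :
    Runs (setLoc m x) s (fun s' => (Same m s s' ∧ rloc α m s' = Val.eval s x) ∧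
      Off m s s') (4 + Val.cost x) :=
  ⟨_, _, Val.exec s 6 (.const m) (.const 0) (.const 0) x,
    ⟨⟨Val.write_same m s m 0 0 _ le_rfl, Val.read_write s 6 m 0 0 _⟩, Val.write_off s m 0 0 _⟩, by
      simp [NExp.cost]⟩

end

/-! ### Local contexts -/

/-- A context of local variables: `holds lay v s` says that the state `s` stores the variables `v`
in the cells of array `6` with the addresses `lay 0, …, lay (depth - 1)`. -/
class Ctx (V : Type) where
  depth : ℕ
  holds : (ℕ → ℕ) → V → State → Prop
  keep : ∀ lay v s s' m, (∀ k < depth, lay k < m) → Keep m s s' → holds lay v s → holds lay v s'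
  congr : ∀ lay lay' v s, (∀ k < depth, lay k = lay' k) → holds lay v s → holds lay' v s

instance : Ctx Unit where
  depth := 0
  holds _ _ _ := True
  keep _ _ _ _ _ _ _ _ := trivial
  congr _ _ _ _ _ _ := trivial

instance {V α : Type} [Ctx V] [LE α] [Val α] : Ctx (V × α) where
  depth := Ctx.depth V + 1
  holds lay v s := Ctx.holds lay v.1 s ∧ rloc α (lay (Ctx.depth V)) s = v.2
  keep lay v s s' m hm hk h :=
    ⟨Ctx.keep lay v.1 s s' m (fun k hk => hm k (by omega)) hk h.1,
      (rloc_keep hk (hm _ (by omega))).trans h.2⟩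
  congr lay lay' v s hl h :=
    ⟨Ctx.congr lay lay' v.1 s (fun k hk => hl k (by omega)) h.1,
      by rw [← hl _ (by omega)]; exact h.2⟩

section
variable {V : Type} [Ctx V] {α β γ δ : Type} [LE α] [Val α] [LE β] [Val β] [LE γ] [Val γ]
  [LE δ] [Val δ]

/-- The program `P` computes `f` into the local cell `m`, with variables stored as in `lay`. -/
def ComputesAt (m : ℕ) (lay : ℕ → ℕ) (f : State → V → α) (P : Prog) (T : ℕ → ℕ) : Prop :=
  ∀ σ v s, Same 0 σ s → Ctx.holds lay v s →
    Runs P s (fun s' => Same m s s' ∧ rloc α m s' = f σ v) (T (σ.nat 7 0 0 0))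

/-- The function `f` of the data and of some local variables can be computed in time polynomial in
the size bound stored in the cell `(0, 0, 0)` of array `7`. -/
class CV (f : State → V → α) : Prop where
  out : ∀ m lay, (∀ k < Ctx.depth V, lay k < m) →
    ∃ P T, PolyT T ∧ ComputesAt m lay f P T

/-- The property `p` can be tested in polynomial time. -/
class CB (p : State → V → Prop) : Prop where
  out : CV fun σ v => if p σ v then (1 : ℕ) else 0

theorem CV.of_exp {f : State → V → α}
    (h : ∀ lay, ∃ E : Val.Ex α, ∀ σ v s, Same 0 σ s → Ctx.holds lay v s → Val.eval s E = f σ v) :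
    CV f where
  out m lay _ := by
    obtain ⟨E, hE⟩ := h lay
    exact ⟨setLoc m E, _, PolyT.const _, fun σ v s hs hv =>
      (Runs.setLoc m E s).mono (fun s' h => ⟨h.1.1, h.1.2.trans (hE σ v s hs hv)⟩) le_rfl⟩

/-! ### Closure properties: variables, arithmetic, memory access, case distinctions, tests -/

instance CV.const (n : ℕ) : CV fun (_ : State) (_ : V) => n :=
  .of_exp fun _ => ⟨NExp.const n, fun _ _ _ _ _ => rfl⟩

theorem CV.var0 : CV fun (_ : State) (v : V × α) => v.2 :=
  .of_exp fun lay => ⟨loc α (lay (Ctx.depth V)), fun _ _ s _ h => (eval_loc _ s).trans h.2⟩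

theorem CV.weak {f : State → V → α} (hf : CV f) : CV fun σ (v : V × β) => f σ v.1 where
  out m lay hm := by
    obtain ⟨P, T, hT, h⟩ := hf.out m lay fun k hk => hm k (Nat.lt_succ_of_lt hk)
    exact ⟨P, T, hT, fun σ v s hs hv => h σ v.1 s hs hv.1⟩

theorem CV.congr {f g : State → V → α} (hf : CV f) (h : ∀ σ v, f σ v = g σ v) : CV g := by
  have : f = g := by funext σ v; exact h σ v
  exact this ▸ hf

/-- The arguments are left in the cells `m`, `m + 1`, `m + 2`, and each computation takes its
scratch space above the results already present. Three arguments are what an array access needs; for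
its sake `op` may also depend on the data. -/
theorem CV.map3 {x : State → V → α} {y : State → V → β} {z : State → V → γ}
    (op : State → α → β → γ → δ) (E : Val.Ex α → Val.Ex β → Val.Ex γ → Val.Ex δ)
    (hE : ∀ σ s a b c, Same 0 σ s → Val.eval s (E a b c) =
      op σ (Val.eval s a) (Val.eval s b) (Val.eval s c))
    (hx : CV x) (hy : CV y) (hz : CV z) : CV fun σ v => op σ (x σ v) (y σ v) (z σ v) where
  out m lay hm := by
    obtain ⟨P, T, hT, hP⟩ := hx.out m lay hm
    obtain ⟨P', T', hT', hP'⟩ := hy.out (m + 1) lay fun k hk => (hm k hk).trans (by omega)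
    obtain ⟨P'', T'', hT'', hP''⟩ := hz.out (m + 2) lay fun k hk => (hm k hk).trans (by omega)
    refine ⟨.seq P (.seq P' (.seq P'' (setLoc m (E (loc α m) (loc β (m + 1)) (loc γ (m + 2)))))),
      _, hT.add (hT'.add (hT''.add (PolyT.const
        (4 + Val.cost (E (loc α m) (loc β (m + 1)) (loc γ (m + 2))))))), fun σ v s hs hv => ?_⟩
    refine (hP σ v s hs hv).seq fun s1 h1 => ?_
    have hv1 := Ctx.keep lay v s s1 m hm h1.1.keep hv
    have hs1 := hs.trans h1.1.zero
    refine (hP' σ v s1 hs1 hv1).seq fun s2 h2 => ?_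
    have h2' : Same m s1 s2 := h2.1.mono (by omega)
    have hv2 := Ctx.keep lay v s1 s2 m hm h2'.keep hv1
    have hs2 := hs1.trans h2.1.zero
    refine (hP'' σ v s2 hs2 hv2).seq fun s3 h3 => ?_
    have h3' : Same m s2 s3 := h3.1.mono (by omega)
    refine (Runs.setLoc m _ s3).mono (fun s4 h4 =>
      ⟨h1.1.trans (h2'.trans (h3'.trans h4.1.1)), ?_⟩) le_rfl
    rw [h4.1.2, hE σ s3 _ _ _ (hs2.trans h3.1.zero), eval_loc, eval_loc, eval_loc, h3.2,
      rloc_same h3.1 (by omega), rloc_same h3.1 (by omega), h2.2, rloc_same h2.1 (by omega), h1.2]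

theorem CV.map2 {x : State → V → α} {y : State → V → β}
    (op : α → β → δ) (E : Val.Ex α → Val.Ex β → Val.Ex δ)
    (hE : ∀ s a b, Val.eval s (E a b) = op (Val.eval s a) (Val.eval s b))
    (hx : CV x) (hy : CV y) : CV fun σ v => op (x σ v) (y σ v) :=
  CV.map3 (fun _ a b (_ : ℕ) => op a b) (fun a b _ => E a b) (fun _ s a b _ _ => hE s a b) hx hy
    (CV.const 0)

instance CV.natAdd {x y : State → V → ℕ} [hx : CV x] [hy : CV y] :
    CV fun σ v => x σ v + y σ v := CV.map2 (· + ·) NExp.add (fun _ _ _ => rfl) hx hy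

instance CV.natSub {x y : State → V → ℕ} [hx : CV x] [hy : CV y] :
    CV fun σ v => x σ v - y σ v := CV.map2 (· - ·) NExp.sub (fun _ _ _ => rfl) hx hy

instance CV.natMul {x y : State → V → ℕ} [hx : CV x] [hy : CV y] :
    CV fun σ v => x σ v * y σ v := CV.map2 (· * ·) NExp.mul (fun _ _ _ => rfl) hx hy

instance CV.natCast {x : State → V → ℕ} [hx : CV x] : CV fun σ v => (x σ v : ℝ) :=
  CV.map2 (fun (a : ℕ) (_ : ℕ) => (a : ℝ)) (fun a _ => RExp.ofNat a) (fun _ _ _ => rfl) hx hx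

instance CV.realAdd {x y : State → V → ℝ} [hx : CV x] [hy : CV y] :
    CV fun σ v => x σ v + y σ v := CV.map2 (· + ·) RExp.add (fun _ _ _ => rfl) hx hy

instance CV.realSub {x y : State → V → ℝ} [hx : CV x] [hy : CV y] :
    CV fun σ v => x σ v - y σ v := CV.map2 (· - ·) RExp.sub (fun _ _ _ => rfl) hx hy

instance CV.realMul {x y : State → V → ℝ} [hx : CV x] [hy : CV y] :
    CV fun σ v => x σ v * y σ v := CV.map2 (· * ·) RExp.mul (fun _ _ _ => rfl) hx hy

theorem CV.read {i j k : State → V → ℕ} (a : ℕ) (ha : a ≠ 6) (hi : CV i) (hj : CV j) (hk : CV k) :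
    CV fun σ v => Val.read (α := α) σ a (i σ v) (j σ v) (k σ v) :=
  CV.map3 (fun σ i j k => Val.read (α := α) σ a i j k) (fun i j k => Val.getE a i j k)
    (fun σ s i j k h => (Val.getE_eval s a i j k).trans
      (Val.read_same 0 σ s a _ _ _ h (Or.inl ha))) hi hj hk

theorem CV.natGet {i j k : State → V → ℕ} (a : ℕ) (ha : a ≠ 6) (hi : CV i) (hj : CV j)
    (hk : CV k) : CV fun σ v => σ.nat a (i σ v) (j σ v) (k σ v) :=
  CV.read (α := ℕ) a ha hi hj hk

theorem CV.realGet {i j k : State → V → ℕ} (a : ℕ) (ha : a ≠ 6) (hi : CV i) (hj : CV j)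
    (hk : CV k) : CV fun σ v => σ.real a (i σ v) (j σ v) (k σ v) :=
  CV.read (α := ℝ) a ha hi hj hk

theorem CV.branch {x y : State → V → β} {f g : State → V → α} (hx : CV x) (hy : CV y) (hf : CV f)
    (hg : CV g) : CV fun σ v => if x σ v ≤ y σ v then f σ v else g σ v where
  out m lay hm := by
    obtain ⟨P, T, hT, hP⟩ := hx.out m lay hm
    obtain ⟨P', T', hT', hP'⟩ := hy.out (m + 1) lay fun k hk => (hm k hk).trans (by omega)
    obtain ⟨Pf, Tf, hTf, hPf⟩ := hf.out m lay hm
    obtain ⟨Pg, Tg, hTg, hPg⟩ := hg.out m lay hm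
    refine ⟨.seq P (.seq P' (.ite (Val.leE (loc β m) (loc β (m + 1))) Pf Pg)),
      _, hT.add (hT'.add ((PolyT.const
        (1 + (Val.leE (loc β m) (loc β (m + 1))).cost)).add (hTf.add hTg))), fun σ v s hs hv => ?_⟩
    refine (hP σ v s hs hv).seq fun s1 h1 => ?_
    have hv1 := Ctx.keep lay v s s1 m hm h1.1.keep hv
    have hs1 := hs.trans h1.1.zero
    refine (hP' σ v s1 hs1 hv1).seq fun s2 h2 => ?_
    have h2' : Same m s1 s2 := h2.1.mono (by omega)
    have hv2 := Ctx.keep lay v s1 s2 m hm h2'.keep hv1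
    have hs2 := hs1.trans h2.1.zero
    have hb : (Val.leE (loc β m) (loc β (m + 1))).Holds s2 ↔ x σ v ≤ y σ v := by
      rw [Val.leE_holds, eval_loc, eval_loc, h2.2, rloc_same h2.1 (by omega), h1.2]
    refine Runs.ite (fun h => ?_) (fun h => ?_)
    · rw [hb] at h
      simp only [h, if_true]
      exact (hPf σ v s2 hs2 hv2).mono (fun s3 h3 => ⟨h1.1.trans (h2'.trans h3.1), h3.2⟩) le_rfl
    · rw [hb] at h
      simp only [h, if_false]
      exact (hPg σ v s2 hs2 hv2).mono (fun s3 h3 => ⟨h1.1.trans (h2'.trans h3.1), h3.2⟩) le_rfl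

/-- A test is available as its indicator, so branching is a comparison with `1`. The decidability
instance is left arbitrary in order to match any `if`. -/
instance CV.ite {p : State → V → Prop} {inst : ∀ σ v, Decidable (p σ v)} {f g : State → V → α}
    [hp : CB p] [hf : CV f] [hg : CV g] :
    CV fun σ v => @ite α (p σ v) (inst σ v) (f σ v) (g σ v) :=
  (CV.branch (CV.const 1) hp.out hf hg).congr fun σ v => by by_cases h : p σ v <;> simp [h]

instance CB.le {x y : State → V → α} [hx : CV x] [hy : CV y] : CB fun σ v => x σ v ≤ y σ v :=
  ⟨(CV.branch hx hy (CV.const 1) (CV.const 0)).congr fun _ _ => by congr⟩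

instance CB.not {p : State → V → Prop} [hp : CB p] : CB fun σ v => ¬ p σ v :=
  ⟨(CV.ite (p := p) (inst := fun _ _ => inferInstance) (hf := CV.const 0) (hg := CV.const 1)).congr
    fun σ v => by by_cases h : p σ v <;> simp [h]⟩

instance CB.and {p r : State → V → Prop} [hp : CB p] [hr : CB r] :
    CB fun σ v => p σ v ∧ r σ v :=
  ⟨(CV.ite (p := p) (inst := fun _ _ => inferInstance) (hf := hr.out) (hg := CV.const 0)).congr
    fun σ v => by by_cases h : p σ v <;> simp [h]⟩

theorem CB.congr {p r : State → V → Prop} (hp : CB p) (h : ∀ σ v, p σ v ↔ r σ v) : CB r := by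
  have : p = r := by funext σ v; exact propext (h σ v)
  exact this ▸ hp

instance CB.or {p r : State → V → Prop} [hp : CB p] [hr : CB r] :
    CB fun σ v => p σ v ∨ r σ v :=
  CB.congr (p := fun σ v => ¬ (¬ p σ v ∧ ¬ r σ v)) inferInstance fun σ v => by tauto

instance CB.imp {p r : State → V → Prop} [hp : CB p] [hr : CB r] :
    CB fun σ v => p σ v → r σ v :=
  CB.congr (p := fun σ v => ¬ (p σ v ∧ ¬ r σ v)) inferInstance fun σ v => by tauto

instance CB.iff {p r : State → V → Prop} [hp : CB p] [hr : CB r] :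
    CB fun σ v => (p σ v ↔ r σ v) :=
  CB.congr (p := fun σ v => (p σ v → r σ v) ∧ (r σ v → p σ v)) inferInstance fun σ v => by tauto

instance CB.natEq {x y : State → V → ℕ} [hx : CV x] [hy : CV y] : CB fun σ v => x σ v = y σ v :=
  CB.congr (p := fun σ v => x σ v ≤ y σ v ∧ y σ v ≤ x σ v) inferInstance fun σ v => by omega

instance CB.natLt {x y : State → V → ℕ} [hx : CV x] [hy : CV y] : CB fun σ v => x σ v < y σ v :=
  CB.congr (p := fun σ v => ¬ y σ v ≤ x σ v) inferInstance fun σ v => by omega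

instance CB.realLt {x y : State → V → ℝ} [hx : CV x] [hy : CV y] : CB fun σ v => x σ v < y σ v :=
  CB.congr (p := fun σ v => ¬ y σ v ≤ x σ v) inferInstance fun _ _ => not_le

/-! ### Bounded iteration -/

/-- Iterate `f`, starting with `a`, for `i = 0, …, N - 1`. -/
def floop {α : Type} (N : ℕ) (a : α) (f : ℕ → α → α) : α := Nat.rec a f N

/-- The layout of a context extended by two variables stored at `m` and `m + 1`. -/
def extLay (d m : ℕ) (lay : ℕ → ℕ) (k : ℕ) : ℕ :=
  if k = d then m else if k = d + 1 then m + 1 else lay k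

/-- The counter lives at `m`, the accumulator at `m + 1`; the body sees them as the two newest
variables of its context and uses the cells from `m + 2` on. The range is always the stored size
bound, so each nesting of loops costs one more factor `B`. -/
theorem CV.fold {init : State → V → α} {step : State → V → ℕ → α → α} (hi : CV init)
    (hs : CV fun σ (w : (V × ℕ) × α) => step σ w.1.1 w.1.2 w.2) :
    CV fun σ v => floop (σ.nat 7 0 0 0) (init σ v) fun i a => step σ v i a where
  out m lay hm := by
    obtain ⟨P, T, hT, hP⟩ := hi.out m lay hm
    have hm' : ∀ k < Ctx.depth ((V × ℕ) × α), extLay (Ctx.depth V) m lay k < m + 2 := by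
      intro k hk
      have hk' : k < Ctx.depth V + 1 + 1 := hk
      have := hm k
      simp only [extLay]
      split_ifs <;> omega
    obtain ⟨P', T', hT', hP'⟩ := hs.out (m + 2) (extLay (Ctx.depth V) m lay) hm'
    let test : BExp := .natLe (.add (loc ℕ m) (.const 1)) (.get 7 (.const 0) (.const 0) (.const 0))
    let body : Prog := .seq P' (.seq (setLoc (m + 1) (loc α (m + 2)))
      (setLoc (α := ℕ) m (NExp.add (loc ℕ m) (.const 1))))
    refine ⟨.seq P (.seq (setLoc (m + 1) (loc α m)) (.seq (setLoc (α := ℕ) m (NExp.const 0))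
      (.seq (.while test body) (setLoc m (loc α (m + 1)))))), _,
      hT.add ((PolyT.const (4 + Val.cost (loc α m))).add
        ((PolyT.const (4 + Val.cost (α := ℕ) (NExp.const 0))).add
        ((((PolyT.const (1 + test.cost)).add (hT'.add
          ((PolyT.const (4 + Val.cost (loc α (m + 2)))).add
          (PolyT.const (4 + Val.cost (α := ℕ) (NExp.add (loc ℕ m) (.const 1))))))).id_mul.add
          (PolyT.const (1 + test.cost))).add (PolyT.const (4 + Val.cost (loc α (m + 1))))))),
      fun σ v s hs hv => ?_⟩
    have hl : ∀ k < Ctx.depth V, lay k = extLay (Ctx.depth V) m lay k := by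
      intro k hk
      simp only [extLay]
      split_ifs <;> omega
    refine (hP σ v s hs hv).seq fun s1 h1 => ?_
    -- The initial value was computed at `m` and has to be moved before `m` becomes the counter.
    refine (Runs.setLoc (m + 1) (loc α m) s1).seq fun s2 ⟨h2, _⟩ => ?_
    refine (Runs.setLoc (α := ℕ) m (NExp.const 0) s2).seq fun s3 ⟨h3, h3'⟩ => ?_
    have h23 : Same m s1 s3 := (h2.1.mono (by omega)).trans h3.1
    let Inv : ℕ → State → Prop := fun i s' => Same m s s' ∧ rloc ℕ m s' = i ∧
      rloc α (m + 1) s' = floop i (init σ v) (fun i a => step σ v i a)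
    have h0 : Inv 0 s3 := by
      refine ⟨h1.1.trans h23, h3.2, ?_⟩
      have : rloc α (m + 1) s3 = rloc α (m + 1) s2 := rloc_off h3' (by omega)
      rw [this, h2.2, eval_loc, h1.2]
      rfl
    have htest : ∀ i s', Inv i s' → (test.Holds s' ↔ i + 1 ≤ σ.nat 7 0 0 0) := by
      rintro i s' ⟨hi1, hi2, -⟩
      have h7 : s'.nat 7 0 0 0 = σ.nat 7 0 0 0 :=
        ((hs.trans hi1.zero) 7 0 0 0 (Or.inl (by decide))).1
      have hi3 : NExp.eval s' (loc ℕ m) = i := (eval_loc (α := ℕ) m s').trans hi2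
      simp only [test, BExp.Holds, NExp.eval, hi3, h7]
    refine Runs.seq (Runs.while (N := σ.nat 7 0 0 0) Inv ?_ ?_ h0) fun s4 h4 => ?_
    · intro i hi s5 h5
      refine ⟨(htest i s5 h5).2 (by omega), ?_⟩
      obtain ⟨h51, h52, h53⟩ := h5
      have hv5 : Ctx.holds (extLay (Ctx.depth V) m lay)
          (((v, i), floop i (init σ v) (fun i a => step σ v i a)) : (V × ℕ) × α) s5 := by
        refine ⟨⟨Ctx.congr lay _ v s5 hl (Ctx.keep lay v s s5 m hm h51.keep hv), ?_⟩, ?_⟩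
        · simpa [extLay] using h52
        · have : extLay (Ctx.depth V) m lay (Ctx.depth (V × ℕ)) = m + 1 := by
            simp [extLay, Ctx.depth]
          rw [this]
          exact h53
      refine (hP' σ _ s5 (hs.trans h51.zero) hv5).seq fun s6 h6 => ?_
      refine (Runs.setLoc (m + 1) (loc α (m + 2)) s6).seq fun s7 ⟨h7, _⟩ => ?_
      refine (Runs.setLoc (α := ℕ) m (NExp.add (loc ℕ m) (.const 1)) s7).mono
        (fun s8 ⟨h8, h8'⟩ => ⟨h51.trans ((h6.1.mono (by omega)).trans
          ((h7.1.mono (by omega)).trans h8.1)), ?_, ?_⟩) le_rfl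
      · rw [h8.2]
        have : NExp.eval s7 (loc ℕ m) = i := by
          refine (eval_loc (α := ℕ) m s7).trans ?_
          rw [rloc_same h7.1 (by omega), rloc_same h6.1 (by omega), h52]
        change NExp.eval s7 (loc ℕ m) + 1 = i + 1
        rw [this]
      · rw [rloc_off h8' (by omega), h7.2, eval_loc, h6.2]
        rfl
    · intro s' h'
      rw [htest _ s' h']
      omega
    · refine (Runs.setLoc m (loc α (m + 1)) s4).mono (fun s5 ⟨h5, _⟩ => ⟨h4.1.trans h5.1, ?_⟩) le_rfl
      rw [h5.2, eval_loc, h4.2.2]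

/-! ### Commands -/

/-- The transformation `F` of the data, which may use local variables, can be carried out in time
polynomial in the final size bound. -/
class CS (F : State → V → State) : Prop where
  bound_mono : ∀ σ v, σ.nat 7 0 0 0 ≤ (F σ v).nat 7 0 0 0
  out : ∀ m lay, (∀ k < Ctx.depth V, lay k < m) →
    ∃ P T, PolyT T ∧ ∀ σ v s, Same 0 σ s → Ctx.holds lay v s →
      Runs P s (fun s' => Same 0 (F σ v) s' ∧ Keep m s s') (T ((F σ v).nat 7 0 0 0))

/-- Address and value are evaluated completely before the write. Since a write must not lower the
size bound, times measured in the old bound are bounded in terms of the new one. -/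
theorem CS.write {i j k : State → V → ℕ} {x : State → V → α} (a : ℕ) (ha : a ≠ 6)
    (hi : CV i) (hj : CV j) (hk : CV k) (hx : CV x)
    (hB : ∀ σ v, σ.nat 7 0 0 0 ≤
      (Val.write σ a (i σ v) (j σ v) (k σ v) (x σ v)).nat 7 0 0 0) :
    CS fun σ v => Val.write σ a (i σ v) (j σ v) (k σ v) (x σ v) where
  bound_mono := hB
  out m lay hm := by
    obtain ⟨Pi, Ti, hTi, hPi⟩ := hi.out m lay hm
    obtain ⟨Pj, Tj, hTj, hPj⟩ := hj.out (m + 1) lay fun k hk => (hm k hk).trans (by omega)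
    obtain ⟨Pk, Tk, hTk, hPk⟩ := hk.out (m + 2) lay fun k hk => (hm k hk).trans (by omega)
    obtain ⟨Px, Tx, hTx, hPx⟩ := hx.out (m + 3) lay fun k hk => (hm k hk).trans (by omega)
    let c : Prog := Val.setP a (loc ℕ m) (loc ℕ (m + 1)) (loc ℕ (m + 2)) (loc α (m + 3))
    let t : ℕ := 1 + NExp.cost (loc ℕ m) + NExp.cost (loc ℕ (m + 1)) + NExp.cost (loc ℕ (m + 2)) +
      Val.cost (loc α (m + 3))
    refine ⟨.seq Pi (.seq Pj (.seq Pk (.seq Px c))), _,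
      hTi.add (hTj.add (hTk.add (hTx.add (PolyT.const t)))), fun σ v s hs hv => ?_⟩
    refine Runs.mono (b := Ti (σ.nat 7 0 0 0) + (Tj (σ.nat 7 0 0 0) + (Tk (σ.nat 7 0 0 0) +
      (Tx (σ.nat 7 0 0 0) + t)))) ?_ (fun _ h => h) (by
        have := hB σ v
        have h1 := hTi.1 this
        have h2 := hTj.1 this
        have h3 := hTk.1 this
        have h4 := hTx.1 this
        omega)
    refine (hPi σ v s hs hv).seq fun s1 h1 => ?_
    have hv1 := Ctx.keep lay v s s1 m hm h1.1.keep hv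
    have hs1 := hs.trans h1.1.zero
    refine (hPj σ v s1 hs1 hv1).seq fun s2 h2 => ?_
    have h2' : Same m s1 s2 := h2.1.mono (by omega)
    have hv2 := Ctx.keep lay v s1 s2 m hm h2'.keep hv1
    have hs2 := hs1.trans h2.1.zero
    refine (hPk σ v s2 hs2 hv2).seq fun s3 h3 => ?_
    have h3' : Same m s2 s3 := h3.1.mono (by omega)
    have hv3 := Ctx.keep lay v s2 s3 m hm h3'.keep hv2
    have hs3 := hs2.trans h3.1.zero
    refine (hPx σ v s3 hs3 hv3).seq fun s4 h4 => ?_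
    have h4' : Same m s3 s4 := h4.1.mono (by omega)
    have hs4 := hs3.trans h4.1.zero
    have e1 : NExp.eval s4 (loc ℕ m) = i σ v := by
      refine (eval_loc (α := ℕ) m s4).trans ?_
      rw [rloc_same h4.1 (by omega), rloc_same h3.1 (by omega), rloc_same h2.1 (by omega), h1.2]
    have e2 : NExp.eval s4 (loc ℕ (m + 1)) = j σ v := by
      refine (eval_loc (α := ℕ) (m + 1) s4).trans ?_
      rw [rloc_same h4.1 (by omega), rloc_same h3.1 (by omega), h2.2]
    have e3 : NExp.eval s4 (loc ℕ (m + 2)) = k σ v := by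
      refine (eval_loc (α := ℕ) (m + 2) s4).trans ?_
      rw [rloc_same h4.1 (by omega), h3.2]
    have e4 : Val.eval s4 (loc α (m + 3)) = x σ v := by rw [eval_loc, h4.2]
    refine ⟨_, _, Val.exec s4 a _ _ _ _, ⟨?_, ?_⟩, le_rfl⟩
    · rw [e1, e2, e3, e4]
      exact Val.write_data σ s4 a _ _ _ _ hs4
    · exact (h1.1.trans (h2'.trans (h3'.trans h4'))).keep.trans
        (Val.write_keep m s4 a _ _ _ _ ha)

theorem CS.writeNat {i j k x : State → V → ℕ} (a : ℕ) (ha : a ≠ 6)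
    (hi : CV i) (hj : CV j) (hk : CV k) (hx : CV x)
    (hB : ∀ σ v, σ.nat 7 0 0 0 ≤ setCell σ.nat a (i σ v) (j σ v) (k σ v) (x σ v) 7 0 0 0) :
    CS fun σ v => { σ with nat := setCell σ.nat a (i σ v) (j σ v) (k σ v) (x σ v) } :=
  CS.write (α := ℕ) a ha hi hj hk hx hB

theorem CS.writeReal {i j k : State → V → ℕ} {x : State → V → ℝ} (a : ℕ) (ha : a ≠ 6)
    (hi : CV i) (hj : CV j) (hk : CV k) (hx : CV x) :
    CS fun σ v => { σ with real := setCell σ.real a (i σ v) (j σ v) (k σ v) (x σ v) } :=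
  CS.write (α := ℝ) a ha hi hj hk hx fun _ _ => le_rfl

/-- The time of the first command is polynomial in the intermediate size bound, hence, by
monotonicity, in the final one. -/
theorem CS.seq {F G : State → V → State} (hF : CS F) (hG : CS G) :
    CS fun σ v => G (F σ v) v where
  bound_mono σ v := (hF.bound_mono σ v).trans (hG.bound_mono _ v)
  out m lay hm := by
    obtain ⟨P, T, hT, hP⟩ := hF.out m lay hm
    obtain ⟨P', T', hT', hP'⟩ := hG.out m lay hm
    refine ⟨.seq P P', _, hT.add hT', fun σ v s hs hv => ?_⟩
    refine Runs.seq ((hP σ v s hs hv).mono (fun _ h => h) (hT.1 (hG.bound_mono _ v)))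
      fun s1 h1 => ?_
    exact (hP' (F σ v) v s1 h1.1 (Ctx.keep lay v s s1 m hm h1.2 hv)).mono
      (fun s2 h2 => ⟨h2.1, h1.2.trans h2.2⟩) le_rfl

/-- The body must not touch the size bound, which is reread by every test. Here the data themselves
change, so the invariant compares the memory with the iterates of `F` and only protects local cells
below `m`. -/
theorem CS.loop {F : State → V × ℕ → State} (hF : CS F)
    (hB : ∀ σ v, (F σ v).nat 7 0 0 0 = σ.nat 7 0 0 0) :
    CS fun σ v => floop (σ.nat 7 0 0 0) σ fun i τ => F τ (v, i) := by
  have hBi : ∀ σ v i, (floop i σ fun i τ => F τ (v, i)).nat 7 0 0 0 =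
      σ.nat 7 0 0 0 := by
    intro σ v i
    induction i with
    | zero => rfl
    | succ i ih => exact (hB _ _).trans ih
  refine ⟨fun σ v => (hBi σ v _).ge, fun m lay hm => ?_⟩
  have hl : ∀ k < Ctx.depth V, lay k = extLay (Ctx.depth V) m lay k := by
    intro k hk
    have := hm k hk
    simp only [extLay]
    split_ifs <;> omega
  have hm' : ∀ k < Ctx.depth (V × ℕ), extLay (Ctx.depth V) m lay k < m + 1 := by
    intro k hk
    have hk' : k < Ctx.depth V + 1 := hk
    have := hm k
    simp only [extLay]
    split_ifs <;> omega
  obtain ⟨P, T, hT, hP⟩ := hF.out (m + 1) (extLay (Ctx.depth V) m lay) hm'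
  let test : BExp := .natLe (.add (loc ℕ m) (.const 1)) (.get 7 (.const 0) (.const 0) (.const 0))
  let body : Prog := .seq P (setLoc (α := ℕ) m (NExp.add (loc ℕ m) (.const 1)))
  refine ⟨.seq (setLoc (α := ℕ) m (NExp.const 0)) (.while test body), _,
    (PolyT.const (4 + Val.cost (α := ℕ) (NExp.const 0))).add
      ((((PolyT.const (1 + test.cost)).add (hT.add
        (PolyT.const (4 + Val.cost (α := ℕ) (NExp.add (loc ℕ m) (.const 1)))))).id_mul).add
          (PolyT.const (1 + test.cost))), fun σ v s hs hv => ?_⟩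
  rw [hBi σ v]
  refine (Runs.setLoc (α := ℕ) m (NExp.const 0) s).seq fun s1 ⟨h1, _⟩ => ?_
  let Inv : ℕ → State → Prop := fun i s' => Keep m s s' ∧ rloc ℕ m s' = i ∧
    Same 0 (floop i σ fun i τ => F τ (v, i)) s'
  have htest : ∀ i s', Inv i s' → (test.Holds s' ↔ i + 1 ≤ σ.nat 7 0 0 0) := by
    rintro i s' ⟨-, hi2, hi3⟩
    have h7 : s'.nat 7 0 0 0 = σ.nat 7 0 0 0 :=
      (hi3 7 0 0 0 (Or.inl (by decide))).1.trans (hBi σ v i)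
    have hi4 : NExp.eval s' (loc ℕ m) = i := (eval_loc (α := ℕ) m s').trans hi2
    simp only [test, BExp.Holds, NExp.eval, hi4, h7]
  refine (Runs.while (N := σ.nat 7 0 0 0) Inv ?_ ?_ ?_).mono ?_ le_rfl
  · intro i hi s5 h5
    refine ⟨(htest i s5 h5).2 (by omega), ?_⟩
    obtain ⟨h51, h52, h53⟩ := h5
    have hv5 : Ctx.holds (extLay (Ctx.depth V) m lay) ((v, i) : V × ℕ) s5 := by
      refine ⟨Ctx.congr lay _ v s5 hl (Ctx.keep lay v s s5 m hm h51 hv), ?_⟩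
      simpa [extLay] using h52
    refine Runs.seq ((hP _ (v, i) s5 h53 hv5).mono (fun _ h => h) (hT.1 ?_))
      fun s6 h6 => ?_
    · exact ((hB _ _).trans (hBi σ v i)).le
    refine (Runs.setLoc (α := ℕ) m (NExp.add (loc ℕ m) (.const 1)) s6).mono
      (fun s8 ⟨h8, _⟩ => ⟨h51.trans ((h6.2.mono (by omega)).trans h8.1.keep), ?_, ?_⟩) le_rfl
    · rw [h8.2]
      have : NExp.eval s6 (loc ℕ m) = i := by
        refine (eval_loc (α := ℕ) m s6).trans ?_
        rw [rloc_keep h6.2 (by omega), h52]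
      change NExp.eval s6 (loc ℕ m) + 1 = i + 1
      rw [this]
    · exact h6.1.trans h8.1.zero
  · intro s' h'
    rw [htest _ s' h']
    omega
  · exact ⟨h1.1.keep, h1.2, hs.trans h1.1.zero⟩
  · exact fun s' h' => ⟨h'.2.2, h'.1⟩

end

/-! ### The computable functions of the dynamic program -/

section
variable {V α β γ δ : Type} [Ctx V] [LE α] [Val α] [LE β] [Val β] [LE γ] [Val γ] [LE δ] [Val δ]

instance CV.v0 : CV fun (_ : State) (v : V × α) => v.2 := CV.var0
instance CV.v1 : CV fun (_ : State) (v : (V × α) × β) => v.1.2 := CV.v0.weak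
instance CV.v2 : CV fun (_ : State) (v : ((V × α) × β) × γ) => v.1.1.2 := CV.v1.weak
instance CV.w1 {x : State → V → α} [h : CV x] : CV fun σ (v : V × β) => x σ v.1 := h.weak
instance CV.w2 {x : State → V → α} [h : CV x] : CV fun σ (v : (V × β) × γ) => x σ v.1.1 :=
  h.weak.weak
instance CV.w3 {x : State → V → α} [h : CV x] :
    CV fun σ (v : ((V × β) × γ) × δ) => x σ v.1.1.1 := h.weak.weak.weak

instance CV.realOfNat (n : ℕ) [n.AtLeastTwo] :
    CV fun (_ : State) (_ : V) => (OfNat.ofNat n : ℝ) :=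
  (CV.natCast (x := fun _ _ => n)).congr fun _ _ => rfl

instance CV.realZero : CV fun (_ : State) (_ : V) => (0 : ℝ) :=
  (CV.natCast (x := fun _ _ => 0)).congr fun _ _ => by simp

instance CV.realOne : CV fun (_ : State) (_ : V) => (1 : ℝ) :=
  (CV.natCast (x := fun _ _ => 1)).congr fun _ _ => by simp

instance CV.realNeg {x : State → V → ℝ} [CV x] : CV fun σ v => - x σ v :=
  (inferInstance : CV fun σ v => 0 - x σ v).congr fun _ _ => by simp

end

/-- The data that the machine works with: the size bound `B`, the input, and the derived numbers
`R` (bound for the rounded distances), `L` (the lowest level below which parts contain at most one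
facility), `M` (number of levels above `L`), `K` (maximal size of an interface), `N` (number of
states of the dynamic program) and `T` (size of the decomposed set). -/
structure Par where
  B : ℕ
  n : ℕ
  q : ℕ
  kind : ℕ
  k : ℕ
  top : ℕ
  R : ℕ
  L : ℕ
  M : ℕ
  K : ℕ
  N : ℕ
  T : ℕ
  inW : ℕ → ℕ
  inF : ℕ → ℕ
  join : ℕ → ℕ → ℕ
  itf : ℕ → ℕ → ℕ → ℕ
  ρ : ℝ
  dist : ℕ → ℕ → ℝ
  dem : ℕ → ℝ
  w : ℕ → ℝ
  pow : ℕ → ℝ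

/-- The data stored in a state. -/
@[reducible] def par (σ : State) : Par where
  B := σ.nat 7 0 0 0
  n := σ.nat 0 0 0 0
  q := σ.nat 0 1 0 0
  kind := σ.nat 0 2 0 0
  k := σ.nat 0 3 0 0
  top := σ.nat 0 4 0 0
  R := σ.nat 7 1 0 0
  L := σ.nat 7 2 0 0
  M := σ.nat 7 3 0 0
  K := σ.nat 7 4 0 0
  N := σ.nat 7 5 0 0
  T := σ.nat 7 6 0 0
  inW a := σ.nat 1 a 0 0
  inF a := σ.nat 2 a 0 0
  join a b := σ.nat 3 a b 0
  itf a i b := σ.nat 4 a i b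
  ρ := σ.real 0 1 0 0
  dist a b := σ.real 1 a b 0
  dem a := σ.real 2 a 0 0
  w a := σ.real 3 a 0 0
  pow i := σ.real 4 i 0 0

/-- The order of the vertices stored in a state. -/
@[reducible] def ordOf (σ : State) (m : ℕ) : ℕ := σ.nat 8 m 0 0

section
variable {V : Type} [Ctx V] {α : Type} [LE α] [Val α]

instance CV.pB : CV fun σ (_ : V) => (par σ).B := .natGet 7 (by decide) (.const 0) (.const 0) (.const 0)
instance CV.pn : CV fun σ (_ : V) => (par σ).n := .natGet 0 (by decide) (.const 0) (.const 0) (.const 0)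
instance CV.pq : CV fun σ (_ : V) => (par σ).q := .natGet 0 (by decide) (.const 1) (.const 0) (.const 0)
instance CV.pkind : CV fun σ (_ : V) => (par σ).kind :=
  .natGet 0 (by decide) (.const 2) (.const 0) (.const 0)
instance CV.pk : CV fun σ (_ : V) => (par σ).k := .natGet 0 (by decide) (.const 3) (.const 0) (.const 0)
instance CV.ptop : CV fun σ (_ : V) => (par σ).top :=
  .natGet 0 (by decide) (.const 4) (.const 0) (.const 0)
instance CV.pR : CV fun σ (_ : V) => (par σ).R := .natGet 7 (by decide) (.const 1) (.const 0) (.const 0)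
instance CV.pL : CV fun σ (_ : V) => (par σ).L := .natGet 7 (by decide) (.const 2) (.const 0) (.const 0)
instance CV.pM : CV fun σ (_ : V) => (par σ).M := .natGet 7 (by decide) (.const 3) (.const 0) (.const 0)
instance CV.pK : CV fun σ (_ : V) => (par σ).K := .natGet 7 (by decide) (.const 4) (.const 0) (.const 0)
instance CV.pN : CV fun σ (_ : V) => (par σ).N := .natGet 7 (by decide) (.const 5) (.const 0) (.const 0)
instance CV.pT : CV fun σ (_ : V) => (par σ).T := .natGet 7 (by decide) (.const 6) (.const 0) (.const 0)
instance CV.pρ : CV fun σ (_ : V) => (par σ).ρ :=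
  .realGet 0 (by decide) (.const 1) (.const 0) (.const 0)

variable {x y z : State → V → ℕ} [hx : CV x] [hy : CV y] [hz : CV z]

instance CV.pinW : CV fun σ v => (par σ).inW (x σ v) := .natGet 1 (by decide) hx (.const 0) (.const 0)
instance CV.pinF : CV fun σ v => (par σ).inF (x σ v) := .natGet 2 (by decide) hx (.const 0) (.const 0)
instance CV.pjoin : CV fun σ v => (par σ).join (x σ v) (y σ v) :=
  .natGet 3 (by decide) hx hy (.const 0)
instance CV.pitf : CV fun σ v => (par σ).itf (x σ v) (y σ v) (z σ v) :=
  .natGet 4 (by decide) hx hy hz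
instance CV.pdist : CV fun σ v => (par σ).dist (x σ v) (y σ v) :=
  .realGet 1 (by decide) hx hy (.const 0)
instance CV.pdem : CV fun σ v => (par σ).dem (x σ v) :=
  .realGet 2 (by decide) hx (.const 0) (.const 0)
instance CV.pw : CV fun σ v => (par σ).w (x σ v) := .realGet 3 (by decide) hx (.const 0) (.const 0)
instance CV.ppow : CV fun σ v => (par σ).pow (x σ v) :=
  .realGet 4 (by decide) hx (.const 0) (.const 0)
instance CV.ordOf_get : CV fun σ v => ordOf σ (x σ v) :=
  .natGet 8 (by decide) hx (.const 0) (.const 0)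

/-- This is `CV.fold` with the range in the form in which it appears in the formulas, so that
instance search finds it. -/
instance CV.loop {init : State → V → α} {step : State → V → ℕ → α → α} [hi : CV init]
    [hs : CV fun σ (w : (V × ℕ) × α) => step σ w.1.1 w.1.2 w.2] :
    CV fun σ v => floop (par σ).B (init σ v) fun i a => step σ v i a := CV.fold hi hs

end

/-- The least `i < B` with property `P`, or `B` if there is none. -/
def firstN (B : ℕ) (P : ℕ → Prop) : ℕ := floop B B fun i a => if a = B ∧ P i then i else a

/-- The number of `i < B` with property `P`. -/
def countN (B : ℕ) (P : ℕ → Prop) : ℕ := floop B 0 fun i a => if P i then a + 1 else a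

/-- The property `P` holds for all `i < B`. -/
def allN (B : ℕ) (P : ℕ → Prop) : Prop := floop B 1 (fun i a => if P i then a else 0) = 1

/-- The minimum of the nonnegative ones among the numbers `f i`, `i < B`, where negative numbers
stand for infinity. -/
def minN (B : ℕ) (f : ℕ → ℝ) : ℝ :=
  floop B (-1) fun i a => if 0 ≤ f i ∧ (a < 0 ∨ f i < a) then f i else a

section
variable {V : Type} [Ctx V]

theorem CB.weak {β : Type} [LE β] [Val β] {p : State → V → Prop} (hp : CB p) :
    CB fun σ (v : V × β) => p σ v.1 := ⟨hp.out.weak⟩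

instance CV.of_firstN {P : State → V → ℕ → Prop} [h : CB fun σ (w : V × ℕ) => P σ w.1 w.2] :
    CV fun σ v => firstN (par σ).B fun i => P σ v i := by
  -- The loop body lives in the context extended by the accumulator, on which the test does not
  -- depend.
  have := h.weak (β := ℕ)
  unfold firstN
  beta_reduce
  infer_instance

instance CV.of_countN {P : State → V → ℕ → Prop} [h : CB fun σ (w : V × ℕ) => P σ w.1 w.2] :
    CV fun σ v => countN (par σ).B fun i => P σ v i := by
  have := h.weak (β := ℕ)
  unfold countN
  beta_reduce
  infer_instance

instance CB.of_allN {P : State → V → ℕ → Prop} [h : CB fun σ (w : V × ℕ) => P σ w.1 w.2] :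
    CB fun σ v => allN (par σ).B fun i => P σ v i := by
  have := h.weak (β := ℕ)
  unfold allN
  beta_reduce
  infer_instance

instance CV.of_minN {f : State → V → ℕ → ℝ} [h : CV fun σ (w : V × ℕ) => f σ w.1 w.2] :
    CV fun σ v => minN (par σ).B fun i => f σ v i := by
  have := h.weak (β := ℝ)
  unfold minN
  beta_reduce
  infer_instance

end

/-! Arithmetic -/

/-- The quotient `a / b`, if it is less than `B`. -/
def divN (B a b : ℕ) : ℕ := firstN B fun i => a < (i + 1) * b

/-- The remainder of `a` modulo `b`. -/
def modN (B a b : ℕ) : ℕ := a - divN B a b * b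

/-- The power `a ^ e`, for `e ≤ B`. -/
def powN (B a e : ℕ) : ℕ := floop B 1 fun i c => if i < e then c * a else c

/-- The power `a ^ e`, for `e ≤ B`, of a real number. -/
def powR (B : ℕ) (a : ℝ) (e : ℕ) : ℝ := floop B 1 fun i c => if i < e then c * a else c

/-- The digit with number `e` of the state `x`. -/
def dig (p : Par) (x e : ℕ) : ℕ :=
  modN p.B (divN p.B x ((p.n + 1) * powN p.B (p.R + 2) e)) (p.R + 2)

/-- The number of opened facilities in the state `x`. -/
def cnt (p : Par) (x : ℕ) : ℕ := modN p.B x (p.n + 1)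

/-- The position of `u` in the interface of the part of level `i` that contains `v`. -/
def rank (p : Par) (v i u : ℕ) : ℕ := countN p.B fun j => j < u ∧ p.itf v i j = 1

/-- The number of the pair of digits for the interface point `u` of the part of level
`p.L + 1 + l` that contains `v`. -/
def slot (p : Par) (v l u : ℕ) : ℕ := l * p.K + rank p v (p.L + 1 + l) u

/-- The claimed rounded distance in the state `x`. -/
def clm (p : Par) (x v l u : ℕ) : ℕ := dig p x (1 + 2 * slot p v l u)

/-- The claim has been witnessed in the state `x` if this is nonzero. -/
def wit (p : Par) (x v l u : ℕ) : ℕ := dig p x (2 + 2 * slot p v l u)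

/-- In the state `x`, the facility `v` is open. -/
def opn (p : Par) (x v : ℕ) : Prop := p.inF v = 1 ∧ dig p x 0 ≠ 0

/-- The facility `v` is open and its distance from `u` is at most `g` when rounded on level `i`. -/
def hit (p : Par) (x v i u g : ℕ) : Prop := opn p x v ∧ p.dist u v ≤ p.ρ * g * p.pow i

section
variable {V : Type} [Ctx V] {x v l u g : State → V → ℕ} {r : State → V → ℝ} [hx : CV x]
  [hv : CV v] [hl : CV l] [hu : CV u] [hg : CV g] [hr : CV r]

instance CV.of_divN : CV fun σ w => divN (par σ).B (x σ w) (v σ w) := by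
  unfold divN
  infer_instance

instance CV.of_modN : CV fun σ w => modN (par σ).B (x σ w) (v σ w) := by
  unfold modN
  infer_instance

instance CV.of_powN : CV fun σ w => powN (par σ).B (x σ w) (v σ w) := by
  unfold powN
  infer_instance

instance CV.of_powR : CV fun σ w => powR (par σ).B (r σ w) (v σ w) := by
  unfold powR
  infer_instance

instance CV.of_dig : CV fun σ w => dig (par σ) (x σ w) (v σ w) := by
  unfold dig
  infer_instance

instance CV.of_cnt : CV fun σ w => cnt (par σ) (x σ w) := by
  unfold cnt
  infer_instance

instance CV.of_rank : CV fun σ w => rank (par σ) (v σ w) (l σ w) (u σ w) := by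
  unfold rank
  infer_instance

instance CV.of_slot : CV fun σ w => slot (par σ) (v σ w) (l σ w) (u σ w) := by
  unfold slot
  infer_instance

instance CV.of_clm : CV fun σ w => clm (par σ) (x σ w) (v σ w) (l σ w) (u σ w) := by
  unfold clm
  infer_instance

instance CV.of_wit : CV fun σ w => wit (par σ) (x σ w) (v σ w) (l σ w) (u σ w) := by
  unfold wit
  infer_instance

instance CB.of_opn : CB fun σ w => opn (par σ) (x σ w) (v σ w) := by
  unfold opn
  infer_instance

instance CB.of_hit : CB fun σ w => hit (par σ) (x σ w) (v σ w) (l σ w) (u σ w) (g σ w) := by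
  unfold hit
  infer_instance

end


/-- The maximum of the numbers `f i`, `i < B`. -/
def supN (B : ℕ) (f : ℕ → ℕ) : ℕ := floop B 0 fun i a => if a < f i then f i else a

instance CV.of_supN {V : Type} [Ctx V] {f : State → V → ℕ → ℕ}
    [h : CV fun σ (w : V × ℕ) => f σ w.1 w.2] :
    CV fun σ v => supN (par σ).B fun i => f σ v i := by
  have := h.weak (β := ℕ)
  unfold supN
  beta_reduce
  infer_instance

/-! Derived parameters -/

/-- The number of levels that are needed to separate the facilities from above. -/
def levelsM (p : Par) : ℕ := supN p.B fun f => supN p.B fun f' =>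
  if p.inF f = 1 ∧ p.inF f' = 1 ∧ ¬ f = f' then p.top + 1 - p.join f f' else 0

/-- The maximal number of interface points of a part of a level above `p.L`. -/
def sizeK (p : Par) : ℕ := supN p.B fun v => supN p.B fun l =>
  if l < p.M then countN p.B fun u => p.itf v (p.L + 1 + l) u = 1 else 0

/-- The number of states. -/
def numN (p : Par) : ℕ := (p.n + 1) * powN p.B (p.R + 2) (1 + 2 * (p.M * p.K))

/-- The number of points of the decomposed set. -/
def sizeT (p : Par) : ℕ := countN p.B fun v => p.inW v = 1

/-! The order of the vertices -/

/-- The point `u` is not among the first `m` points of the order `o`. -/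
def unvisited (p : Par) (o : ℕ → ℕ) (m u : ℕ) : Prop :=
  p.inW u = 1 ∧ allN p.B fun j => j < m → ¬ o j = u

/-- The point with number `m` of the order: an unvisited point closest to the previous one. -/
def nextV (p : Par) (o : ℕ → ℕ) (m : ℕ) : ℕ :=
  firstN p.B fun u => unvisited p o m u ∧ allN p.B fun u' => unvisited p o m u' →
    (m = 0 ∨ p.join (o (m - 1)) u ≤ p.join (o (m - 1)) u')

/-! Transitions -/

/-- A witness bit in the state of a first vertex `v` of a part has to be justified by `v`. -/
def newOK (p : Par) (v x l u : ℕ) : Prop :=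
  p.itf v (p.L + 1 + l) u = 1 → wit p x v l u = 0 ∨ hit p x v (p.L + 1 + l) u (clm p x v l u)

/-- The claims in the state of a last vertex `v` of a part have to be witnessed. -/
def doneOK (p : Par) (v x l u : ℕ) : Prop :=
  p.itf v (p.L + 1 + l) u = 1 → clm p x v l u = 0 ∨ ¬ wit p x v l u = 0

/-- Within a part, claims do not change, and new witness bits have to be justified. -/
def sameOK (p : Par) (v x v' x' l u : ℕ) : Prop :=
  p.itf v (p.L + 1 + l) u = 1 → clm p x' v' l u = clm p x v l u ∧
    (wit p x' v' l u = 0 ∨ ¬ wit p x v l u = 0 ∨ hit p x' v' (p.L + 1 + l) u (clm p x v l u))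

/-- The state `x` is possible at the first vertex `v`. -/
def startOK (p : Par) (v x : ℕ) : Prop :=
  cnt p x = (if opn p x v then 1 else 0) ∧
    allN p.B fun l => allN p.B fun u => l < p.M → newOK p v x l u

/-- The state `x` is possible at the last vertex `v`. -/
def endOK (p : Par) (v x : ℕ) : Prop :=
  (p.kind = 0 → cnt p x ≤ p.k) ∧
    allN p.B fun l => allN p.B fun u => l < p.M → doneOK p v x l u

/-- The state `x` at the vertex `v` can be followed by the state `x'` at the vertex `v'`. -/
def stepOK (p : Par) (v x v' x' : ℕ) : Prop :=
  (cnt p x' = cnt p x + (if opn p x' v' then 1 else 0) ∧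
    (p.join v v' ≤ p.L → (dig p x 0 = 0 ↔ dig p x' 0 = 0))) ∧
    allN p.B fun l => allN p.B fun u => l < p.M →
      (p.join v v' ≤ p.L + 1 + l → sameOK p v x v' x' l u) ∧
      (p.L + 1 + l < p.join v v' → doneOK p v x l u ∧ newOK p v' x' l u)

/-! Costs, where negative numbers stand for infinity -/

def min2 (a b : ℝ) : ℝ := if 0 ≤ a ∧ (b < 0 ∨ a < b) then a else b

/-- The case distinction makes infinity absorbing; a plain sum with `-1` could be a finite cost. -/
def add2 (a b : ℝ) : ℝ := if a < 0 ∨ b < 0 then -1 else a + b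

def le2 (a b : ℝ) : Prop := b < 0 ∨ (0 ≤ a ∧ a ≤ b)

/-- The distance from `v` to claimed facilities on the levels above `p.L`. -/
def highDist (p : Par) (v x : ℕ) : ℝ := minN p.B fun l => minN p.B fun u =>
  if l < p.M ∧ p.itf v (p.L + 1 + l) u = 1 ∧ 1 ≤ clm p x v l u then
    p.dist v u + (69 + (clm p x v l u : ℝ)) * p.ρ * p.pow (p.L + 1 + l) else -1

/-- The distance from `v` to an open facility in the same part of level `p.L`. -/
def lowDist (p : Par) (v x : ℕ) : ℝ := minN p.B fun f => minN p.B fun u => minN p.B fun g =>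
  if (p.inF f = 1 ∧ ¬ dig p x 0 = 0 ∧ p.join v f ≤ p.L) ∧
      (p.itf v (p.join v f) u = 1 ∧ 1 ≤ g ∧ p.dist u f ≤ p.ρ * g * p.pow (p.join v f)) then
    p.dist v u + (69 + (g : ℝ)) * p.ρ * p.pow (p.join v f) else -1

/-- The distance from `v` to the open facilities. -/
def dstTo (p : Par) (v x : ℕ) : ℝ :=
  if opn p x v then 0 else min2 (highDist p v x) (lowDist p v x)

/-- The contribution of `v` to the connection cost. -/
def connCost (p : Par) (v x : ℕ) : ℝ :=
  if p.dem v ≤ 0 then 0 else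
    if dstTo p v x < 0 then -1 else p.dem v * powR p.B (dstTo p v x) p.q

/-- The contribution of `v` to the total cost. -/
def wgt (p : Par) (v x : ℕ) : ℝ := add2 (connCost p v x) (if opn p x v then p.w v else 0)

/-- The entry of the table for the vertex with number `m` and the state `x`, where `row` is the
preceding row. -/
def entry (p : Par) (o : ℕ → ℕ) (row : ℕ → ℝ) (m x : ℕ) : ℝ :=
  add2 (if m = 0 then (if startOK p (o m) x then 0 else -1) else
    minN p.B fun y => if y < p.N ∧ stepOK p (o (m - 1)) y (o m) x then row y else -1)
    (wgt p (o m) x)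

/-- The state `y` can be used in step `j` of the reconstruction of an optimal path, where `z` is
the state found in the preceding step. -/
def backOK (p : Par) (o : ℕ → ℕ) (z j y : ℕ) : Prop :=
  y < p.N ∧ (j = 0 → endOK p (o (p.T - 1)) y) ∧
    (1 ≤ j → stepOK p (o (p.T - 1 - j)) y (o (p.T - j)) z)

/-- The state found in step `j` of the reconstruction of an optimal path, which is the one at the
vertex with number `p.T - 1 - j`. -/
def backSt (p : Par) (o : ℕ → ℕ) (tab : ℕ → ℕ → ℝ) (z j : ℕ) : ℕ :=
  firstN p.B fun y => backOK p o z j y ∧ allN p.B fun y' => backOK p o z j y' →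
    le2 (tab (p.T - 1 - j) y) (tab (p.T - 1 - j) y')

/-- The mark of the vertex `v` in the output. -/
def markV (p : Par) (o : ℕ → ℕ) (tab : ℕ → ℕ → ℝ) (st : ℕ → ℕ) (v : ℕ) : ℕ :=
  if 0 ≤ tab (p.T - 1) (st 0) ∧ ¬ allN p.B (fun m => ¬ (m < p.T ∧ o m = v ∧
    opn p (st (p.T - 1 - m)) v)) then 1 else 0

/-- The table of the dynamic program stored in a state. -/
@[reducible] def tabOf (σ : State) (m x : ℕ) : ℝ := σ.real 8 m x 0

/-- The sequence of states (in reverse order) stored in a state. -/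
@[reducible] def stOf (σ : State) (j : ℕ) : ℕ := σ.nat 9 j 0 0

section
variable {V : Type} [Ctx V] {x v l u g y : State → V → ℕ} {r s : State → V → ℝ} [hx : CV x]
  [hv : CV v] [hl : CV l] [hu : CV u] [hg : CV g] [hr : CV r] [hs : CV s] [hy : CV y]

instance CV.tabOf_get : CV fun σ w => tabOf σ (x σ w) (v σ w) :=
  .realGet 8 (by decide) hx hv (.const 0)
instance CV.stOf_get : CV fun σ w => stOf σ (x σ w) :=
  .natGet 9 (by decide) hx (.const 0) (.const 0)

instance CV.of_levelsM : CV fun σ (_ : V) => levelsM (par σ) := by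
  unfold levelsM
  infer_instance
instance CV.of_sizeK : CV fun σ (_ : V) => sizeK (par σ) := by
  unfold sizeK
  infer_instance
instance CV.of_numN : CV fun σ (_ : V) => numN (par σ) := by
  unfold numN
  infer_instance
instance CV.of_sizeT : CV fun σ (_ : V) => sizeT (par σ) := by
  unfold sizeT
  infer_instance
instance CB.of_unvisited : CB fun σ w => unvisited (par σ) (ordOf σ) (x σ w) (v σ w) := by
  unfold unvisited
  infer_instance
instance CV.of_nextV : CV fun σ w => nextV (par σ) (ordOf σ) (x σ w) := by
  unfold nextV
  infer_instance
instance CB.of_newOK : CB fun σ w => newOK (par σ) (v σ w) (x σ w) (l σ w) (u σ w) := by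
  unfold newOK
  infer_instance
instance CB.of_doneOK : CB fun σ w => doneOK (par σ) (v σ w) (x σ w) (l σ w) (u σ w) := by
  unfold doneOK
  infer_instance
instance CB.of_sameOK :
    CB fun σ w => sameOK (par σ) (v σ w) (x σ w) (g σ w) (y σ w) (l σ w) (u σ w) := by
  unfold sameOK
  infer_instance
instance CB.of_startOK : CB fun σ w => startOK (par σ) (v σ w) (x σ w) := by
  unfold startOK
  infer_instance
instance CB.of_endOK : CB fun σ w => endOK (par σ) (v σ w) (x σ w) := by
  unfold endOK
  infer_instance
instance CB.of_stepOK : CB fun σ w => stepOK (par σ) (v σ w) (x σ w) (g σ w) (y σ w) := by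
  unfold stepOK
  infer_instance
instance CV.of_min2 : CV fun σ w => min2 (r σ w) (s σ w) := by
  unfold min2
  infer_instance
instance CV.of_add2 : CV fun σ w => add2 (r σ w) (s σ w) := by
  unfold add2
  infer_instance
instance CB.of_le2 : CB fun σ w => le2 (r σ w) (s σ w) := by
  unfold le2
  infer_instance
instance CV.of_highDist : CV fun σ w => highDist (par σ) (v σ w) (x σ w) := by
  unfold highDist
  infer_instance
instance CV.of_lowDist : CV fun σ w => lowDist (par σ) (v σ w) (x σ w) := by
  unfold lowDist
  infer_instance
instance CV.of_dstTo : CV fun σ w => dstTo (par σ) (v σ w) (x σ w) := by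
  unfold dstTo
  infer_instance
instance CV.of_connCost : CV fun σ w => connCost (par σ) (v σ w) (x σ w) := by
  unfold connCost
  infer_instance
instance CV.of_wgt : CV fun σ w => wgt (par σ) (v σ w) (x σ w) := by
  unfold wgt
  infer_instance
instance CV.of_entry : CV fun σ w =>
    entry (par σ) (ordOf σ) (fun z => tabOf σ (v σ w) z) (l σ w) (x σ w) := by
  unfold entry
  infer_instance
instance CB.of_backOK : CB fun σ w => backOK (par σ) (ordOf σ) (v σ w) (l σ w) (x σ w) := by
  unfold backOK
  infer_instance
instance CV.of_backSt : CV fun σ w => backSt (par σ) (ordOf σ) (tabOf σ) (v σ w) (l σ w) := by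
  unfold backSt
  infer_instance
instance CV.of_markV : CV fun σ w => markV (par σ) (ordOf σ) (tabOf σ) (stOf σ) (v σ w) := by
  unfold markV
  infer_instance

end

/-! ### The program -/

/-- Store `x` in the cell `(i, 0, 0)` of array `7`. -/
def put7 (i x : ℕ) (σ : State) : State := { σ with nat := setCell σ.nat 7 i 0 0 x }

theorem par_put7_0 (x : ℕ) (σ : State) : par (put7 0 x σ) = { par σ with B := x } := by
  simp [par, put7, setCell]
theorem par_put7_1 (x : ℕ) (σ : State) : par (put7 1 x σ) = { par σ with R := x } := by
  simp [par, put7, setCell]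
theorem par_put7_2 (x : ℕ) (σ : State) : par (put7 2 x σ) = { par σ with L := x } := by
  simp [par, put7, setCell]
theorem par_put7_3 (x : ℕ) (σ : State) : par (put7 3 x σ) = { par σ with M := x } := by
  simp [par, put7, setCell]
theorem par_put7_4 (x : ℕ) (σ : State) : par (put7 4 x σ) = { par σ with K := x } := by
  simp [par, put7, setCell]
theorem par_put7_5 (x : ℕ) (σ : State) : par (put7 5 x σ) = { par σ with N := x } := by
  simp [par, put7, setCell]
theorem par_put7_6 (x : ℕ) (σ : State) : par (put7 6 x σ) = { par σ with T := x } := by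
  simp [par, put7, setCell]

theorem CS.put7 (i : ℕ) (hi : i ≠ 0) {x : State → Unit → ℕ} (hx : CV x) :
    CS fun σ v => put7 i (x σ v) σ :=
  CS.writeNat 7 (by decide) (.const i) (.const 0) (.const 0) hx fun σ v => by
    simp [setCell, hi.symm]

theorem CS.grow {x : State → Unit → ℕ} (hx : CV x) :
    CS fun σ v => ClusterDP.put7 0 ((par σ).B + x σ v) σ :=
  CS.writeNat 7 (by decide) (.const 0) (.const 0) (.const 0) inferInstance fun σ v => by
    simp [setCell]

/-- Compute the derived parameters. -/
def prep (σ : State) : State :=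
  let σ := put7 1 (par σ).B σ
  let σ := put7 0 ((par σ).B + ((par σ).n + (par σ).q + 2)) σ
  let σ := put7 3 (levelsM (par σ)) σ
  let σ := put7 2 ((par σ).top - (par σ).M) σ
  let σ := put7 0 ((par σ).B + (par σ).M) σ
  let σ := put7 4 (sizeK (par σ)) σ
  let σ := put7 0 ((par σ).B + (1 + 2 * ((par σ).M * (par σ).K))) σ
  let σ := put7 5 (numN (par σ)) σ
  let σ := put7 0 ((par σ).B + (par σ).N) σ
  put7 6 (sizeT (par σ)) σ

/-- A loop reaches only up to the current size bound, so the bound grows before each quantity that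
needs a longer range: beyond `n` and `q` before `M`, by `M` before `K`, by the number of digits
before the power in `N`, and by `N` so that all states are reached. The value found by the search
loop is saved as `R` beforehand. -/
theorem CS.prep : CS fun σ (_ : Unit) => prep σ :=
  ((((((((((CS.put7 1 (by decide) (x := fun σ _ => (par σ).B) inferInstance).seq
    (CS.grow (x := fun σ _ => (par σ).n + (par σ).q + 2) (by infer_instance))).seq
    (CS.put7 3 (by decide) (x := fun σ _ => levelsM (par σ)) inferInstance)).seq
    (CS.put7 2 (by decide) (x := fun σ _ => (par σ).top - (par σ).M) inferInstance)).seq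
    (CS.grow (x := fun σ _ => (par σ).M) inferInstance)).seq
    (CS.put7 4 (by decide) (x := fun σ _ => sizeK (par σ)) inferInstance)).seq
    (CS.grow (x := fun σ _ => 1 + 2 * ((par σ).M * (par σ).K)) (by infer_instance))).seq
    (CS.put7 5 (by decide) (x := fun σ _ => numN (par σ)) inferInstance)).seq
    (CS.grow (x := fun σ _ => (par σ).N) inferInstance)).seq
    (CS.put7 6 (by decide) (x := fun σ _ => sizeT (par σ)) inferInstance))

/-- Successively fill the array `a` of natural numbers. -/
def fillN (a : ℕ) (f : State → ℕ → ℕ) (σ : State) : State :=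
  floop (σ.nat 7 0 0 0) σ fun i τ => { τ with nat := setCell τ.nat a i 0 0 (f τ i) }

/-- Successively fill the array `a` of real numbers. -/
def fillR (a : ℕ) (f : State → ℕ → ℕ → ℝ) (σ : State) : State :=
  floop (σ.nat 7 0 0 0) σ fun i τ => floop (τ.nat 7 0 0 0) τ fun j τ =>
    { τ with real := setCell τ.real a i j 0 (f τ i j) }

theorem CS.fillN (a : ℕ) (h6 : a ≠ 6) (h7 : a ≠ 7) {f : State → ℕ → ℕ}
    (hf : CV fun σ (v : Unit × ℕ) => f σ v.2) : CS fun σ (_ : Unit) => fillN a f σ :=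
  CS.loop (F := fun σ (v : Unit × ℕ) =>
      { σ with nat := setCell σ.nat a v.2 0 0 (f σ v.2) })
    (CS.writeNat a h6 inferInstance (.const 0) (.const 0) hf fun σ v => by
      simp [setCell, h7.symm])
    fun σ v => by simp [setCell, h7.symm]

theorem CS.fillR (a : ℕ) (h6 : a ≠ 6) {f : State → ℕ → ℕ → ℝ}
    (hf : CV fun σ (v : (Unit × ℕ) × ℕ) => f σ v.1.2 v.2) :
    CS fun σ (_ : Unit) => fillR a f σ := by
  have h1 : ∀ (i k : ℕ) (τ : State), (floop k τ fun j τ =>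
      { τ with real := setCell τ.real a i j 0 (f τ i j) }).nat = τ.nat := by
    intro i k τ
    induction k with
    | zero => rfl
    | succ k ih => exact ih
  exact CS.loop (F := fun σ (v : Unit × ℕ) => floop (σ.nat 7 0 0 0) σ fun j τ =>
      { τ with real := setCell τ.real a v.2 j 0 (f τ v.2 j) })
    (CS.loop (F := fun σ (v : (Unit × ℕ) × ℕ) =>
        { σ with real := setCell σ.real a v.1.2 v.2 0 (f σ v.1.2 v.2) })
      (CS.writeReal a h6 inferInstance inferInstance (.const 0) hf) fun σ v => rfl)
    fun σ v => congrFun (congrFun (congrFun (congrFun (h1 _ _ _) 7) 0) 0) 0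

/-- The states agree except for the array `a` of natural numbers. -/
def EqN (a : ℕ) (σ τ : State) : Prop := τ.real = σ.real ∧ ∀ b, b ≠ a → τ.nat b = σ.nat b

/-- The states agree except for the array `a` of real numbers. -/
def EqR (a : ℕ) (σ τ : State) : Prop := τ.nat = σ.nat ∧ ∀ b, b ≠ a → τ.real b = σ.real b

theorem EqN.trans {a : ℕ} {σ τ υ : State} (h : EqN a σ τ) (h' : EqN a τ υ) : EqN a σ υ :=
  ⟨h'.1.trans h.1, fun b hb => (h'.2 b hb).trans (h.2 b hb)⟩

theorem EqR.trans {a : ℕ} {σ τ υ : State} (h : EqR a σ τ) (h' : EqR a τ υ) : EqR a σ υ :=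
  ⟨h'.1.trans h.1, fun b hb => (h'.2 b hb).trans (h.2 b hb)⟩

theorem EqN.set (a i j k x : ℕ) (σ : State) :
    EqN a σ { σ with nat := setCell σ.nat a i j k x } :=
  ⟨rfl, fun b hb => by funext _ _ _; simp [setCell, hb]⟩

theorem EqR.set (a i j k : ℕ) (x : ℝ) (σ : State) :
    EqR a σ { σ with real := setCell σ.real a i j k x } :=
  ⟨rfl, fun b hb => by funext _ _ _; simp [setCell, hb]⟩

/-- If entry `i` depends only on the other arrays and on earlier entries, later writes cannot change
what it was computed from. The finished array therefore satisfies its own recurrence. -/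
theorem fillN_spec (a : ℕ) (f : State → ℕ → ℕ) (σ : State)
    (hf : ∀ τ τ' i, EqN a τ τ' → (∀ j < i, τ'.nat a j 0 0 = τ.nat a j 0 0) → f τ' i = f τ i) :
    EqN a σ (fillN a f σ) ∧
      ∀ i < σ.nat 7 0 0 0, (fillN a f σ).nat a i 0 0 = f (fillN a f σ) i := by
  unfold fillN
  generalize σ.nat 7 0 0 0 = k
  induction k with
  | zero => exact ⟨⟨rfl, fun _ _ => rfl⟩, fun i hi => absurd hi (by omega)⟩
  | succ k ih =>
    obtain ⟨h1, h2⟩ := ih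
    set τ := floop k σ fun i τ => { τ with nat := setCell τ.nat a i 0 0 (f τ i) } with hτ
    have h3 : (floop (k + 1) σ fun i τ => { τ with nat := setCell τ.nat a i 0 0 (f τ i) }) =
      { τ with nat := setCell τ.nat a k 0 0 (f τ k) } := rfl
    rw [h3]
    have h4 := EqN.set a k 0 0 (f τ k) τ
    have h5 : ∀ j < k, setCell τ.nat a k 0 0 (f τ k) a j 0 0 = τ.nat a j 0 0 := by
      intro j hj
      simp [setCell, hj.ne]
    refine ⟨h1.trans h4, fun i hi => ?_⟩
    rcases Nat.lt_succ_iff_lt_or_eq.1 hi with hi | rfl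
    · rw [hf τ _ i h4 fun j hj => h5 j (by omega)]
      exact (h5 i hi).trans (h2 i hi)
    · rw [hf τ _ i h4 h5]
      simp [setCell]

/-- Here an entry may depend only on earlier rows, so the order within a row is immaterial. -/
theorem fillR_spec (a : ℕ) (f : State → ℕ → ℕ → ℝ) (σ : State)
    (hf : ∀ τ τ' i j, EqR a τ τ' → (∀ i' < i, ∀ j, τ'.real a i' j 0 = τ.real a i' j 0) →
      f τ' i j = f τ i j) :
    EqR a σ (fillR a f σ) ∧ ∀ i < σ.nat 7 0 0 0, ∀ j < σ.nat 7 0 0 0,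
      (fillR a f σ).real a i j 0 = f (fillR a f σ) i j := by
  have inner : ∀ (i : ℕ) (τ : State) (l : ℕ), EqR a τ (floop l τ fun j τ =>
        { τ with real := setCell τ.real a i j 0 (f τ i j) }) ∧
      (∀ i' < i, ∀ j, (floop l τ fun j τ =>
        { τ with real := setCell τ.real a i j 0 (f τ i j) }).real a i' j 0 = τ.real a i' j 0) ∧
      ∀ j < l, (floop l τ fun j τ =>
        { τ with real := setCell τ.real a i j 0 (f τ i j) }).real a i j 0 = f τ i j := by
    intro i τ l
    induction l with
    | zero => exact ⟨⟨rfl, fun _ _ => rfl⟩, fun _ _ _ => rfl, fun i hi => absurd hi (by omega)⟩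
    | succ l ih =>
      obtain ⟨h1, h2, h3⟩ := ih
      set υ := floop l τ fun j τ => { τ with real := setCell τ.real a i j 0 (f τ i j) }
      have h4 : (floop (l + 1) τ fun j τ => { τ with real := setCell τ.real a i j 0 (f τ i j) }) =
        { υ with real := setCell υ.real a i l 0 (f υ i l) } := rfl
      rw [h4]
      have h5 := EqR.set a i l 0 (f υ i l) υ
      refine ⟨h1.trans h5, fun i' hi' j => ?_, fun j hj => ?_⟩
      · rw [← h2 i' hi' j]
        simp [setCell, hi'.ne]
      · rcases Nat.lt_succ_iff_lt_or_eq.1 hj with hj | rfl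
        · rw [← h3 j hj]
          simp [setCell, hj.ne]
        · simp only [setCell, and_self, if_true]
          exact hf τ υ i j h1 h2
  unfold fillR
  suffices H : ∀ k, EqR a σ (floop k σ fun i τ => floop (τ.nat 7 0 0 0) τ fun j τ =>
        { τ with real := setCell τ.real a i j 0 (f τ i j) }) ∧
      ∀ i < k, ∀ j < σ.nat 7 0 0 0, (floop k σ fun i τ => floop (τ.nat 7 0 0 0) τ fun j τ =>
        { τ with real := setCell τ.real a i j 0 (f τ i j) }).real a i j 0 =
        f (floop k σ fun i τ => floop (τ.nat 7 0 0 0) τ fun j τ =>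
        { τ with real := setCell τ.real a i j 0 (f τ i j) }) i j from H _
  intro k
  induction k with
  | zero => exact ⟨⟨rfl, fun _ _ => rfl⟩, fun i hi => absurd hi (by omega)⟩
  | succ k ih =>
    obtain ⟨h1, h2⟩ := ih
    set τ := floop k σ fun i τ => floop (τ.nat 7 0 0 0) τ fun j τ =>
        { τ with real := setCell τ.real a i j 0 (f τ i j) } with hτ
    have h3 : (floop (k + 1) σ fun i τ => floop (τ.nat 7 0 0 0) τ fun j τ =>
        { τ with real := setCell τ.real a i j 0 (f τ i j) }) =
        floop (τ.nat 7 0 0 0) τ fun j τ =>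
        { τ with real := setCell τ.real a k j 0 (f τ k j) } := rfl
    rw [h3]
    obtain ⟨h4, h5, h6⟩ := inner k τ (τ.nat 7 0 0 0)
    refine ⟨h1.trans h4, fun i hi j hj => ?_⟩
    rcases Nat.lt_succ_iff_lt_or_eq.1 hi with hi | rfl
    · rw [hf τ _ i j h4 fun i' hi' => h5 i' (by omega)]
      exact (h5 i hi j).trans (h2 i hi j hj)
    · rw [hf τ _ i j h4 h5]
      exact h6 j (by rw [h1.1]; exact hj)

/-- Compute the order of the vertices. -/
def fillOrd : State → State := fillN 8 fun τ i => nextV (par τ) (ordOf τ) i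

/-- Compute the table of the dynamic program. -/
def fillTab : State → State :=
  fillR 8 fun τ i j => entry (par τ) (ordOf τ) (fun z => tabOf τ (i - 1) z) i j

/-- Compute an optimal path. -/
def fillBack : State → State :=
  fillN 9 fun τ j => backSt (par τ) (ordOf τ) (tabOf τ) (stOf τ (j - 1)) j

/-- Mark the facilities to be opened. -/
def fillMark : State → State := fillN 5 fun τ v => markV (par τ) (ordOf τ) (tabOf τ) (stOf τ) v

/-- The dynamic program. -/
def solve (σ : State) : State := fillMark (fillBack (fillTab (fillOrd σ)))

theorem CS.solve : CS fun σ (_ : Unit) => solve σ :=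
  (((CS.fillN 8 (by decide) (by decide) inferInstance).seq
    (CS.fillR 8 (by decide) inferInstance)).seq
    (CS.fillN 9 (by decide) (by decide) inferInstance)).seq
    (CS.fillN 5 (by decide) (by decide) inferInstance)

theorem nextV_congr {p : Par} {o o' : ℕ → ℕ} {i : ℕ} (h : ∀ j < i, o' j = o j) :
    nextV p o' i = nextV p o i := by
  have h1 : ∀ u, unvisited p o' i u = unvisited p o i u := by
    intro u
    unfold unvisited
    congr 2
    funext j
    by_cases hj : j < i
    · simp [h j hj]
    · simp [hj]
  unfold nextV
  congr 1
  funext u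
  rw [h1]
  congr 2
  funext u'
  rw [h1]
  rcases Nat.eq_zero_or_pos i with rfl | hi
  · simp
  · rw [h (i - 1) (by omega)]

/-- The first row consults no preceding row, so the truncated index `0 - 1 = 0` does no harm. -/
theorem entry_congr {p : Par} {o : ℕ → ℕ} {row row' : ℕ → ℝ} {m x : ℕ}
    (h : 0 < m → row' = row) : entry p o row' m x = entry p o row m x := by
  unfold entry
  by_cases hm : m = 0
  · simp [hm]
  · rw [h (by omega)]

theorem backSt_congr {p : Par} {o : ℕ → ℕ} {tab : ℕ → ℕ → ℝ} {z z' j : ℕ}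
    (h : 0 < j → z' = z) : backSt p o tab z' j = backSt p o tab z j := by
  rcases Nat.eq_zero_or_pos j with rfl | hj
  · unfold backSt backOK
    simp
  · rw [h hj]

theorem par_eqN {a : ℕ} {σ τ : State} (h : EqN a σ τ) (h5 : 4 < a) (h7 : a ≠ 7) :
    par τ = par σ := by
  simp only [par, h.1, h.2 0 (by omega), h.2 1 (by omega), h.2 2 (by omega), h.2 3 (by omega),
    h.2 4 (by omega), h.2 7 h7.symm]

theorem par_eqR {a : ℕ} {σ τ : State} (h : EqR a σ τ) (h5 : 4 < a) : par τ = par σ := by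
  simp only [par, h.1, h.2 0 (by omega), h.2 1 (by omega), h.2 2 (by omega), h.2 3 (by omega),
    h.2 4 (by omega)]

/-- This is the interface between machine and mathematics: correctness of the output uses only these
recurrences and the formula for the marks. -/
theorem solve_spec (σ : State) : ∃ (o : ℕ → ℕ) (tab : ℕ → ℕ → ℝ) (st : ℕ → ℕ),
    (∀ i < (par σ).B, o i = nextV (par σ) o i) ∧
    (∀ i < (par σ).B, ∀ j < (par σ).B, tab i j = entry (par σ) o (tab (i - 1)) i j) ∧
    (∀ j < (par σ).B, st j = backSt (par σ) o tab (st (j - 1)) j) ∧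
    (∀ v < (par σ).B, (solve σ).nat 5 v 0 0 = markV (par σ) o tab st v) ∧
    (solve σ).nat 7 0 0 0 = (par σ).B := by
  unfold solve
  set σ1 := fillOrd σ
  set σ2 := fillTab σ1
  set σ3 := fillBack σ2
  obtain ⟨e1, f1⟩ := fillN_spec 8 (fun τ i => nextV (par τ) (ordOf τ) i) σ fun τ τ' i h hj => by
    rw [par_eqN h (by decide) (by decide)]
    exact nextV_congr hj
  obtain ⟨e2, f2⟩ := fillR_spec 8
      (fun τ i j => entry (par τ) (ordOf τ) (fun z => tabOf τ (i - 1) z) i j) σ1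
      fun τ τ' i j h hj => by
    have h1 : ordOf τ' = ordOf τ := by funext i; rw [ordOf, h.1]
    rw [par_eqR h (by decide), h1]
    exact entry_congr fun hi => funext fun z => hj _ (by omega) z
  obtain ⟨e3, f3⟩ := fillN_spec 9
      (fun τ j => backSt (par τ) (ordOf τ) (tabOf τ) (stOf τ (j - 1)) j) σ2 fun τ τ' j h hj => by
    rw [par_eqN h (by decide) (by decide)]
    have h1 : ordOf τ' = ordOf τ := by funext i; rw [ordOf, h.2 8 (by decide)]
    have h2 : tabOf τ' = tabOf τ := by funext i j; rw [tabOf, h.1]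
    rw [h1, h2]
    exact backSt_congr fun h0 => hj _ (by omega)
  obtain ⟨e4, f4⟩ := fillN_spec 5
      (fun τ v => markV (par τ) (ordOf τ) (tabOf τ) (stOf τ) v) σ3 fun τ τ' v h hj => by
    rw [par_eqN h (by decide) (by decide)]
    have h1 : ordOf τ' = ordOf τ := by funext i; rw [ordOf, h.2 8 (by decide)]
    have h2 : tabOf τ' = tabOf τ := by funext i j; rw [tabOf, h.1]
    have h3 : stOf τ' = stOf τ := by funext i; rw [stOf, h.2 9 (by decide)]
    rw [h1, h2, h3]
  change EqN 8 σ σ1 at e1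
  change EqR 8 σ1 σ2 at e2
  change EqN 9 σ2 σ3 at e3
  change EqN 5 σ3 (fillMark σ3) at e4
  have p1 := par_eqN e1 (by decide) (by decide)
  have p2 := (par_eqR e2 (by decide)).trans p1
  have p3 := (par_eqN e3 (by decide) (by decide)).trans p2
  have p4 := (par_eqN e4 (by decide) (by decide)).trans p3
  have b1 : σ1.nat 7 0 0 0 = (par σ).B := congrArg Par.B p1
  have b2 : σ2.nat 7 0 0 0 = (par σ).B := congrArg Par.B p2
  have b3 : σ3.nat 7 0 0 0 = (par σ).B := congrArg Par.B p3
  have o2 : ordOf σ2 = ordOf σ1 := by funext i; rw [ordOf, e2.1]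
  have o3 : ordOf σ3 = ordOf σ1 := by
    rw [← o2]; funext i; rw [ordOf, e3.2 8 (by decide)]
  have o4 : ordOf (fillMark σ3) =
      ordOf σ1 := by
    rw [← o3]; funext i; rw [ordOf, e4.2 8 (by decide)]
  have t3 : tabOf σ3 = tabOf σ2 := by funext i j; rw [tabOf, e3.1]
  have t4 : tabOf (fillMark σ3) =
      tabOf σ2 := by
    rw [← t3]; funext i j; rw [tabOf, e4.1]
  have s4 : stOf (fillMark σ3) =
      stOf σ3 := by
    funext i; rw [stOf, e4.2 9 (by decide)]
  refine ⟨ordOf σ1, tabOf σ2, stOf σ3, fun i hi => ?_, fun i hi j hj => ?_, fun j hj => ?_,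
    fun v hv => ?_, congrArg Par.B p4⟩
  · refine (f1 i hi).trans ?_
    change nextV (par σ1) (ordOf σ1) i = _
    rw [p1]
  · have h := f2 i (by rw [b1]; exact hi) j (by rw [b1]; exact hj)
    refine h.trans ?_
    change entry (par σ2) (ordOf σ2) (fun z => tabOf σ2 (i - 1) z) i j = _
    rw [p2, o2]
  · have h := f3 j (by rw [b2]; exact hj)
    refine h.trans ?_
    change backSt (par σ3) (ordOf σ3) (tabOf σ3) (stOf σ3 (j - 1)) j = _
    rw [p3, o3, t3]
  · have h := f4 v (by rw [b3]; exact hv)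
    refine h.trans ?_
    change markV (par (fillMark σ3)) (ordOf (fillMark σ3)) (tabOf (fillMark σ3))
      (stOf (fillMark σ3)) v = _
    rw [p4, o4, t4, s4]

/-! ### The search for the bound on rounded distances, and the whole program -/

/-- The test of the loop that finds a bound for the rounded distances. -/
def searchTest : BExp :=
  .conj (.neg (.realLe (.ofNat (.const 101)) (.mul (.ofNat (.get 7 (.const 0) (.const 0)
    (.const 0))) (.get 0 (.const 1) (.const 0) (.const 0)))))
    (.natLe (.const 2) (.get 0 (.const 0) (.const 0) (.const 0)))

/-- The loop that finds a bound for the rounded distances. -/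
def searchR : Prog :=
  .while searchTest
    (.setNat 7 (.const 0) (.const 0) (.const 0) (.add (.get 7 (.const 0) (.const 0) (.const 0))
      (.const 1)))

/-- Without rounding of reals, the bound has to be found by counting upwards, in time proportional
to its value. The test on `n` stops the search at `0` for a single vertex, where `n X / ε` may be
`1` and the time must not depend on `ρ`. -/
theorem runs_searchR : ∃ c : ℕ, ∀ (σ : State) (R : ℕ), σ.nat 7 0 0 0 = 0 →
    (∀ i < R, (i : ℝ) * (par σ).ρ < 101 ∧ 2 ≤ (par σ).n) →
    ¬ ((R : ℝ) * (par σ).ρ < 101 ∧ 2 ≤ (par σ).n) →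
    Runs searchR σ (fun s => s = put7 0 R σ) (c * (R + 1)) := by
  refine ⟨1 + searchTest.cost + 10, fun σ R h0 hR hR' => (Runs.while (N := R) (c := 10)
    (fun i s => s = put7 0 i σ) ?_ ?_ ?_).mono (fun _ h => h) ?_⟩
  · rintro i hi s rfl
    refine ⟨⟨?_, ?_⟩, _, _, .setNat _ _ _ _ _ _, ?_, by simp [NExp.cost]⟩
    · simpa [searchTest, BExp.Holds, RExp.eval, NExp.eval, put7, setCell] using (hR i hi).1
    · simpa [searchTest, BExp.Holds, NExp.eval, put7, setCell] using (hR i hi).2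
    · simp only [NExp.eval, put7]
      congr 1
      funext a b c d
      by_cases h : a = 7 ∧ b = 0 ∧ c = 0 ∧ d = 0 <;> simp [setCell, h]
  · rintro s rfl
    simpa [searchTest, BExp.Holds, RExp.eval, NExp.eval, put7, setCell] using hR'
  · have : (setCell σ.nat 7 0 0 0 0) = σ.nat := by
      funext a b c d
      by_cases h : a = 7 ∧ b = 0 ∧ c = 0 ∧ d = 0
      · obtain ⟨rfl, rfl, rfl, rfl⟩ := h
        simp [setCell, h0]
      · simp [setCell, h]
    simp [put7, this]
  · ring_nf
    omega

/-- The whole program, with its effect and its running time. -/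
theorem exists_program : ∃ (P : Prog) (T : ℕ → ℕ), PolyT T ∧ ∀ (σ : State) (R : ℕ),
    σ.nat 7 0 0 0 = 0 → (∀ i < R, (i : ℝ) * (par σ).ρ < 101 ∧ 2 ≤ (par σ).n) →
    ¬ ((R : ℝ) * (par σ).ρ < 101 ∧ 2 ≤ (par σ).n) →
    Runs P σ (fun s => ∀ v, s.nat 5 v 0 0 = (solve (prep (put7 0 R σ))).nat 5 v 0 0)
      (T (par (prep (put7 0 R σ))).B) := by
  obtain ⟨c, hc⟩ := runs_searchR
  have hS := CS.prep.seq CS.solve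
  obtain ⟨P, T, hT, hP⟩ := hS.out 0 (fun _ => 0) fun k hk => absurd hk (Nat.not_lt_zero k)
  have hB : ∀ σ, (solve (prep σ)).nat 7 0 0 0 = (prep σ).nat 7 0 0 0 := by
    intro σ
    obtain ⟨_, _, _, _, _, _, _, h⟩ := solve_spec (prep σ)
    exact h
  -- The search costs `c * (R + 1)`, and its result `R` is the initial size bound, which is at most
  -- the final one.
  refine ⟨.seq searchR P, fun b => (c + b * c) + T b,
    ((PolyT.const c).add (PolyT.const c).id_mul).add hT, fun σ R h0 h1 h2 => ?_⟩
  refine Runs.seq ((hc σ R h0 h1 h2).mono (fun _ h => h) ?_) fun s hs => ?_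
  · have := CS.prep.bound_mono (put7 0 R σ) ()
    have hR : (put7 0 R σ).nat 7 0 0 0 = R := by simp [put7, setCell]
    rw [hR] at this
    calc c * (R + 1) = c + R * c := by ring
      _ ≤ _ := by gcongr
  · subst hs
    refine (hP (put7 0 R σ) () _ (Same.refl 0 _) trivial).mono (fun s hs v => ?_) (le_of_eq ?_)
    · exact (hs.1 5 v 0 0 (Or.inl (by decide))).1
    · rw [hB]

/-! ### Values of the computable functions -/

theorem floop_succ {α : Type} (N : ℕ) (a : α) (f : ℕ → α → α) :
    floop (N + 1) a f = f N (floop N a f) := rfl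

theorem allN_iff {B : ℕ} {P : ℕ → Prop} : allN B P ↔ ∀ i < B, P i := by
  unfold allN
  induction B with
  | zero => simp [floop]
  | succ B ih =>
    rw [floop_succ, Nat.forall_lt_succ_right, ← ih]
    by_cases h : P B <;> simp [h]

theorem firstN_spec {B : ℕ} {P : ℕ → Prop} (h : ∃ i < B, P i) :
    firstN B P < B ∧ P (firstN B P) ∧ ∀ j < firstN B P, ¬ P j := by
  unfold firstN
  -- The induction runs over prefixes of the loop; the value `B` signals that nothing has been found
  -- yet.
  suffices H : ∀ l ≤ B, ((∃ i < l, P i) →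
      let a := floop l B fun i a => if a = B ∧ P i then i else a
      a < B ∧ P a ∧ ∀ j < a, ¬ P j) ∧
      ((¬ ∃ i < l, P i) → (floop l B fun i a => if a = B ∧ P i then i else a) = B) from
    (H B le_rfl).1 h
  intro l
  induction l with
  | zero => exact fun _ => ⟨fun ⟨i, hi, _⟩ => absurd hi (by omega), fun _ => rfl⟩
  | succ l ih =>
    intro hl
    obtain ⟨ih1, ih2⟩ := ih (by omega)
    have e : (floop (l + 1) B fun i a => if a = B ∧ P i then i else a) =
      if (floop l B fun i a => if a = B ∧ P i then i else a) = B ∧ P l then l else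
        floop l B fun i a => if a = B ∧ P i then i else a := rfl
    rw [e]
    by_cases h1 : ∃ i < l, P i
    · have h2 := ih1 h1
      rw [if_neg (fun h => by have := h2.1; omega)]
      exact ⟨fun _ => h2, fun h3 => absurd (h1.imp fun i hi => ⟨by omega, hi.2⟩) h3⟩
    · rw [ih2 h1]
      by_cases h3 : P l
      · rw [if_pos ⟨rfl, h3⟩]
        refine ⟨fun _ => ⟨by omega, h3, fun j hj hp => h1 ⟨j, hj, hp⟩⟩,
          fun h4 => absurd ⟨l, by omega, h3⟩ h4⟩
      · rw [if_neg fun h => h3 h.2]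
        refine ⟨fun ⟨i, hi, hp⟩ => ?_, fun _ => rfl⟩
        rcases Nat.lt_succ_iff_lt_or_eq.1 hi with hi | rfl
        · exact absurd ⟨i, hi, hp⟩ h1
        · exact absurd hp h3

theorem countN_eq {B : ℕ} {P : ℕ → Prop} : countN B P = ((Finset.range B).filter P).card := by
  unfold countN
  induction B with
  | zero => rfl
  | succ B ih =>
    change (if P B then floop B 0 (fun i a => if P i then a + 1 else a) + 1 else
      floop B 0 (fun i a => if P i then a + 1 else a)) = _
    rw [ih, Finset.range_add_one, Finset.filter_insert]
    by_cases h : P B <;> simp [h]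

theorem le_supN {B : ℕ} {f : ℕ → ℕ} {i : ℕ} (hi : i < B) : f i ≤ supN B f := by
  unfold supN
  induction B with
  | zero => omega
  | succ B ih =>
    rw [floop_succ]
    rcases Nat.lt_succ_iff_lt_or_eq.1 hi with hi | rfl
    · have := ih hi
      split_ifs <;> omega
    · split_ifs <;> omega

theorem supN_le {B C : ℕ} {f : ℕ → ℕ} (h : ∀ i < B, f i ≤ C) : supN B f ≤ C := by
  unfold supN
  induction B with
  | zero => exact Nat.zero_le _
  | succ B ih =>
    rw [floop_succ]
    have := ih fun i hi => h i (by omega)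
    have := h B (by omega)
    split_ifs <;> omega

theorem divN_eq {B a b : ℕ} (hb : 0 < b) (h : a / b < B) : divN B a b = a / b := by
  have h0 : a < (a / b + 1) * b := by
    have := Nat.lt_div_mul_add hb (a := a)
    linarith [Nat.add_mul (a / b) 1 b]
  obtain ⟨h1, h2, h3⟩ := firstN_spec (P := fun i => a < (i + 1) * b) ⟨a / b, h, h0⟩
  have h4 : divN B a b ≤ a / b := by
    by_contra hc
    exact h3 (a / b) (by unfold divN at hc; omega) h0
  have h5 : a / b < divN B a b + 1 := (Nat.div_lt_iff_lt_mul hb).2 h2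
  omega

theorem modN_eq {B a b : ℕ} (hb : 0 < b) (h : a / b < B) : modN B a b = a % b := by
  unfold modN
  rw [divN_eq hb h]
  have := Nat.div_add_mod a b
  rw [mul_comm] at this
  omega

theorem powN_eq {B a e : ℕ} (h : e ≤ B) : powN B a e = a ^ e := by
  have : ∀ k, floop k 1 (fun i c => if i < e then c * a else c) = a ^ (min k e) := by
    intro k
    induction k with
    | zero => simp [floop]
    | succ k ih =>
      rw [floop_succ, ih]
      by_cases hk : k < e
      · rw [if_pos hk, min_eq_left (by omega), min_eq_left (by omega), pow_succ]
      · rw [if_neg hk, min_eq_right (by omega), min_eq_right (by omega)]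
  rw [powN, this, min_eq_right h]

theorem powR_eq {B : ℕ} {a : ℝ} {e : ℕ} (h : e ≤ B) : powR B a e = a ^ e := by
  have : ∀ k, floop k 1 (fun i c => if i < e then c * a else c) = a ^ (min k e) := by
    intro k
    induction k with
    | zero => simp [floop]
    | succ k ih =>
      rw [floop_succ, ih]
      by_cases hk : k < e
      · rw [if_pos hk, min_eq_left (by omega), min_eq_left (by omega), pow_succ]
      · rw [if_neg hk, min_eq_right (by omega), min_eq_right (by omega)]
  rw [powR, this, min_eq_right h]

/-- The extended nonnegative real number that a real number stands for. -/
def toE (a : ℝ) : ℝ≥0∞ := if a < 0 then ⊤ else ENNReal.ofReal a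

theorem toE_of_nonneg {a : ℝ} (h : 0 ≤ a) : toE a = ENNReal.ofReal a := if_neg (not_lt.2 h)

theorem toE_of_neg {a : ℝ} (h : a < 0) : toE a = ⊤ := if_pos h

theorem toE_lt_top {a : ℝ} : toE a < ⊤ ↔ 0 ≤ a := by
  unfold toE
  split_ifs with h <;> simp <;> linarith

theorem le2_iff {a b : ℝ} : le2 a b ↔ toE a ≤ toE b := by
  unfold le2 toE
  by_cases ha : a < 0 <;> by_cases hb : b < 0 <;> simp only [ha, hb, if_true, if_false]
  · simp
  · simp; intro h; linarith
  · simp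
  · rw [ENNReal.ofReal_le_ofReal_iff (not_lt.1 hb)]
    simp [not_lt.1 ha]

theorem toE_min2 {a b : ℝ} : toE (min2 a b) = min (toE a) (toE b) := by
  have h := @le2_iff a b
  have h' := @le2_iff b a
  unfold min2
  split_ifs with h1
  · rw [min_eq_left]
    rw [← h]
    rcases h1.2 with h2 | h2
    · exact Or.inl h2
    · exact Or.inr ⟨h1.1, h2.le⟩
  · rw [min_eq_right]
    rw [← h']
    unfold le2
    by_contra hc
    push Not at h1 hc
    obtain ⟨h3, h4⟩ := h1 hc.1
    linarith [hc.2 h3]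

theorem toE_add2 {a b : ℝ} : toE (add2 a b) = toE a + toE b := by
  unfold add2
  by_cases ha : a < 0
  · simp [ha, toE_of_neg]
  by_cases hb : b < 0
  · simp [hb, toE_of_neg]
  rw [if_neg (by tauto), toE_of_nonneg (by linarith), toE_of_nonneg (by linarith),
    toE_of_nonneg (by linarith), ENNReal.ofReal_add (by linarith) (by linarith)]

theorem toE_minN {B : ℕ} {f : ℕ → ℝ} : toE (minN B f) = ⨅ (i : ℕ) (_ : i < B), toE (f i) := by
  unfold minN
  induction B with
  | zero => simp [floop, toE]
  | succ B ih =>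
    have e : (floop (B + 1) (-1) fun i a => if 0 ≤ f i ∧ (a < 0 ∨ f i < a) then f i else a) =
      min2 (f B) (floop B (-1) fun i a => if 0 ≤ f i ∧ (a < 0 ∨ f i < a) then f i else a) := rfl
    rw [e, toE_min2, ih]
    apply le_antisymm
    · refine le_iInf₂ fun i hi => ?_
      rcases Nat.lt_succ_iff_lt_or_eq.1 hi with hi | rfl
      · exact (min_le_right _ _).trans (iInf₂_le i hi)
      · exact min_le_left _ _
    · refine le_min (iInf₂_le B (by omega)) (le_iInf₂ fun i hi => iInf₂_le i (by omega))

/-! Digits -/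

theorem exists_digits (Q E : ℕ) (d : ℕ → ℕ) (hd : ∀ e < E, d e < Q) :
    ∃ c < Q ^ E, ∀ e < E, c / Q ^ e % Q = d e := by
  induction E with
  | zero => exact ⟨0, by simp, fun e he => absurd he (by omega)⟩
  | succ E ih =>
    obtain ⟨c, hc, h⟩ := ih fun e he => hd e (by omega)
    have hQ : 0 < Q := by have := hd E (by omega); omega
    have hdE := hd E (by omega)
    refine ⟨c + d E * Q ^ E, ?_, fun e he => ?_⟩
    · calc c + d E * Q ^ E < Q ^ E + d E * Q ^ E := by omega
        _ = (d E + 1) * Q ^ E := by ring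
        _ ≤ Q * Q ^ E := Nat.mul_le_mul_right _ (by omega)
        _ = Q ^ (E + 1) := by ring
    · rcases Nat.lt_succ_iff_lt_or_eq.1 he with he | rfl
      · obtain ⟨k, rfl⟩ : ∃ k, E = e + (k + 1) := ⟨E - e - 1, by omega⟩
        have : c + d (e + (k + 1)) * Q ^ (e + (k + 1)) =
          c + (Q * (d (e + (k + 1)) * Q ^ k)) * Q ^ e := by ring
        rw [this, Nat.add_mul_div_right _ _ (Nat.pow_pos hQ), Nat.add_mul_mod_self_left]
        exact h e he
      · rw [Nat.add_mul_div_right _ _ (Nat.pow_pos hQ), Nat.div_eq_of_lt hc, zero_add,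
          Nat.mod_eq_of_lt hdE]

theorem cnt_eq {p : Par} {x : ℕ} (hx : x < p.B) : cnt p x = x % (p.n + 1) :=
  modN_eq (by omega) ((Nat.div_le_self _ _).trans_lt hx)

theorem dig_eq {p : Par} {x e : ℕ} (hx : x < p.B) (he : e ≤ p.B) :
    dig p x e = x / ((p.n + 1) * (p.R + 2) ^ e) % (p.R + 2) := by
  unfold dig
  rw [powN_eq he, divN_eq (by positivity) ((Nat.div_le_self _ _).trans_lt hx),
    modN_eq (by omega) ((Nat.div_le_self _ _).trans_lt ((Nat.div_le_self _ _).trans_lt hx))]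

/-- The count is the remainder modulo `n + 1`, and the quotient carries the digits. Base `R + 2` has
room for the claims `0, …, R` and, even if `R = 0`, for bits. -/
theorem exists_state {p : Par} {E : ℕ} (hE : E ≤ p.B) (hN : (p.n + 1) * (p.R + 2) ^ E ≤ p.B)
    (k : ℕ) (hk : k ≤ p.n) (d : ℕ → ℕ) (hd : ∀ e < E, d e < p.R + 2) :
    ∃ x < (p.n + 1) * (p.R + 2) ^ E, cnt p x = k ∧ ∀ e < E, dig p x e = d e := by
  obtain ⟨c, hc, h⟩ := exists_digits (p.R + 2) E d hd
  have hx : k + (p.n + 1) * c < (p.n + 1) * (p.R + 2) ^ E := by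
    calc k + (p.n + 1) * c < (p.n + 1) + (p.n + 1) * c := by omega
      _ = (p.n + 1) * (c + 1) := by ring
      _ ≤ _ := Nat.mul_le_mul_left _ hc
  refine ⟨k + (p.n + 1) * c, hx, ?_, fun e he => ?_⟩
  · rw [cnt_eq (hx.trans_le hN), Nat.add_mul_mod_self_left, Nat.mod_eq_of_lt (by omega)]
  · rw [dig_eq (hx.trans_le hN) (he.le.trans hE), ← Nat.div_div_eq_div_mul,
      Nat.add_mul_div_left _ _ (by omega), Nat.div_eq_of_lt (show k < p.n + 1 by omega), zero_add]
    exact h e he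

/-! ### The order of the vertices -/

/-- The sequence `o 0, …, o (T - 1)` enumerates the decomposed set, and each point is followed by
one of the closest among the points that come later. -/
structure IsOrder (p : Par) (o : ℕ → ℕ) : Prop where
  inj : ∀ i < p.T, ∀ j < p.T, o i = o j → i = j
  mem : ∀ i < p.T, p.inW (o i) = 1
  surj : ∀ v, p.inW v = 1 → ∃ i < p.T, o i = v
  greedy : ∀ i j, i < j → j < p.T → p.join (o i) (o (i + 1)) ≤ p.join (o i) (o j)

/-- Counting shows that the search succeeds in each of the first `T` places, and `T` distinct points
exhaust the decomposed set. A later point `o j` is still unvisited when `o (i + 1)` is chosen, which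
gives the greedy inequality. -/
theorem isOrder_of_nextV {p : Par} {o : ℕ → ℕ} (hW : ∀ v, p.inW v = 1 → v < p.B)
    (hT : p.T = sizeT p) (ho : ∀ i < p.B, o i = nextV p o i) : IsOrder p o := by
  set A := (Finset.range p.B).filter fun v => p.inW v = 1 with hA
  have hTA : p.T = A.card := by
    rw [hT, sizeT, countN_eq, hA]
    congr!
  have hTB : p.T ≤ p.B := by
    rw [hTA]
    exact (Finset.card_filter_le _ _).trans (by simp)
  have hun : ∀ m u, unvisited p o m u ↔ p.inW u = 1 ∧ ∀ j < p.B, j < m → ¬ o j = u := by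
    intro m u
    rw [unvisited, allN_iff]
  have key : ∀ i < p.T, unvisited p o i (o i) ∧ ∀ u', unvisited p o i u' →
      (i = 0 ∨ p.join (o (i - 1)) (o i) ≤ p.join (o (i - 1)) u') := by
    intro i hi
    -- Otherwise the first `i < T` places would already cover the decomposed set.
    have hne : ((Finset.range p.B).filter fun u => unvisited p o i u).Nonempty := by
      by_contra hc
      rw [Finset.not_nonempty_iff_eq_empty, Finset.filter_eq_empty_iff] at hc
      have : A ⊆ (Finset.range i).image o := by
        intro v hv
        rw [hA, Finset.mem_filter] at hv
        have := hc hv.1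
        rw [hun] at this
        push Not at this
        obtain ⟨j, -, hj, rfl⟩ := this hv.2
        exact Finset.mem_image_of_mem _ (Finset.mem_range.2 hj)
      have := (Finset.card_le_card this).trans Finset.card_image_le
      rw [Finset.card_range] at this
      omega
    obtain ⟨u, hu, hmin⟩ := Finset.exists_min_image _ (fun u => p.join (o (i - 1)) u) hne
    rw [Finset.mem_filter, Finset.mem_range] at hu
    have h := firstN_spec (B := p.B) (P := fun u => unvisited p o i u ∧ allN p.B fun u' =>
      unvisited p o i u' → (i = 0 ∨ p.join (o (i - 1)) u ≤ p.join (o (i - 1)) u'))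
      ⟨u, hu.1, hu.2, allN_iff.2 fun u' hu' h' => Or.inr
        (hmin u' (Finset.mem_filter.2 ⟨Finset.mem_range.2 hu', h'⟩))⟩
    have h2 := h.2.1
    rw [allN_iff] at h2
    change unvisited p o i (nextV p o i) ∧ ∀ u' < p.B, unvisited p o i u' → (i = 0 ∨
      p.join (o (i - 1)) (nextV p o i) ≤ p.join (o (i - 1)) u') at h2
    rw [← ho i (by omega)] at h2
    exact ⟨h2.1, fun u' h' => h2.2 u' (hW _ ((hun _ _).1 h').1) h'⟩
  have inj' : ∀ i < p.T, ∀ j < i, o j ≠ o i := fun i hi j hj =>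
    ((hun _ _).1 (key i hi).1).2 j (by omega) hj
  have inj : ∀ i < p.T, ∀ j < p.T, o i = o j → i = j := by
    intro i hi j hj h
    rcases lt_trichotomy i j with h1 | h1 | h1
    · exact absurd h (inj' j hj i h1)
    · exact h1
    · exact absurd h.symm (inj' i hi j h1)
  have mem : ∀ i < p.T, p.inW (o i) = 1 := fun i hi => ((hun _ _).1 (key i hi).1).1
  refine ⟨inj, mem, fun v hv => ?_, fun i j hij hj => ?_⟩
  · have hsub : (Finset.range p.T).image o ⊆ A := by
      intro v hv
      obtain ⟨i, hi, rfl⟩ := Finset.mem_image.1 hv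
      have := mem i (Finset.mem_range.1 hi)
      exact Finset.mem_filter.2 ⟨Finset.mem_range.2 (hW _ this), this⟩
    have hcard : ((Finset.range p.T).image o).card = p.T := by
      rw [Finset.card_image_of_injOn, Finset.card_range]
      intro i hi j hj h
      exact inj i (by simpa using hi) j (by simpa using hj) h
    have heq := Finset.eq_of_subset_of_card_le hsub (by rw [hcard, hTA])
    have hvA : v ∈ A := Finset.mem_filter.2 ⟨Finset.mem_range.2 (hW v hv), hv⟩
    rw [← heq] at hvA
    obtain ⟨i, hi, h⟩ := Finset.mem_image.1 hvA
    exact ⟨i, Finset.mem_range.1 hi, h⟩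
  · have := (key (i + 1) (by omega)).2 (o j) ((hun _ _).2 ⟨mem j hj, fun l hl hli h => by
      have := inj l (by omega) j hj h
      omega⟩)
    simpa using this

/-! ### Optimal paths -/

/-- The sequence of states `x 0, …, x (T - 1)` is possible. -/
structure IsPath (p : Par) (o x : ℕ → ℕ) : Prop where
  lt : ∀ m < p.T, x m < p.N
  start : startOK p (o 0) (x 0)
  step : ∀ m, m + 1 < p.T → stepOK p (o m) (x m) (o (m + 1)) (x (m + 1))
  finish : endOK p (o (p.T - 1)) (x (p.T - 1))

/-- The cost of a sequence of states up to the index `m`. -/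
def pathCost (p : Par) (o x : ℕ → ℕ) (m : ℕ) : ℝ≥0∞ :=
  ∑ i ∈ Finset.range m, toE (wgt p (o i) (x i))

theorem toE_entry_zero {p : Par} {o : ℕ → ℕ} {row : ℕ → ℝ} {x : ℕ} (h : startOK p (o 0) x) :
    toE (entry p o row 0 x) = toE (wgt p (o 0) x) := by
  simp [entry, toE_add2, h, toE_of_nonneg]

theorem startOK_of_entry {p : Par} {o : ℕ → ℕ} {row : ℕ → ℝ} {x : ℕ}
    (h : 0 ≤ entry p o row 0 x) : startOK p (o 0) x := by
  by_contra hc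
  rw [← toE_lt_top] at h
  simp [entry, toE_add2, hc, toE_of_neg] at h

theorem toE_entry_succ {p : Par} {o : ℕ → ℕ} {row : ℕ → ℝ} {m x : ℕ} :
    toE (entry p o row (m + 1) x) = (⨅ (y : ℕ) (_ : y < p.B),
      toE (if y < p.N ∧ stepOK p (o m) y (o (m + 1)) x then row y else -1)) +
      toE (wgt p (o (m + 1)) x) := by
  simp [entry, toE_add2, toE_minN]

section
variable {p : Par} {o : ℕ → ℕ} {tab : ℕ → ℕ → ℝ} {st : ℕ → ℕ}

/-- The predecessor on any given path is a candidate in the minimum defining an entry, so the table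
never exceeds the cost of a path. -/
theorem tab_le_pathCost (hNB : p.N ≤ p.B) (hTB : p.T ≤ p.B)
    (htab : ∀ i < p.B, ∀ j < p.B, tab i j = entry p o (tab (i - 1)) i j) {x : ℕ → ℕ}
    (hx : IsPath p o x) : ∀ m < p.T, toE (tab m (x m)) ≤ pathCost p o x (m + 1) := by
  intro m
  induction m with
  | zero =>
    intro hm
    have := hx.lt 0 hm
    rw [htab 0 (by omega) _ (by omega), toE_entry_zero hx.start]
    simp [pathCost]
  | succ m ih =>
    intro hm
    have h1 := hx.lt (m + 1) hm
    have h0 := hx.lt m (by omega)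
    rw [htab (m + 1) (by omega) _ (by omega), toE_entry_succ, pathCost, Finset.sum_range_succ]
    gcongr
    refine (iInf₂_le (x m) (by omega)).trans ?_
    rw [if_pos ⟨h0, hx.step m hm⟩]
    exact ih (by omega)

theorem backSt_spec (hNB : p.N ≤ p.B) (hst : ∀ j < p.B, st j = backSt p o tab (st (j - 1)) j)
    {j : ℕ} (hj : j < p.B) (hy : ∃ y, backOK p o (st (j - 1)) j y) :
    backOK p o (st (j - 1)) j (st j) ∧ ∀ y, backOK p o (st (j - 1)) j y →
      toE (tab (p.T - 1 - j) (st j)) ≤ toE (tab (p.T - 1 - j) y) := by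
  have hne : ((Finset.range p.B).filter fun y => backOK p o (st (j - 1)) j y).Nonempty := by
    obtain ⟨y, hy⟩ := hy
    exact ⟨y, Finset.mem_filter.2 ⟨Finset.mem_range.2 (hy.1.trans_le hNB), hy⟩⟩
  obtain ⟨u, hu, hmin⟩ := Finset.exists_min_image _ (fun u => toE (tab (p.T - 1 - j) u)) hne
  rw [Finset.mem_filter, Finset.mem_range] at hu
  have h := firstN_spec (B := p.B) (P := fun y => backOK p o (st (j - 1)) j y ∧
    allN p.B fun y' => backOK p o (st (j - 1)) j y' →
      le2 (tab (p.T - 1 - j) y) (tab (p.T - 1 - j) y')) ⟨u, hu.1, hu.2, allN_iff.2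
        fun y' hy' h' => le2_iff.2 (hmin y' (Finset.mem_filter.2 ⟨Finset.mem_range.2 hy', h'⟩))⟩
  have h2 := h.2.1
  rw [allN_iff] at h2
  change backOK p o (st (j - 1)) j (backSt p o tab (st (j - 1)) j) ∧ ∀ y' < p.B,
    backOK p o (st (j - 1)) j y' → le2 (tab (p.T - 1 - j) (backSt p o tab (st (j - 1)) j))
      (tab (p.T - 1 - j) y') at h2
  rw [← hst j hj] at h2
  exact ⟨h2.1, fun y hy => le2_iff.1 (h2.2 y (hy.1.trans_le hNB) hy)⟩

/-- A predecessor with the least entry among the compatible states attains the minimum in the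
recurrence. Finiteness is thus inherited backwards, and the costs along the reconstructed path
telescope to the final entry. -/
theorem path_of_tab (hNB : p.N ≤ p.B) (hTB : p.T ≤ p.B)
    (htab : ∀ i < p.B, ∀ j < p.B, tab i j = entry p o (tab (i - 1)) i j) (hT : 1 ≤ p.T)
    (hst : ∀ j < p.B, st j = backSt p o tab (st (j - 1)) j)
    (hex : ∃ y < p.N, endOK p (o (p.T - 1)) y)
    (hfeas : 0 ≤ tab (p.T - 1) (st 0)) :
    IsPath p o (fun m => st (p.T - 1 - m)) ∧
    pathCost p o (fun m => st (p.T - 1 - m)) p.T ≤ toE (tab (p.T - 1) (st 0)) := by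
  -- Step `0` formally refers to `st (0 - 1) = st 0`, but `backOK` ignores that argument there.
  have h0 : backOK p o (st 0) 0 (st 0) := by
    obtain ⟨y, hy, hy'⟩ := hex
    exact (backSt_spec hNB hst (by omega) ⟨y, hy, fun _ => hy', fun h => absurd h (by omega)⟩).1
  -- the entries along the path are finite and add up
  have main : ∀ j < p.T, 0 ≤ tab (p.T - 1 - j) (st j) ∧ st j < p.N ∧
      (1 ≤ j → stepOK p (o (p.T - 1 - j)) (st j) (o (p.T - j)) (st (j - 1)) ∧
        toE (tab (p.T - j) (st (j - 1))) =
          toE (tab (p.T - 1 - j) (st j)) + toE (wgt p (o (p.T - j)) (st (j - 1)))) := by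
    intro j
    induction j with
    | zero => exact fun _ => ⟨hfeas, h0.1, fun h => absurd h (by omega)⟩
    | succ j ih =>
      intro hj
      obtain ⟨h1, h2, -⟩ := ih (by omega)
      obtain ⟨m, hm⟩ : ∃ m, p.T - 1 - j = m + 1 := ⟨p.T - 1 - j - 1, by omega⟩
      have hm' : p.T - 1 - (j + 1) = m := by omega
      have hm2 : p.T - (j + 1) = m + 1 := by omega
      simp only [Nat.add_sub_cancel, hm', hm2]
      rw [hm] at h1
      have he := toE_entry_succ (p := p) (o := o) (row := tab m) (m := m) (x := st j)
      have e1 := htab (m + 1) (by omega) (st j) (by omega)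
      rw [Nat.add_sub_cancel] at e1
      rw [← e1] at he
      -- A finite sum has a finite minimum as its first summand, so some predecessor is compatible:
      -- all others contribute `-1`, that is, infinity.
      have hfin : (⨅ (y : ℕ) (_ : y < p.B),
          toE (if y < p.N ∧ stepOK p (o m) y (o (m + 1)) (st j) then tab m y else -1)) < ⊤ := by
        have := toE_lt_top.2 h1
        rw [he] at this
        exact (ENNReal.add_lt_top.1 this).1
      simp only [iInf_lt_iff] at hfin
      obtain ⟨y, hy, hy'⟩ := hfin
      have hyc : y < p.N ∧ stepOK p (o m) y (o (m + 1)) (st j) := by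
        by_contra hc
        rw [if_neg hc] at hy'
        simp [toE] at hy'
      have hbk : ∀ y, y < p.N ∧ stepOK p (o m) y (o (m + 1)) (st j) →
          backOK p o (st (j + 1 - 1)) (j + 1) y := by
        intro y hyc
        refine ⟨hyc.1, fun h => absurd h (by omega), fun _ => ?_⟩
        rw [hm', hm2]
        exact hyc.2
      obtain ⟨h3, h4⟩ := backSt_spec hNB hst (hj.trans_le hTB) ⟨y, hbk y hyc⟩
      rw [hm'] at h4
      have h5 := h3.2.2 (by omega)
      rw [hm', hm2, Nat.add_sub_cancel] at h5
      have h6 : (⨅ (y : ℕ) (_ : y < p.B),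
          toE (if y < p.N ∧ stepOK p (o m) y (o (m + 1)) (st j) then tab m y else -1)) =
          toE (tab m (st (j + 1))) := by
        apply le_antisymm
        · refine iInf_le_of_le (st (j + 1)) (iInf_le_of_le (h3.1.trans_le hNB) ?_)
          rw [if_pos ⟨h3.1, h5⟩]
        · refine le_iInf₂ fun y hy => ?_
          split_ifs with hyc
          · exact h4 y (hbk y hyc)
          · simp [toE]
      rw [h6] at he
      refine ⟨?_, h3.1, fun _ => ⟨h5, he⟩⟩
      rw [← toE_lt_top]
      have := toE_lt_top.2 h1
      rw [he] at this
      exact (ENNReal.add_lt_top.1 this).1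
  have hstart : startOK p (o 0) (st (p.T - 1)) := by
    obtain ⟨h1, h2, -⟩ := main (p.T - 1) (by omega)
    rw [Nat.sub_self, htab 0 (by omega) _ (by omega)] at h1
    exact startOK_of_entry h1
  refine ⟨⟨fun m hm => (main _ (by omega)).2.1, ?_, fun m hm => ?_, ?_⟩, ?_⟩
  · simpa using hstart
  · have h := (main (p.T - 1 - m) (by omega)).2.2 (by omega)
    rw [show p.T - 1 - (p.T - 1 - m) = m by omega, show p.T - (p.T - 1 - m) = m + 1 by omega,
      show p.T - 1 - m - 1 = p.T - 1 - (m + 1) by omega] at h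
    exact h.1
  · simpa using h0.2.1 rfl
  · have hsum : ∀ m < p.T, pathCost p o (fun m => st (p.T - 1 - m)) (m + 1) =
        toE (tab m (st (p.T - 1 - m))) := by
      intro m
      induction m with
      | zero =>
        intro hm
        have := (main (p.T - 1) (by omega)).2.1
        rw [Nat.sub_zero, htab 0 (by omega) _ (by omega), toE_entry_zero hstart]
        simp [pathCost]
      | succ m ih =>
        intro hm
        have h := (main (p.T - 1 - m) (by omega)).2.2 (by omega)
        rw [show p.T - 1 - (p.T - 1 - m) = m by omega, show p.T - (p.T - 1 - m) = m + 1 by omega,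
          show p.T - 1 - m - 1 = p.T - 1 - (m + 1) by omega] at h
        rw [h.2, ← ih (by omega), pathCost, Finset.sum_range_succ, pathCost]
    have := hsum (p.T - 1) (by omega)
    rw [Nat.sub_add_cancel hT, Nat.sub_self] at this
    exact this.le

end

/-! ### Paths and solutions -/

/-- The distance from `v` to a facility via the interface point `u` of a part of level `i`, where
`g` is the rounded distance from `u` to the facility. -/
def via (p : Par) (v i u g : ℕ) : ℝ := p.dist v u + (69 + (g : ℝ)) * p.ρ * p.pow i

/-- The properties of the data that make the dynamic program correct for the distances `rd`. -/
structure Facts (p : Par) (rd : ℕ → ℕ → ℝ≥0∞) : Prop where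
  inW_of_inF : ∀ v, p.inF v = 1 → p.inW v = 1
  inW_of_dem : ∀ v, 0 < p.dem v → p.inW v = 1
  lt_n : ∀ v, p.inW v = 1 → v < p.n
  join_self : ∀ v, p.inW v = 1 → p.join v v = 0
  join_comm : ∀ v u, p.inW v = 1 → p.inW u = 1 → p.join v u = p.join u v
  join_tri : ∀ u v w, p.inW u = 1 → p.inW v = 1 → p.inW w = 1 →
    p.join u w ≤ max (p.join u v) (p.join v w)
  join_le : ∀ u v, p.inW u = 1 → p.inW v = 1 → p.join u v ≤ p.top
  itf_congr : ∀ v v' i u, p.inW v = 1 → p.inW v' = 1 → p.join v v' ≤ i → p.itf v i u = 1 →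
    p.itf v' i u = 1
  itf_lt : ∀ v i u, p.itf v i u = 1 → u < p.n
  rd_self : ∀ v, p.inW v = 1 → rd v v = 0
  rd_le : ∀ v f i u (g : ℕ), p.inW v = 1 → p.inW f = 1 → p.join v f ≤ i → p.itf v i u = 1 → 1 ≤ g →
    p.dist u f ≤ p.ρ * g * p.pow i → rd v f ≤ toE (via p v i u g)
  le_rd : ∀ v f, p.inW v = 1 → p.inW f = 1 → v ≠ f → ∃ (u g : ℕ), p.itf v (p.join v f) u = 1 ∧
    1 ≤ g ∧ g ≤ p.R ∧ p.dist u f ≤ p.ρ * g * p.pow (p.join v f) ∧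
      toE (via p v (p.join v f) u g) ≤ rd v f
  sep : ∀ f f', p.inF f = 1 → p.inF f' = 1 → p.join f f' ≤ p.L → f = f'
  levels : p.L + p.M = p.top
  rank_lt : ∀ v l u, p.inW v = 1 → l < p.M → p.itf v (p.L + 1 + l) u = 1 →
    rank p v (p.L + 1 + l) u < p.K
  dist_nonneg : ∀ v u, 0 ≤ p.dist v u
  ρ_nonneg : 0 ≤ p.ρ
  pow_nonneg : ∀ i, 0 ≤ p.pow i
  dem_nonneg : ∀ v, 0 ≤ p.dem v
  w_nonneg : ∀ v, 0 ≤ p.w v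
  one_le_q : 1 ≤ p.q
  q_le : p.q ≤ p.B
  n_lt : p.n < p.B
  R_lt : p.R < p.B
  M_le : p.M ≤ p.B
  digits_le : 1 + 2 * (p.M * p.K) ≤ p.B
  N_eq : p.N = (p.n + 1) * (p.R + 2) ^ (1 + 2 * (p.M * p.K))
  N_le : p.N ≤ p.B

/-! ### Values of solutions, and contiguity of parts -/

section
variable {p : Par} {rd : ℕ → ℕ → ℝ≥0∞} {o : ℕ → ℕ}

theorem Facts.via_nonneg (h : Facts p rd) (v i u g : ℕ) : 0 ≤ via p v i u g := by
  have h1 := h.dist_nonneg v u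
  have h2 := h.ρ_nonneg
  have h3 := h.pow_nonneg i
  unfold via
  positivity

/-- The value of the set `S` of facilities. -/
def setValue (p : Par) (rd : ℕ → ℕ → ℝ≥0∞) (S : Finset ℕ) : ℝ≥0∞ :=
  ∑ v ∈ Finset.range p.n, ENNReal.ofReal (p.dem v) * (⨅ f ∈ S, rd v f) ^ p.q +
    ∑ f ∈ S, ENNReal.ofReal (p.w f)

theorem IsOrder.T_le (h : Facts p rd) (ho : IsOrder p o) : p.T ≤ p.n := by
  have : (Finset.range p.T).image o ⊆ Finset.range p.n := by
    intro v hv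
    obtain ⟨i, hi, rfl⟩ := Finset.mem_image.1 hv
    exact Finset.mem_range.2 (h.lt_n _ (ho.mem i (Finset.mem_range.1 hi)))
  have := Finset.card_le_card this
  rwa [Finset.card_image_of_injOn, Finset.card_range, Finset.card_range] at this
  intro i hi j hj hij
  exact ho.inj i (by simpa using hi) j (by simpa using hj) hij

theorem IsOrder.injOn (ho : IsOrder p o) : Set.InjOn o (Finset.range p.T : Set ℕ) :=
  fun i hi j hj hij => ho.inj i (by simpa using hi) j (by simpa using hj) hij

/-- Vertices outside the decomposed set have no demand, and facilities lie in it. Hence both sums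
can be taken along the order, each opening cost being charged at its facility. -/
theorem setValue_eq (h : Facts p rd) (ho : IsOrder p o) (S : Finset ℕ)
    (hS : ∀ f ∈ S, p.inW f = 1) : setValue p rd S = ∑ m ∈ Finset.range p.T,
      (ENNReal.ofReal (p.dem (o m)) * (⨅ f ∈ S, rd (o m) f) ^ p.q +
        if o m ∈ S then ENNReal.ofReal (p.w (o m)) else 0) := by
  rw [setValue, Finset.sum_add_distrib]
  congr 1
  · have hsub : (Finset.range p.T).image o ⊆ Finset.range p.n := by
      intro v hv
      obtain ⟨i, hi, rfl⟩ := Finset.mem_image.1 hv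
      exact Finset.mem_range.2 (h.lt_n _ (ho.mem i (Finset.mem_range.1 hi)))
    rw [← Finset.sum_subset hsub, Finset.sum_image ho.injOn]
    intro v _ hv
    have : ¬ 0 < p.dem v := by
      intro hd
      obtain ⟨i, hi, rfl⟩ := ho.surj v (h.inW_of_dem v hd)
      exact hv (Finset.mem_image_of_mem _ (Finset.mem_range.2 hi))
    rw [ENNReal.ofReal_of_nonpos (not_lt.1 this), zero_mul]
  · rw [← Finset.sum_image (f := fun v => if v ∈ S then ENNReal.ofReal (p.w v) else 0) ho.injOn,
      ← Finset.sum_filter]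
    congr 1
    ext f
    rw [Finset.mem_filter]
    refine ⟨fun hf => ⟨?_, hf⟩, fun hf => hf.2⟩
    obtain ⟨i, hi, rfl⟩ := ho.surj f (hS f hf)
    exact Finset.mem_image_of_mem _ (Finset.mem_range.2 hi)

/-- Infinite distances agree on both sides: zero demand gives `0 * ⊤ = 0`, and `⊤ ^ q = ⊤` because
`q ≥ 1`. -/
theorem toE_wgt (h : Facts p rd) (v x : ℕ) : toE (wgt p v x) =
    ENNReal.ofReal (p.dem v) * toE (dstTo p v x) ^ p.q +
      if opn p x v then ENNReal.ofReal (p.w v) else 0 := by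
  have hq := h.one_le_q
  rw [wgt, toE_add2]
  congr 1
  · unfold connCost
    by_cases h1 : p.dem v ≤ 0
    · rw [if_pos h1, ENNReal.ofReal_of_nonpos h1, toE_of_nonneg le_rfl]
      simp
    · rw [if_neg h1]
      by_cases h2 : dstTo p v x < 0
      · rw [if_pos h2, toE_of_neg h2, toE_of_neg (by norm_num), ENNReal.top_pow (by omega),
          ENNReal.mul_top (by simpa using h1)]
      · rw [if_neg h2, powR_eq h.q_le, toE_of_nonneg (not_lt.1 h2), toE_of_nonneg,
          ENNReal.ofReal_mul (h.dem_nonneg v), ENNReal.ofReal_pow (not_lt.1 h2)]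
        exact mul_nonneg (h.dem_nonneg v) (pow_nonneg (not_lt.1 h2) _)
  · split_ifs
    · exact toE_of_nonneg (h.w_nonneg v)
    · rw [toE_of_nonneg le_rfl, ENNReal.ofReal_zero]

theorem toE_mono {a b : ℝ} (ha : 0 ≤ a) (hab : a ≤ b) : toE a ≤ toE b :=
  le2_iff.1 (Or.inr ⟨ha, hab⟩)

/-- Parts are contiguous in the order. -/
theorem IsOrder.contiguous (h : Facts p rd) (ho : IsOrder p o) {i k a : ℕ} (hk : k < p.T)
    (hik : p.join (o i) (o k) ≤ a) : ∀ j, i ≤ j → j ≤ k → p.join (o i) (o j) ≤ a ∧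
      (j < k → p.join (o j) (o (j + 1)) ≤ a) := by
  have hW : ∀ j, j ≤ k → p.inW (o j) = 1 := fun j hj => ho.mem j (by omega)
  -- By the ultrametric inequality `o j` and `o k` are joined on level `a` at the latest. As `o k`
  -- comes later, the greedy choice of `o (j + 1)` is at least as close.
  have key : ∀ j, i ≤ j → j < k → p.join (o i) (o j) ≤ a → p.join (o j) (o (j + 1)) ≤ a := by
    intro j hij hjk hj
    have h1 := h.join_tri (o j) (o i) (o k) (hW j hjk.le) (hW i (by omega)) (hW k le_rfl)
    rw [h.join_comm (o j) (o i) (hW j hjk.le) (hW i (by omega))] at h1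
    have h2 := ho.greedy j k hjk hk
    omega
  intro j hij
  induction j, hij using Nat.le_induction with
  | base =>
    intro hjk
    have h1 : p.join (o i) (o i) ≤ a := by rw [h.join_self _ (hW i hjk)]; omega
    exact ⟨h1, fun hlt => key i le_rfl hlt h1⟩
  | succ j hij ih =>
    intro hjk
    obtain ⟨h1, h2⟩ := ih (by omega)
    have h3 := h.join_tri (o i) (o j) (o (j + 1)) (hW i (by omega)) (hW j (by omega))
      (hW (j + 1) hjk)
    have h4 := h2 (by omega)
    have h5 : p.join (o i) (o (j + 1)) ≤ a := by omega
    exact ⟨h5, fun hlt => key (j + 1) (by omega) hlt h5⟩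

theorem stepOK_iff {v x v' x' : ℕ} : stepOK p v x v' x' ↔
    (cnt p x' = cnt p x + (if opn p x' v' then 1 else 0) ∧
      (p.join v v' ≤ p.L → (dig p x 0 = 0 ↔ dig p x' 0 = 0))) ∧
    ∀ l < p.B, ∀ u < p.B, l < p.M →
      (p.join v v' ≤ p.L + 1 + l → sameOK p v x v' x' l u) ∧
      (p.L + 1 + l < p.join v v' → doneOK p v x l u ∧ newOK p v' x' l u) := by
  simp only [stepOK, allN_iff]

theorem startOK_iff {v x : ℕ} : startOK p v x ↔ cnt p x = (if opn p x v then 1 else 0) ∧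
    ∀ l < p.B, ∀ u < p.B, l < p.M → newOK p v x l u := by
  simp only [startOK, allN_iff]

theorem endOK_iff {v x : ℕ} : endOK p v x ↔ (p.kind = 0 → cnt p x ≤ p.k) ∧
    ∀ l < p.B, ∀ u < p.B, l < p.M → doneOK p v x l u := by
  simp only [endOK, allN_iff]

/-! Soundness -/

/-- The facilities that are opened along a path. -/
def opened (p : Par) (o x : ℕ → ℕ) : Finset ℕ :=
  ((Finset.range p.T).filter fun m => opn p (x m) (o m)).image o

theorem mem_opened {x : ℕ → ℕ} {f : ℕ} :
    f ∈ opened p o x ↔ ∃ m < p.T, opn p (x m) (o m) ∧ o m = f := by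
  simp [opened, and_assoc]

section
variable {x : ℕ → ℕ}

/-- All vertices between `o i` and `o k` lie in their part of level `p.L`, and steps within such a
part preserve the bit. -/
theorem IsPath.block (h : Facts p rd) (ho : IsOrder p o) (hx : IsPath p o x) {i k : ℕ}
    (hik : i ≤ k) (hk : k < p.T) (hj : p.join (o i) (o k) ≤ p.L) :
    dig p (x i) 0 = 0 ↔ dig p (x k) 0 = 0 := by
  have H : ∀ j, i ≤ j → j ≤ k → (dig p (x i) 0 = 0 ↔ dig p (x j) 0 = 0) := by
    intro j hij
    induction j, hij using Nat.le_induction with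
    | base => exact fun _ => Iff.rfl
    | succ j hij ih =>
      intro hjk
      exact (ih (by omega)).trans ((hx.step j (by omega)).1.2
        ((ho.contiguous h hk hj j hij (by omega)).2 (by omega)))
  exact H k hik le_rfl

/-- A witness bit is justified at its vertex or inherited from the preceding vertex in the same
part. Going backwards ends at the first vertex of the part at the latest, where only the vertex
itself can justify it. -/
theorem IsPath.of_wit (h : Facts p rd) (ho : IsOrder p o) (hx : IsPath p o x) {l u : ℕ}
    (hl : l < p.M) : ∀ m < p.T, p.itf (o m) (p.L + 1 + l) u = 1 → ¬ wit p (x m) (o m) l u = 0 →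
      ∃ m' < p.T, opn p (x m') (o m') ∧ p.join (o m) (o m') ≤ p.L + 1 + l ∧
        p.dist u (o m') ≤ p.ρ * (clm p (x m) (o m) l u : ℕ) * p.pow (p.L + 1 + l) := by
  have hlB : l < p.B := hl.trans_le h.M_le
  have now : ∀ m < p.T, hit p (x m) (o m) (p.L + 1 + l) u (clm p (x m) (o m) l u) →
      ∃ m' < p.T, opn p (x m') (o m') ∧ p.join (o m) (o m') ≤ p.L + 1 + l ∧
        p.dist u (o m') ≤ p.ρ * (clm p (x m) (o m) l u : ℕ) * p.pow (p.L + 1 + l) := by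
    intro m hm hh
    exact ⟨m, hm, hh.1, by rw [h.join_self _ (ho.mem m hm)]; omega, hh.2⟩
  intro m
  induction m with
  | zero =>
    intro hm hi hw
    have huB : u < p.B := (h.itf_lt _ _ _ hi).trans h.n_lt
    exact now 0 hm (((startOK_iff.1 hx.start).2 l hlB u huB hl hi).resolve_left hw)
  | succ m ih =>
    intro hm hi hw
    have huB : u < p.B := (h.itf_lt _ _ _ hi).trans h.n_lt
    have hW := ho.mem m (by omega)
    have hW' := ho.mem (m + 1) hm
    obtain ⟨h1, h2⟩ := (stepOK_iff.1 (hx.step m hm)).2 l hlB u huB hl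
    by_cases hj : p.join (o m) (o (m + 1)) ≤ p.L + 1 + l
    · have hj' : p.join (o (m + 1)) (o m) ≤ p.L + 1 + l := by rwa [h.join_comm _ _ hW' hW]
      have hi' := h.itf_congr _ _ _ u hW' hW hj' hi
      obtain ⟨h3, h4⟩ := h1 hj hi'
      rcases h4.resolve_left hw with h5 | h5
      · obtain ⟨m', hm', h6, h7, h8⟩ := ih (by omega) hi' h5
        refine ⟨m', hm', h6, ?_, by rw [h3]; exact h8⟩
        have := h.join_tri (o (m + 1)) (o m) (o m') hW' hW (ho.mem m' hm')
        omega
      · exact now (m + 1) hm (by rw [h3]; exact h5)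
    · exact now (m + 1) hm (((h2 (by omega)).2 hi).resolve_left hw)

/-- The claim is handed on unchanged to the last vertex of the part, where it must be witnessed;
`IsPath.of_wit` then leads back to a facility. The induction is on the number `d` of vertices that
still follow. -/
theorem IsPath.of_claim (h : Facts p rd) (ho : IsOrder p o) (hx : IsPath p o x) {l u : ℕ}
    (hl : l < p.M) : ∀ d m, m + d + 1 = p.T → p.itf (o m) (p.L + 1 + l) u = 1 →
      1 ≤ clm p (x m) (o m) l u →
      ∃ m' < p.T, opn p (x m') (o m') ∧ p.join (o m) (o m') ≤ p.L + 1 + l ∧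
        p.dist u (o m') ≤ p.ρ * (clm p (x m) (o m) l u : ℕ) * p.pow (p.L + 1 + l) := by
  have hlB : l < p.B := hl.trans_le h.M_le
  intro d
  induction d with
  | zero =>
    intro m hm hi hc
    have huB : u < p.B := (h.itf_lt _ _ _ hi).trans h.n_lt
    obtain rfl : m = p.T - 1 := by omega
    have := (endOK_iff.1 hx.finish).2 l hlB u huB hl hi
    exact hx.of_wit h ho hl _ (by omega) hi (this.resolve_left (by omega))
  | succ d ih =>
    intro m hm hi hc
    have huB : u < p.B := (h.itf_lt _ _ _ hi).trans h.n_lt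
    have hW := ho.mem m (by omega)
    have hW' := ho.mem (m + 1) (by omega)
    obtain ⟨h1, h2⟩ := (stepOK_iff.1 (hx.step m (by omega))).2 l hlB u huB hl
    by_cases hj : p.join (o m) (o (m + 1)) ≤ p.L + 1 + l
    · have h3 := (h1 hj hi).1
      obtain ⟨m', hm', h4, h5, h6⟩ := ih (m + 1) (by omega) (h.itf_congr _ _ _ u hW hW' hj hi)
        (by omega)
      refine ⟨m', hm', h4, ?_, by rw [← h3]; exact h6⟩
      have := h.join_tri (o m) (o (m + 1)) (o m') hW hW' (ho.mem m' hm')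
      omega
    · have := (h2 (by omega)).1 hi
      exact hx.of_wit h ho hl m (by omega) hi (this.resolve_left (by omega))

/-- A path never underestimates a distance. A candidate of `highDist` is backed by an opened
facility through `IsPath.of_claim`, one of `lowDist` through `IsPath.block`; `Facts.rd_le` applies
even if that facility is joined to the vertex below the level of the claim. -/
theorem IsPath.dist_le (h : Facts p rd) (ho : IsOrder p o) (hx : IsPath p o x) {m : ℕ}
    (hm : m < p.T) : ⨅ f ∈ opened p o x, rd (o m) f ≤ toE (dstTo p (o m) (x m)) := by
  have hW := ho.mem m hm
  unfold dstTo
  split_ifs with h0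
  · refine (iInf₂_le (o m) (mem_opened.2 ⟨m, hm, h0, rfl⟩)).trans ?_
    rw [h.rd_self _ hW]
    exact bot_le
  rw [toE_min2]
  refine le_min ?_ ?_
  · unfold highDist
    rw [toE_minN]
    refine le_iInf₂ fun l _ => ?_
    rw [toE_minN]
    refine le_iInf₂ fun u _ => ?_
    split_ifs with hc
    · obtain ⟨hl, hi, hc⟩ := hc
      obtain ⟨m', hm', h1, h2, h3⟩ := hx.of_claim h ho hl (p.T - 1 - m) m (by omega) hi hc
      refine (iInf₂_le (o m') (mem_opened.2 ⟨m', hm', h1, rfl⟩)).trans ?_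
      exact h.rd_le _ _ _ u _ hW (ho.mem m' hm') h2 hi hc h3
    · simp [toE]
  · unfold lowDist
    rw [toE_minN]
    refine le_iInf₂ fun f _ => ?_
    rw [toE_minN]
    refine le_iInf₂ fun u _ => ?_
    rw [toE_minN]
    refine le_iInf₂ fun g _ => ?_
    split_ifs with hc
    · obtain ⟨⟨hF, hd, hj⟩, hi, hg, hdist⟩ := hc
      have hfW := h.inW_of_inF f hF
      obtain ⟨m', hm', rfl⟩ := ho.surj f hfW
      have hd' : ¬ dig p (x m') 0 = 0 := by
        rcases le_total m m' with hmm | hmm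
        · rwa [← hx.block h ho hmm hm' hj]
        · rwa [hx.block h ho hmm hm (by rwa [h.join_comm _ _ hfW hW])]
      refine (iInf₂_le (o m') (mem_opened.2 ⟨m', hm', ⟨hF, hd'⟩, rfl⟩)).trans ?_
      exact h.rd_le _ _ _ u g hW hfW le_rfl hi hg hdist
    · simp [toE]

theorem IsPath.cnt_eq (hx : IsPath p o x) : ∀ m < p.T, cnt p (x m) =
    ((Finset.range (m + 1)).filter fun i => opn p (x i) (o i)).card := by
  intro m
  induction m with
  | zero =>
    intro _
    rw [hx.start.1]
    by_cases h : opn p (x 0) (o 0) <;> simp [h, Finset.filter_singleton]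
  | succ m ih =>
    intro hm
    rw [(hx.step m hm).1.1, ih (by omega), Finset.range_add_one (n := m + 1),
      Finset.filter_insert]
    by_cases h : opn p (x (m + 1)) (o (m + 1)) <;> simp [h]

theorem IsPath.card_opened (hx : IsPath p o x) (hT : 1 ≤ p.T)
    (hk : p.kind = 0) : (opened p o x).card ≤ p.k := by
  have h1 := hx.finish.1 hk
  rw [hx.cnt_eq _ (by omega), Nat.sub_add_cancel hT] at h1
  exact Finset.card_image_le.trans h1

theorem IsPath.setValue_le (h : Facts p rd) (ho : IsOrder p o) (hx : IsPath p o x) :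
    setValue p rd (opened p o x) ≤ pathCost p o x p.T := by
  have hop : ∀ m < p.T, (o m ∈ opened p o x ↔ opn p (x m) (o m)) := by
    intro m hm
    rw [mem_opened]
    refine ⟨fun ⟨m', hm', h1, h2⟩ => ?_, fun h1 => ⟨m, hm, h1, rfl⟩⟩
    obtain rfl := ho.inj m' hm' m hm h2
    exact h1
  rw [setValue_eq h ho, pathCost]
  · refine Finset.sum_le_sum fun m hm => ?_
    have hm := Finset.mem_range.1 hm
    rw [toE_wgt h]
    simp only [hop m hm]
    gcongr
    exact hx.dist_le h ho hm
  · intro f hf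
    obtain ⟨m, hm, -, rfl⟩ := mem_opened.1 hf
    exact ho.mem m hm

end

end

section
variable {p : Par} {rd : ℕ → ℕ → ℝ≥0∞} {o : ℕ → ℕ}

/-! Completeness -/

theorem rank_inj (h : Facts p rd) {v i u u' : ℕ} (hu : p.itf v i u = 1) (hu' : p.itf v i u' = 1)
    (hr : rank p v i u = rank p v i u') : u = u' := by
  have key : ∀ u u', p.itf v i u = 1 → p.itf v i u' = 1 → u < u' →
      rank p v i u < rank p v i u' := by
    intro u u' hu hu' hlt
    rw [rank, rank, countN_eq, countN_eq]
    have huB := (h.itf_lt _ _ _ hu).trans h.n_lt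
    apply Finset.card_lt_card
    rw [Finset.ssubset_iff_of_subset]
    · exact ⟨u, by simp [huB, hlt, hu], by simp⟩
    · intro j hj
      simp only [Finset.mem_filter] at hj ⊢
      exact ⟨hj.1, hj.2.1.trans hlt, hj.2.2⟩
  rcases lt_trichotomy u u' with h1 | h1 | h1
  · have := key u u' hu hu' h1
    omega
  · exact h1
  · have := key u' u hu' hu h1
    omega

/-- States with prescribed components exist. -/
theorem exists_state_of (h : Facts p rd) {v : ℕ} (hv : p.inW v = 1) (k : ℕ) (hk : k ≤ p.n)
    (b : ℕ) (hb : b ≤ 1) (c w : ℕ → ℕ → ℕ) (hc : ∀ l u, c l u ≤ p.R) (hw : ∀ l u, w l u ≤ 1) :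
    ∃ x < p.N, cnt p x = k ∧ dig p x 0 = b ∧ ∀ l < p.M, ∀ u, p.itf v (p.L + 1 + l) u = 1 →
      clm p x v l u = c l u ∧ wit p x v l u = w l u := by
  -- Slot `s` stands for the level with offset `s / K` and the interface point of rank `s % K`;
  -- unused slots get the default `0`.
  let el : ℕ → ℕ := fun s => if hu : ∃ u, p.itf v (p.L + 1 + s / p.K) u = 1 ∧
    rank p v (p.L + 1 + s / p.K) u = s % p.K then hu.choose else 0
  -- Digit `0` is the bit of the block, odd digits are claims, and the other even digits are witness
  -- bits.
  let d : ℕ → ℕ := fun e => if e = 0 then b else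
    if (e - 1) % 2 = 0 then c ((e - 1) / 2 / p.K) (el ((e - 1) / 2))
      else w ((e - 1) / 2 / p.K) (el ((e - 1) / 2))
  have hN := h.N_eq
  obtain ⟨x, hx, h1, h2⟩ := exists_state (p := p) h.digits_le (by rw [← hN]; exact h.N_le) k hk d
    (fun e _ => by
      have := hc ((e - 1) / 2 / p.K) (el ((e - 1) / 2))
      have := hw ((e - 1) / 2 / p.K) (el ((e - 1) / 2))
      simp only [d]
      split_ifs <;> omega)
  refine ⟨x, by rw [hN]; exact hx, h1, by rw [h2 0 (by omega)]; simp [d], fun l hl u hi => ?_⟩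
  have hr := h.rank_lt v l u hv hl hi
  set r := rank p v (p.L + 1 + l) u with hrdef
  have hs : slot p v l u = l * p.K + r := rfl
  have hdiv : (l * p.K + r) / p.K = l := by
    rw [mul_comm, Nat.mul_add_div (by omega), Nat.div_eq_of_lt hr, add_zero]
  have hmod : (l * p.K + r) % p.K = r := by
    rw [mul_comm, Nat.mul_add_mod, Nat.mod_eq_of_lt hr]
  have hlt : l * p.K + r < p.M * p.K := by
    calc l * p.K + r < l * p.K + p.K := by omega
      _ = (l + 1) * p.K := by ring
      _ ≤ _ := Nat.mul_le_mul_right _ hl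
  have hel : el (l * p.K + r) = u := by
    have hex : ∃ u, p.itf v (p.L + 1 + (l * p.K + r) / p.K) u = 1 ∧
        rank p v (p.L + 1 + (l * p.K + r) / p.K) u = (l * p.K + r) % p.K := by
      rw [hdiv, hmod]
      exact ⟨u, hi, rfl⟩
    have hsp := hex.choose_spec
    have : el (l * p.K + r) = hex.choose := dif_pos hex
    rw [this]
    generalize hex.choose = u' at hsp
    rw [hdiv, hmod] at hsp
    exact rank_inj h hsp.1 hi hsp.2
  constructor
  · rw [clm, hs, h2 _ (by omega)]
    have e1 : 1 + 2 * (l * p.K + r) - 1 = 2 * (l * p.K + r) := by omega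
    have e2 : 2 * (l * p.K + r) / 2 = l * p.K + r := by omega
    simp only [d, e1, e2, hdiv, hel]
    rw [if_neg (by omega), if_pos (by omega)]
  · rw [wit, hs, h2 _ (by omega)]
    have e1 : 2 + 2 * (l * p.K + r) - 1 = 2 * (l * p.K + r) + 1 := by omega
    have e2 : (2 * (l * p.K + r) + 1) / 2 = l * p.K + r := by omega
    simp only [d, e1, e2, hdiv, hel]
    rw [if_neg (by omega), if_neg (by omega)]

/-- Some facility of `S` in the part of level `i` that contains `v` has rounded distance at most
`g` from `u`. -/
def Near (p : Par) (S : Finset ℕ) (v i u g : ℕ) : Prop :=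
  ∃ f ∈ S, p.join v f ≤ i ∧ p.dist u f ≤ p.ρ * g * p.pow i

/-- The rounded distance of `u` from the facilities of `S` in the part of level `i` that contains
`v`, or `0` if it is too large. -/
def trueClaim (p : Par) (S : Finset ℕ) (v i u : ℕ) : ℕ :=
  if h : ∃ g, (1 ≤ g ∧ g ≤ p.R) ∧ Near p S v i u g then Nat.find h else 0

theorem trueClaim_le (S : Finset ℕ) (v i u : ℕ) : trueClaim p S v i u ≤ p.R := by
  unfold trueClaim
  split_ifs with h
  · exact (Nat.find_spec h).1.2
  · omega

theorem near_trueClaim {S : Finset ℕ} {v i u : ℕ} (h0 : ¬ trueClaim p S v i u = 0) :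
    Near p S v i u (trueClaim p S v i u) := by
  unfold trueClaim at h0 ⊢
  split_ifs at h0 ⊢ with h
  · exact (Nat.find_spec h).2
  · exact absurd rfl h0

theorem trueClaim_of_near {S : Finset ℕ} {v i u g : ℕ} (h1 : 1 ≤ g) (h2 : g ≤ p.R)
    (h3 : Near p S v i u g) : 1 ≤ trueClaim p S v i u ∧ trueClaim p S v i u ≤ g := by
  have h : ∃ g, (1 ≤ g ∧ g ≤ p.R) ∧ Near p S v i u g := ⟨g, ⟨h1, h2⟩, h3⟩
  unfold trueClaim
  rw [dif_pos h]
  exact ⟨(Nat.find_spec h).1.1, Nat.find_min' h ⟨⟨h1, h2⟩, h3⟩⟩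

theorem near_congr (h : Facts p rd) {S : Finset ℕ} (hS : ∀ f ∈ S, p.inW f = 1) {v v' i u g : ℕ}
    (hv : p.inW v = 1) (hv' : p.inW v' = 1) (hj : p.join v v' ≤ i) (hn : Near p S v i u g) :
    Near p S v' i u g := by
  obtain ⟨f, hf, h1, h2⟩ := hn
  have := h.join_tri v' v f hv' hv (hS f hf)
  rw [h.join_comm v' v hv' hv] at this
  exact ⟨f, hf, by omega, h2⟩

theorem trueClaim_congr (h : Facts p rd) {S : Finset ℕ} (hS : ∀ f ∈ S, p.inW f = 1)
    {v v' i u : ℕ} (hv : p.inW v = 1) (hv' : p.inW v' = 1) (hj : p.join v v' ≤ i) :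
    trueClaim p S v i u = trueClaim p S v' i u := by
  have : ∀ g, Near p S v i u g = Near p S v' i u g := fun g => propext
    ⟨near_congr h hS hv hv' hj, near_congr h hS hv' hv (by rwa [h.join_comm _ _ hv' hv])⟩
  unfold trueClaim
  simp only [this]

/-- A facility that justifies the claim has been seen up to the index `m`. -/
def Seen (p : Par) (o : ℕ → ℕ) (S : Finset ℕ) (m i u : ℕ) : Prop :=
  ∃ m' ≤ m, p.join (o m) (o m') ≤ i ∧ o m' ∈ S ∧
    p.dist u (o m') ≤ p.ρ * (trueClaim p S (o m) i u : ℕ) * p.pow i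

/-- Some facility of `S` lies in the part of level `p.L` that contains `v`. -/
def BlockOpen (p : Par) (S : Finset ℕ) (v : ℕ) : Prop := ∃ f ∈ S, p.join v f ≤ p.L

/-- The states of the path of the solution `S`. -/
structure IsTrace (p : Par) (o : ℕ → ℕ) (S : Finset ℕ) (x : ℕ → ℕ) : Prop where
  lt : ∀ m < p.T, x m < p.N
  cnt : ∀ m < p.T, cnt p (x m) = ((Finset.range (m + 1)).filter fun i => o i ∈ S).card
  dig : ∀ m < p.T, (dig p (x m) 0 = 0 ↔ ¬ BlockOpen p S (o m))
  clm : ∀ m < p.T, ∀ l < p.M, ∀ u, p.itf (o m) (p.L + 1 + l) u = 1 →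
    clm p (x m) (o m) l u = trueClaim p S (o m) (p.L + 1 + l) u
  wit : ∀ m < p.T, ∀ l < p.M, ∀ u, p.itf (o m) (p.L + 1 + l) u = 1 →
    (wit p (x m) (o m) l u = 0 ↔ ¬ Seen p o S m (p.L + 1 + l) u)

theorem exists_trace (h : Facts p rd) (ho : IsOrder p o) (S : Finset ℕ) :
    ∃ x, IsTrace p o S x := by
  have ex : ∀ m, ∃ x, m < p.T → x < p.N ∧
      cnt p x = ((Finset.range (m + 1)).filter fun i => o i ∈ S).card ∧
      dig p x 0 = (if BlockOpen p S (o m) then 1 else 0) ∧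
      ∀ l < p.M, ∀ u, p.itf (o m) (p.L + 1 + l) u = 1 →
        clm p x (o m) l u = trueClaim p S (o m) (p.L + 1 + l) u ∧
        wit p x (o m) l u = if Seen p o S m (p.L + 1 + l) u then 1 else 0 := by
    intro m
    by_cases hm : m < p.T
    · obtain ⟨x, h1, h2⟩ := exists_state_of h (ho.mem m hm)
        ((Finset.range (m + 1)).filter fun i => o i ∈ S).card
        ((Finset.card_filter_le _ _).trans (by rw [Finset.card_range]; have := ho.T_le h; omega))
        (if BlockOpen p S (o m) then 1 else 0) (by split_ifs <;> omega)
        (fun l u => trueClaim p S (o m) (p.L + 1 + l) u)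
        (fun l u => if Seen p o S m (p.L + 1 + l) u then 1 else 0)
        (fun l u => trueClaim_le _ _ _ _) (fun l u => by split_ifs <;> omega)
      exact ⟨x, fun _ => ⟨h1, h2⟩⟩
    · exact ⟨0, fun h => absurd h hm⟩
  choose x hx using ex
  refine ⟨x, fun m hm => (hx m hm).1, fun m hm => (hx m hm).2.1, fun m hm => ?_,
    fun m hm l hl u hu => ((hx m hm).2.2.2 l hl u hu).1, fun m hm l hl u hu => ?_⟩
  · rw [(hx m hm).2.2.1]
    split_ifs with h <;> simp [h]
  · rw [((hx m hm).2.2.2 l hl u hu).2]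
    split_ifs with h <;> simp [h]

section
variable {S : Finset ℕ} {x : ℕ → ℕ}

/-- One bit per part of level `p.L` is enough: by `Facts.sep`, a facility sharing such a part with a
member of `S` is that member. -/
theorem IsTrace.opn (h : Facts p rd) (ho : IsOrder p o) (hSF : ∀ f ∈ S, p.inF f = 1)
    (hx : IsTrace p o S x) {m : ℕ} (hm : m < p.T) : opn p (x m) (o m) ↔ o m ∈ S := by
  unfold ClusterDP.opn
  rw [ne_eq, hx.dig m hm, not_not]
  constructor
  · rintro ⟨h1, f, hf, h2⟩
    rwa [h.sep (o m) f h1 (hSF f hf) h2]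
  · intro hmS
    exact ⟨hSF _ hmS, o m, hmS, by rw [h.join_self _ (ho.mem m hm)]; omega⟩

/-- With no earlier vertex in the part, a facility seen so far can only be the vertex itself. -/
theorem IsTrace.newOK (h : Facts p rd) (ho : IsOrder p o) (hSF : ∀ f ∈ S, p.inF f = 1)
    (hx : IsTrace p o S x) {m l u : ℕ} (hm : m < p.T) (hl : l < p.M)
    (hnew : ∀ m' < m, ¬ p.join (o m) (o m') ≤ p.L + 1 + l) : newOK p (o m) (x m) l u := by
  intro hi
  by_contra hc
  push Not at hc
  obtain ⟨h1, h2⟩ := hc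
  rw [ne_eq, hx.wit m hm l hl u hi, not_not] at h1
  obtain ⟨m', hm', h3, h4, h5⟩ := h1
  rcases Nat.lt_or_eq_of_le hm' with h6 | rfl
  · exact hnew m' h6 h3
  · exact h2 ⟨(hx.opn h ho hSF hm).2 h4, by rw [hx.clm _ hm l hl u hi]; exact h5⟩

/-- A nonzero true claim is realised in the part, and with no later vertex in the part that facility
has been seen. -/
theorem IsTrace.doneOK (h : Facts p rd) (ho : IsOrder p o) (hSF : ∀ f ∈ S, p.inF f = 1)
    (hx : IsTrace p o S x) {m l u : ℕ} (hm : m < p.T) (hl : l < p.M)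
    (hdone : ∀ m' < p.T, m < m' → ¬ p.join (o m) (o m') ≤ p.L + 1 + l) :
    doneOK p (o m) (x m) l u := by
  intro hi
  rw [hx.clm m hm l hl u hi, hx.wit m hm l hl u hi, not_not]
  by_cases h0 : trueClaim p S (o m) (p.L + 1 + l) u = 0
  · exact Or.inl h0
  · obtain ⟨f, hf, h1, h2⟩ := near_trueClaim h0
    obtain ⟨m', hm', rfl⟩ := ho.surj f (h.inW_of_inF f (hSF f hf))
    refine Or.inr ⟨m', ?_, h1, hf, h2⟩
    by_contra hc
    exact hdone m' hm' (by omega) h1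

theorem IsTrace.isPath (h : Facts p rd) (ho : IsOrder p o) (hT : 1 ≤ p.T)
    (hSF : ∀ f ∈ S, p.inF f = 1) (hSk : p.kind = 0 → S.card ≤ p.k) (hx : IsTrace p o S x) :
    IsPath p o x := by
  have hSW : ∀ f ∈ S, p.inW f = 1 := fun f hf => h.inW_of_inF f (hSF f hf)
  refine ⟨hx.lt, ?_, fun m hm => ?_, ?_⟩
  · rw [startOK_iff]
    refine ⟨?_, fun l _ u _ hl => hx.newOK h ho hSF (by omega) hl fun m' hm' => by omega⟩
    rw [hx.cnt 0 (by omega)]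
    simp only [hx.opn h ho hSF (show 0 < p.T by omega)]
    by_cases h0 : o 0 ∈ S <;> simp [h0, Finset.filter_singleton]
  · have hm0 : m < p.T := by omega
    have hW := ho.mem m hm0
    have hW' := ho.mem (m + 1) hm
    rw [stepOK_iff]
    refine ⟨⟨?_, fun hj => ?_⟩, fun l _ u _ hl => ⟨fun hj hi => ?_, fun hj => ⟨?_, ?_⟩⟩⟩
    · rw [hx.cnt m hm0, hx.cnt (m + 1) hm, Finset.range_add_one (n := m + 1),
        Finset.filter_insert]
      simp only [hx.opn h ho hSF hm]
      by_cases h0 : o (m + 1) ∈ S <;> simp [h0]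
    · rw [hx.dig m hm0, hx.dig (m + 1) hm, not_iff_not]
      have hj' := hj
      rw [h.join_comm _ _ hW hW'] at hj'
      constructor
      · rintro ⟨f, hf, h1⟩
        have := h.join_tri _ _ f hW' hW (hSW f hf)
        exact ⟨f, hf, by omega⟩
      · rintro ⟨f, hf, h1⟩
        have := h.join_tri _ _ f hW hW' (hSW f hf)
        exact ⟨f, hf, by omega⟩
    · have hi' := h.itf_congr _ _ _ u hW hW' hj hi
      have hc := trueClaim_congr h (u := u) hSW hW hW' hj
      rw [hx.clm m hm0 l hl u hi, hx.clm (m + 1) hm l hl u hi', hx.wit m hm0 l hl u hi,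
        hx.wit (m + 1) hm l hl u hi', not_not, hc]
      refine ⟨rfl, ?_⟩
      by_contra hcon
      push Not at hcon
      obtain ⟨⟨m', hm', h1, h2, h3⟩, h4, h5⟩ := hcon
      rcases Nat.lt_or_eq_of_le hm' with h6 | rfl
      · refine h4 ⟨m', by omega, ?_, h2, by rw [hc]; exact h3⟩
        have := h.join_tri _ _ (o m') hW hW' (ho.mem m' (by omega))
        omega
      · exact h5 ⟨(hx.opn h ho hSF hm).2 h2, h3⟩
    · refine hx.doneOK h ho hSF hm0 hl fun m' hm' hlt hle => ?_
      have := ho.greedy m m' hlt hm'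
      omega
    · refine hx.newOK h ho hSF hm hl fun m' hm' hle => ?_
      rw [h.join_comm _ _ hW' (ho.mem m' (by omega))] at hle
      have := (ho.contiguous h hm hle m (by omega) (by omega)).2 (by omega)
      omega
  · rw [endOK_iff]
    refine ⟨fun hk => ?_, fun l _ u _ hl => hx.doneOK h ho hSF (by omega) hl
      fun m' hm' hlt => by omega⟩
    rw [hx.cnt _ (by omega), Nat.sub_add_cancel hT]
    refine le_trans ?_ (hSk hk)
    refine Finset.card_le_card_of_injOn o (fun i hi => ?_) (fun i hi j hj hij => ?_)
    · exact (Finset.mem_filter.1 hi).2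
    · simp only [Finset.coe_filter, Finset.mem_range, Set.mem_ofPred_eq] at hi hj
      exact ho.inj i hi.1 j hj.1 hij

/-- The trace never overestimates. An interface point attaining `dist'` on the level where vertex
and facility are joined is a candidate of `lowDist` or `highDist`, depending on that level; in the
second case the true claim is at most its multiplier `g`. -/
theorem IsTrace.dist_le (h : Facts p rd) (ho : IsOrder p o) (hSF : ∀ f ∈ S, p.inF f = 1)
    (hx : IsTrace p o S x) {m : ℕ} (hm : m < p.T) :
    toE (dstTo p (o m) (x m)) ≤ ⨅ f ∈ S, rd (o m) f := by
  have hW := ho.mem m hm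
  refine le_iInf₂ fun f hf => ?_
  have hfF := hSF f hf
  have hfW := h.inW_of_inF f hfF
  unfold dstTo
  split_ifs with h0
  · simp [toE]
  rw [toE_min2]
  have hne : o m ≠ f := by
    rintro rfl
    exact h0 ((hx.opn h ho hSF hm).2 hf)
  obtain ⟨u, g, hi, hg1, hg2, hd, hle⟩ := h.le_rd (o m) f hW hfW hne
  have hu := (h.itf_lt _ _ _ hi).trans h.n_lt
  by_cases hL : p.join (o m) f ≤ p.L
  · refine (min_le_right _ _).trans (le_trans ?_ hle)
    unfold lowDist
    rw [toE_minN]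
    refine iInf_le_of_le f (iInf_le_of_le ((h.lt_n f hfW).trans h.n_lt) ?_)
    rw [toE_minN]
    refine iInf_le_of_le u (iInf_le_of_le hu ?_)
    rw [toE_minN]
    refine iInf_le_of_le g (iInf_le_of_le (hg2.trans_lt h.R_lt) ?_)
    rw [if_pos ⟨⟨hfF, by rw [hx.dig m hm, not_not]; exact ⟨f, hf, hL⟩, hL⟩, hi, hg1, hd⟩]
    rfl
  · refine (min_le_left _ _).trans (le_trans ?_ hle)
    have hjt := h.join_le _ _ hW hfW
    have hlev := h.levels
    obtain ⟨l, hl⟩ : ∃ l, p.join (o m) f = p.L + 1 + l := ⟨p.join (o m) f - p.L - 1, by omega⟩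
    have hlM : l < p.M := by omega
    rw [hl] at hi hd ⊢
    obtain ⟨hc1, hc2⟩ := trueClaim_of_near (p := p) (S := S) (v := o m) (i := p.L + 1 + l) (u := u)
      hg1 hg2 ⟨f, hf, hl.le, hd⟩
    unfold highDist
    rw [toE_minN]
    refine iInf_le_of_le l (iInf_le_of_le (hlM.trans_le h.M_le) ?_)
    rw [toE_minN]
    refine iInf_le_of_le u (iInf_le_of_le hu ?_)
    rw [hx.clm m hm l hlM u hi, if_pos ⟨hlM, hi, hc1⟩]
    refine toE_mono (h.via_nonneg _ _ _ _) ?_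
    unfold via
    have h1 := h.ρ_nonneg
    have h2 := h.pow_nonneg (p.L + 1 + l)
    have h3 : (trueClaim p S (o m) (p.L + 1 + l) u : ℝ) ≤ g := by exact_mod_cast hc2
    gcongr

end

theorem exists_path (h : Facts p rd) (ho : IsOrder p o) (hT : 1 ≤ p.T) {S : Finset ℕ}
    (hSF : ∀ f ∈ S, p.inF f = 1) (hSk : p.kind = 0 → S.card ≤ p.k) :
    ∃ x, IsPath p o x ∧ pathCost p o x p.T ≤ setValue p rd S := by
  obtain ⟨x, hx⟩ := exists_trace h ho S
  refine ⟨x, hx.isPath h ho hT hSF hSk, ?_⟩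
  rw [setValue_eq h ho S fun f hf => h.inW_of_inF f (hSF f hf), pathCost]
  refine Finset.sum_le_sum fun m hm => ?_
  have hm := Finset.mem_range.1 hm
  rw [toE_wgt h]
  simp only [hx.opn h ho hSF hm]
  gcongr
  exact hx.dist_le h ho hSF hm

/-! ### Correctness of the dynamic program -/

/-- The final entry bounds the value of every solution from below, and the set opened along the
reconstructed path attains this bound. If the entry is infinite, so are all values, and the empty
set that is marked then is optimal. -/
theorem optimal_of_tab (h : Facts p rd) {tab : ℕ → ℕ → ℝ} {st : ℕ → ℕ} (hT1 : 1 ≤ p.T)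
    (hT : p.T = sizeT p) (ho : ∀ i < p.B, o i = nextV p o i)
    (htab : ∀ i < p.B, ∀ j < p.B, tab i j = entry p o (tab (i - 1)) i j)
    (hst : ∀ j < p.B, st j = backSt p o tab (st (j - 1)) j) {S : Finset ℕ}
    (hS : ∀ v, v ∈ S ↔ v < p.n ∧ markV p o tab st v = 1) :
    (∀ f ∈ S, p.inF f = 1) ∧ (p.kind = 0 → S.card ≤ p.k) ∧
    ∀ S' : Finset ℕ, (∀ f ∈ S', p.inF f = 1) → (p.kind = 0 → S'.card ≤ p.k) →
      setValue p rd S ≤ setValue p rd S' := by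
  have hO : IsOrder p o :=
    isOrder_of_nextV (fun v hv => (h.lt_n v hv).trans h.n_lt) hT ho
  have hTB : p.T ≤ p.B := (hO.T_le h).trans h.n_lt.le
  have hmark : ∀ v, markV p o tab st v = 1 ↔ 0 ≤ tab (p.T - 1) (st 0) ∧
      ∃ m < p.T, o m = v ∧ opn p (st (p.T - 1 - m)) v := by
    intro v
    unfold markV
    rw [allN_iff]
    constructor
    · intro hv
      split_ifs at hv with hc
      push Not at hc
      obtain ⟨h1, m, _, h2, h3, h4⟩ := hc
      exact ⟨h1, m, h2, h3, h4⟩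
    · rintro ⟨h1, m, h2, h3⟩
      rw [if_pos ⟨h1, fun hc => hc m (by omega) ⟨h2, h3⟩⟩]
  -- The empty solution is always allowed, so an admissible final state exists even when the optimum
  -- is infinite.
  have hex : ∃ y < p.N, endOK p (o (p.T - 1)) y := by
    obtain ⟨x, hx, -⟩ := exists_path h hO hT1 (S := ∅) (by simp) (by simp)
    exact ⟨_, hx.lt _ (by omega), hx.finish⟩
  have hlow : ∀ S' : Finset ℕ, (∀ f ∈ S', p.inF f = 1) → (p.kind = 0 → S'.card ≤ p.k) →
      toE (tab (p.T - 1) (st 0)) ≤ setValue p rd S' := by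
    intro S' h1 h2
    obtain ⟨x, hx, hle⟩ := exists_path h hO hT1 h1 h2
    refine le_trans ?_ hle
    have h3 := tab_le_pathCost h.N_le hTB htab hx (p.T - 1) (by omega)
    rw [Nat.sub_add_cancel hT1] at h3
    refine le_trans ?_ h3
    have hb : ∀ y, y < p.N → endOK p (o (p.T - 1)) y → backOK p o (st (0 - 1)) 0 y :=
      fun y hy hy' => ⟨hy, fun _ => hy', fun h => absurd h (by omega)⟩
    obtain ⟨y, hy, hy'⟩ := hex
    exact (backSt_spec h.N_le hst (by omega) ⟨y, hb y hy hy'⟩).2 _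
      (hb _ (hx.lt _ (by omega)) hx.finish)
  by_cases hfeas : 0 ≤ tab (p.T - 1) (st 0)
  · obtain ⟨hx, hcost⟩ := path_of_tab h.N_le hTB htab hT1 hst hex hfeas
    have hSeq : S = opened p o fun m => st (p.T - 1 - m) := by
      ext v
      rw [hS, hmark, mem_opened]
      constructor
      · rintro ⟨-, -, m, h1, rfl, h2⟩
        exact ⟨m, h1, h2, rfl⟩
      · rintro ⟨m, h1, h2, rfl⟩
        exact ⟨h.lt_n _ (hO.mem m h1), hfeas, m, h1, rfl, h2⟩
    rw [hSeq]
    refine ⟨fun f hf => ?_, fun hk => hx.card_opened hT1 hk, fun S' h1 h2 => ?_⟩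
    · obtain ⟨m, _, h1, rfl⟩ := mem_opened.1 hf
      exact h1.1
    · exact (hx.setValue_le h hO).trans (hcost.trans (hlow S' h1 h2))
  · have hSeq : S = ∅ := by
      rw [Finset.eq_empty_iff_forall_notMem]
      intro v hv
      exact hfeas ((hmark v).1 ((hS v).1 hv).2).1
    subst hSeq
    refine ⟨by simp, by simp, fun S' h1 h2 => ?_⟩
    have := hlow S' h1 h2
    rw [toE_of_neg (not_le.1 hfeas), top_le_iff] at this
    rw [this]
    exact le_top

end

/-! ### Metrics, decompositions and rounded distances -/

namespace WGraph
variable {n : ℕ} (G : WGraph n)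

theorem walkLen_nonneg {u v : Fin n} (p : G.graph.Walk u v) : 0 ≤ G.walkLen p := by
  refine List.sum_nonneg fun x hx => ?_
  obtain ⟨e, he, rfl⟩ := List.mem_map.1 hx
  exact (G.len_pos e (p.edges_subset_edgeSet he)).le

theorem dist_nonneg (u v : Fin n) : 0 ≤ G.dist u v :=
  Real.iInf_nonneg fun p => G.walkLen_nonneg p

theorem dist_triangle (u v w : Fin n) : G.dist u w ≤ G.dist u v + G.dist v w := by
  have : Nonempty (G.graph.Walk u v) := G.connected.preconnected u v
  have : Nonempty (G.graph.Walk v w) := G.connected.preconnected v w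
  refine le_ciInf_add_ciInf fun p p' => ?_
  refine (ciInf_le ⟨0, ?_⟩ (p.append p')).trans ?_
  · rintro _ ⟨r, rfl⟩
    exact G.walkLen_nonneg r
  · simp [walkLen, SimpleGraph.Walk.edges_append]

theorem dist_le_diam {B : Finset (Fin n)} {u v : Fin n} (hu : u ∈ B) (hv : v ∈ B) :
    G.dist u v ≤ G.diam B := by
  refine le_csSup (Set.Finite.bddAbove ?_) ⟨u, hu, v, hv, rfl⟩
  refine (Set.finite_range fun x : Fin n × Fin n => G.dist x.1 x.2).subset ?_
  rintro _ ⟨a, -, b, -, rfl⟩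
  exact ⟨(a, b), rfl⟩

end WGraph

namespace HierDecomp
variable {n : ℕ} (D : HierDecomp n) {u v w : Fin n} {i : ℕ}

theorem mem_of_mem_part {B : Finset (Fin n)} (hB : B ∈ (D.part i).parts) (hu : u ∈ B) : u ∈ D.W :=
  (D.part i).le hB hu

theorem part_eq {B B' : Finset (Fin n)} (hB : B ∈ (D.part i).parts) (hB' : B' ∈ (D.part i).parts)
    (hu : u ∈ B) (hu' : u ∈ B') : B = B' :=
  (D.part i).eq_of_mem_parts hB hB' hu hu'

theorem samePart_refl (i : ℕ) (hu : u ∈ D.W) : D.SamePart i u u := by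
  obtain ⟨B, hB, h⟩ := (D.part i).exists_mem hu
  exact ⟨B, hB, h, h⟩

theorem SamePart.symm {D : HierDecomp n} (h : D.SamePart i u v) : D.SamePart i v u := by
  obtain ⟨B, hB, h1, h2⟩ := h
  exact ⟨B, hB, h2, h1⟩

theorem SamePart.trans {D : HierDecomp n} (h : D.SamePart i u v) (h' : D.SamePart i v w) :
    D.SamePart i u w := by
  obtain ⟨B, hB, h1, h2⟩ := h
  obtain ⟨B', hB', h1', h2'⟩ := h'
  obtain rfl := D.part_eq hB hB' h2 h1'
  exact ⟨B, hB, h1, h2'⟩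

theorem samePart_top (hu : u ∈ D.W) (hv : v ∈ D.W) : D.SamePart D.top u v :=
  ⟨D.W, by simp [D.part_top], hu, hv⟩

theorem samePart_joinLevel (hu : u ∈ D.W) (hv : v ∈ D.W) : D.SamePart (D.joinLevel u v) u v :=
  Nat.sInf_mem (s := {i | D.SamePart i u v}) ⟨_, D.samePart_top hu hv⟩

theorem joinLevel_le (h : D.SamePart i u v) : D.joinLevel u v ≤ i := Nat.sInf_le h

theorem joinLevel_le_top (hu : u ∈ D.W) (hv : v ∈ D.W) : D.joinLevel u v ≤ D.top :=
  D.joinLevel_le (D.samePart_top hu hv)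

theorem samePart_of_joinLevel_le (hu : u ∈ D.W) (hv : v ∈ D.W) (h : D.joinLevel u v ≤ i)
    (hi : i ≤ D.top) : D.SamePart i u v :=
  D.samePart_mono h hi (D.samePart_joinLevel hu hv)

theorem joinLevel_self (hu : u ∈ D.W) : D.joinLevel u u = 0 :=
  Nat.le_zero.1 (D.joinLevel_le (D.samePart_refl 0 hu))

theorem joinLevel_comm (u v : Fin n) : D.joinLevel u v = D.joinLevel v u := by
  unfold joinLevel
  congr 1
  ext i
  exact ⟨SamePart.symm, SamePart.symm⟩

theorem joinLevel_le_max (hu : u ∈ D.W) (hv : v ∈ D.W) (hw : w ∈ D.W) :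
    D.joinLevel u w ≤ max (D.joinLevel u v) (D.joinLevel v w) := by
  have h : max (D.joinLevel u v) (D.joinLevel v w) ≤ D.top :=
    max_le (D.joinLevel_le_top hu hv) (D.joinLevel_le_top hv hw)
  exact D.joinLevel_le ((D.samePart_of_joinLevel_le hu hv (le_max_left _ _) h).trans
    (D.samePart_of_joinLevel_le hv hw (le_max_right _ _) h))

theorem one_le_joinLevel (hu : u ∈ D.W) (hv : v ∈ D.W) (h : u ≠ v) : 1 ≤ D.joinLevel u v := by
  by_contra hc
  obtain ⟨B, hB, h1, h2⟩ := D.samePart_joinLevel hu hv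
  rw [show D.joinLevel u v = 0 by omega] at hB
  obtain ⟨a, rfl⟩ := Finset.card_eq_one.1 (D.part_zero B hB)
  rw [Finset.mem_singleton] at h1 h2
  exact h (h1.trans h2.symm)

theorem cutAt_joinLevel (hu : u ∈ D.W) (hv : v ∈ D.W) (h : u ≠ v) :
    D.CutAt (D.joinLevel u v - 1) u v :=
  (D.cutAt_iff hu hv).2 (by have := D.one_le_joinLevel hu hv h; omega)

end HierDecomp

theorem roundUp_le {ρ : ℝ} (hρ : 0 < ρ) {i g : ℕ} {x : ℝ} (hg : 1 ≤ g) (hx : x ≤ ρ * g * 2 ^ i) :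
    roundUp ρ i x ≤ (69 + g) * ρ * 2 ^ i :=
  (isLeast_roundUp hρ i x).2 ⟨g, hg, hx, rfl⟩

/-- The multiplier `⌊x / (ρ 2^i)⌋ + 1` overshoots by at most one unit `ρ 2^i`, and the rounding adds
`69` units. -/
theorem roundUp_le_add {ρ : ℝ} (hρ : 0 < ρ) (i : ℕ) {x : ℝ} (hx : 0 ≤ x) :
    roundUp ρ i x ≤ x + 70 * ρ * 2 ^ i := by
  have hs : 0 < ρ * 2 ^ i := by positivity
  have h1 := Nat.floor_le (div_nonneg hx hs.le)
  have h2 := Nat.lt_floor_add_one (x / (ρ * 2 ^ i))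
  rw [le_div_iff₀ hs] at h1
  rw [div_lt_iff₀ hs] at h2
  refine (roundUp_le hρ (g := ⌊x / (ρ * 2 ^ i)⌋₊ + 1) (by omega) ?_).trans ?_
  · push_cast
    linarith
  · push_cast
    linarith

section
variable {n : ℕ} {G : WGraph n} {D : HierDecomp n} {I : ℕ → Finset (Fin n) → Finset (Fin n)}
  {ρ : ℝ} {v f : Fin n}

theorem rdist_self : rdist G D I ρ v v = 0 := if_pos rfl

theorem rdist_le {B : Finset (Fin n)} {u : Fin n} (hne : v ≠ f)
    (hB : B ∈ (D.part (D.joinLevel v f)).parts) (hv : v ∈ B) (hf : f ∈ B)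
    (hu : u ∈ I (D.joinLevel v f) B) : rdist G D I ρ v f ≤
      ENNReal.ofReal (G.dist v u + roundUp ρ (D.joinLevel v f) (G.dist u f)) := by
  have hvW := D.mem_of_mem_part hB hv
  have hfW := D.mem_of_mem_part hB hf
  have hj : D.joinLevel v f - 1 + 1 = D.joinLevel v f :=
    Nat.sub_add_cancel (D.one_le_joinLevel hvW hfW hne)
  rw [rdist, if_neg hne]
  refine iInf_le_of_le _ (iInf_le_of_le (D.cutAt_joinLevel hvW hfW hne) ?_)
  rw [hj]
  exact iInf_le_of_le B (iInf_le_of_le hB (iInf_le_of_le ⟨hv, hf⟩ (iInf₂_le u hu)))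

theorem exists_precise {h c : ℕ} (hI : HasInterfaces G D I h ρ c) (hne : v ≠ f) (hv : v ∈ D.W)
    (hf : f ∈ D.W) : ∃ B ∈ (D.part (D.joinLevel v f)).parts, v ∈ B ∧ f ∈ B ∧
      ∃ u ∈ I (D.joinLevel v f) B,
        G.dist v u + G.dist u f ≤ G.dist v f + 68 * ρ * 2 ^ D.joinLevel v f := by
  obtain ⟨B, hB, h1, h2⟩ := D.samePart_joinLevel hv hf
  exact ⟨B, hB, h1, h2, hI.precise _ (D.one_le_joinLevel hv hf hne) (D.joinLevel_le_top hv hf) B hB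
    v h1 f h2 (D.cutAt_joinLevel hv hf hne)⟩

/-- The constant is `68` from precision plus `70` from rounding. That it equals `2 * 69` is what
makes claims on higher levels harmless. -/
theorem rdist_le_dist_add {h c : ℕ} (hI : HasInterfaces G D I h ρ c) (hρ : 0 < ρ) (hne : v ≠ f)
    (hv : v ∈ D.W) (hf : f ∈ D.W) : rdist G D I ρ v f ≤
      ENNReal.ofReal (G.dist v f + 138 * ρ * 2 ^ D.joinLevel v f) := by
  obtain ⟨B, hB, h1, h2, u, hu, hle⟩ := exists_precise hI hne hv hf
  refine (rdist_le hne hB h1 h2 hu).trans (ENNReal.ofReal_le_ofReal ?_)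
  have := roundUp_le_add hρ (D.joinLevel v f) (G.dist_nonneg u f)
  linarith

/-- Precision serves only to make the interface nonempty; the minimum over a nonempty finite set is
attained. -/
theorem exists_rdist_eq {h c : ℕ} (hI : HasInterfaces G D I h ρ c) (hne : v ≠ f)
    (hv : v ∈ D.W) (hf : f ∈ D.W) : ∃ B ∈ (D.part (D.joinLevel v f)).parts, v ∈ B ∧ f ∈ B ∧
      ∃ u ∈ I (D.joinLevel v f) B, rdist G D I ρ v f =
        ENNReal.ofReal (G.dist v u + roundUp ρ (D.joinLevel v f) (G.dist u f)) := by
  obtain ⟨B, hB, h1, h2, u', hu', -⟩ := exists_precise hI hne hv hf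
  obtain ⟨u, hu, hmin⟩ := Finset.exists_min_image (I (D.joinLevel v f) B)
    (fun u => ENNReal.ofReal (G.dist v u + roundUp ρ (D.joinLevel v f) (G.dist u f))) ⟨u', hu'⟩
  refine ⟨B, hB, h1, h2, u, hu, le_antisymm (rdist_le hne hB h1 h2 hu) ?_⟩
  rw [rdist, if_neg hne]
  refine le_iInf₂ fun j hj => le_iInf₂ fun B' hB' => le_iInf fun hm => le_iInf₂ fun p hp => ?_
  have hj' := (D.cutAt_iff hv hf).1 hj
  rw [← hj'] at hB' hp ⊢
  obtain rfl := D.part_eq hB hB' h1 hm.1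
  exact hmin p hp

end

/-! ### The derived parameters -/

/-- The effect of `prep` on the data. -/
def prepPar (p : Par) : Par :=
  let B₁ := p.B + (p.n + p.q + 2)
  let M := levelsM { p with R := p.B, B := B₁ }
  let L := p.top - M
  let B₂ := B₁ + M
  let K := sizeK { p with R := p.B, B := B₂, M := M, L := L }
  let B₃ := B₂ + (1 + 2 * (M * K))
  let N := numN { p with R := p.B, B := B₃, M := M, L := L, K := K }
  let B₄ := B₃ + N
  let T := sizeT { p with R := p.B, B := B₄, M := M, L := L, K := K, N := N }
  { p with R := p.B, B := B₄, M := M, L := L, K := K, N := N, T := T }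

/-- Separate names for the intermediate states avoid the nested updates, in which each state occurs
several times. -/
theorem par_put7_prep {p : Par} {σ σ₁ σ₂ σ₃ σ₄ σ₅ σ₆ σ₇ σ₈ σ₉ σ₁₀ : State} (h : par σ = p)
    (h₁ : σ₁ = put7 1 (par σ).B σ)
    (h₂ : σ₂ = put7 0 ((par σ₁).B + ((par σ₁).n + (par σ₁).q + 2)) σ₁)
    (h₃ : σ₃ = put7 3 (levelsM (par σ₂)) σ₂)
    (h₄ : σ₄ = put7 2 ((par σ₃).top - (par σ₃).M) σ₃)
    (h₅ : σ₅ = put7 0 ((par σ₄).B + (par σ₄).M) σ₄)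
    (h₆ : σ₆ = put7 4 (sizeK (par σ₅)) σ₅)
    (h₇ : σ₇ = put7 0 ((par σ₆).B + (1 + 2 * ((par σ₆).M * (par σ₆).K))) σ₆)
    (h₈ : σ₈ = put7 5 (numN (par σ₇)) σ₇)
    (h₉ : σ₉ = put7 0 ((par σ₈).B + (par σ₈).N) σ₈)
    (h₁₀ : σ₁₀ = put7 6 (sizeT (par σ₉)) σ₉) : par σ₁₀ = prepPar p := by
  replace h₁ := (congrArg par h₁).trans (par_put7_1 _ _)
  replace h₂ := (congrArg par h₂).trans (par_put7_0 _ _)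
  replace h₃ := (congrArg par h₃).trans (par_put7_3 _ _)
  replace h₄ := (congrArg par h₄).trans (par_put7_2 _ _)
  replace h₅ := (congrArg par h₅).trans (par_put7_0 _ _)
  replace h₆ := (congrArg par h₆).trans (par_put7_4 _ _)
  replace h₇ := (congrArg par h₇).trans (par_put7_0 _ _)
  replace h₈ := (congrArg par h₈).trans (par_put7_5 _ _)
  replace h₉ := (congrArg par h₉).trans (par_put7_0 _ _)
  replace h₁₀ := (congrArg par h₁₀).trans (par_put7_6 _ _)
  generalize par σ = p₀, par σ₁ = p₁, par σ₂ = p₂, par σ₃ = p₃, par σ₄ = p₄, par σ₅ = p₅,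
    par σ₆ = p₆, par σ₇ = p₇, par σ₈ = p₈, par σ₉ = p₉, par σ₁₀ = p₁₀ at *
  subst h h₁
  dsimp only at h₂
  subst h₂
  dsimp only at h₃
  rw [h₁₀, h₉, h₈, h₇, h₆, h₅, h₄, h₃]
  rfl

theorem par_prep (σ : State) : par (prep σ) = prepPar (par σ) :=
  par_put7_prep rfl rfl rfl rfl rfl rfl rfl rfl rfl rfl rfl

theorem ite_eq_one_iff {P : Prop} [Decidable P] : (if P then 1 else 0 : ℕ) = 1 ↔ P := by
  split_ifs with h <;> simp [h]

theorem levelsM_le {p : Par} {m : ℕ} (h : ∀ f f', p.inF f = 1 → p.inF f' = 1 → f ≠ f' →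
    p.top + 1 - p.join f f' ≤ m) : levelsM p ≤ m := by
  refine supN_le fun f _ => supN_le fun f' _ => ?_
  split_ifs with hc
  · exact h f f' hc.1 hc.2.1 hc.2.2
  · exact Nat.zero_le _

theorem le_levelsM {p : Par} {f f' : ℕ} (hf : f < p.B) (hf' : f' < p.B) (h1 : p.inF f = 1)
    (h2 : p.inF f' = 1) (hne : f ≠ f') : p.top + 1 - p.join f f' ≤ levelsM p := by
  unfold levelsM
  have h3 := le_supN (f := fun f' => if p.inF f = 1 ∧ p.inF f' = 1 ∧ ¬ f = f' then
    p.top + 1 - p.join f f' else 0) hf'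
  have h4 := le_supN (f := fun f => supN p.B fun f' => if p.inF f = 1 ∧ p.inF f' = 1 ∧ ¬ f = f' then
    p.top + 1 - p.join f f' else 0) hf
  simp only [h1, h2, hne, not_false_eq_true, and_self, if_true] at h3 h4
  exact h3.trans (by simpa [h1] using h4)

/-- Counts do not depend on the range of the loop once it covers all vertices, so parameters
computed under different size bounds can be compared. -/
theorem countN_of_le {B n : ℕ} {P : ℕ → Prop} (hB : n ≤ B) (hP : ∀ u, P u → u < n) :
    countN B P = countN n P := by
  rw [countN_eq, countN_eq]
  congr 1
  ext u
  simp only [Finset.mem_filter, Finset.mem_range]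
  exact ⟨fun h => ⟨hP u h.2, h.2⟩, fun h => ⟨h.1.trans_le hB, h.2⟩⟩

theorem sizeK_le {p : Par} {k : ℕ} (hB : p.n ≤ p.B) (hI : ∀ v i u, p.itf v i u = 1 → u < p.n)
    (h : ∀ v i, (countN p.n fun u => p.itf v i u = 1) ≤ k) : sizeK p ≤ k := by
  refine supN_le fun v _ => supN_le fun l _ => ?_
  split_ifs
  · rw [countN_of_le hB fun u hu => hI _ _ u hu]
    exact h _ _
  · exact Nat.zero_le _

theorem le_sizeK {p : Par} {v l : ℕ} (hB : p.n ≤ p.B) (hM : p.M ≤ p.B)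
    (hI : ∀ v i u, p.itf v i u = 1 → u < p.n) (hv : v < p.n) (hl : l < p.M) :
    (countN p.n fun u => p.itf v (p.L + 1 + l) u = 1) ≤ sizeK p := by
  have h4 := le_supN (B := p.B) (f := fun v => supN p.B fun l => if l < p.M then
    countN p.B fun u => p.itf v (p.L + 1 + l) u = 1 else 0) (i := v) (by omega)
  have h3 := le_supN (B := p.B) (f := fun l => if l < p.M then
    countN p.B fun u => p.itf v (p.L + 1 + l) u = 1 else 0) (i := l) (by omega)
  simp only [hl, if_true] at h3
  rw [countN_of_le hB fun u hu => hI _ _ u hu] at h3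
  exact h3.trans h4

theorem numN_eq {p : Par} (h : 1 + 2 * (p.M * p.K) ≤ p.B) :
    numN p = (p.n + 1) * (p.R + 2) ^ (1 + 2 * (p.M * p.K)) := by
  rw [numN, powN_eq h]

section
variable {p : Par}

theorem prepPar_M_le {m : ℕ} (h : ∀ f f', p.inF f = 1 → p.inF f' = 1 → f ≠ f' →
    p.top + 1 - p.join f f' ≤ m) : (prepPar p).M ≤ m :=
  levelsM_le (p := { p with R := p.B, B := p.B + (p.n + p.q + 2) }) h

theorem le_prepPar_M (hF : ∀ f, p.inF f = 1 → f < p.n) {f f' : ℕ} (h1 : p.inF f = 1)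
    (h2 : p.inF f' = 1) (hne : f ≠ f') : p.top + 1 - p.join f f' ≤ (prepPar p).M :=
  le_levelsM (p := { p with R := p.B, B := p.B + (p.n + p.q + 2) })
    (show f < p.B + (p.n + p.q + 2) by have := hF f h1; omega)
    (show f' < p.B + (p.n + p.q + 2) by have := hF f' h2; omega) h1 h2 hne

theorem prepPar_K_le (hI : ∀ v i u, p.itf v i u = 1 → u < p.n) {k : ℕ}
    (h : ∀ v i, (countN p.n fun u => p.itf v i u = 1) ≤ k) :
    (prepPar p).K ≤ k :=
  sizeK_le (show p.n ≤ p.B + (p.n + p.q + 2) + (prepPar p).M by omega) hI h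

theorem le_prepPar_K (hI : ∀ v i u, p.itf v i u = 1 → u < p.n) {v l : ℕ} (hv : v < p.n)
    (hl : l < (prepPar p).M) :
    (countN p.n fun u => p.itf v ((prepPar p).L + 1 + l) u = 1) ≤ (prepPar p).K := by
  have h := le_sizeK (p := { p with
    R := p.B
    M := (prepPar p).M
    L := (prepPar p).L
    B := p.B + (p.n + p.q + 2) + (prepPar p).M })
    (show p.n ≤ p.B + (p.n + p.q + 2) + (prepPar p).M by omega)
    (show (prepPar p).M ≤ p.B + (p.n + p.q + 2) + (prepPar p).M by omega) hI hv hl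
  exact h

theorem prepPar_N : (prepPar p).N =
    (p.n + 1) * (p.B + 2) ^ (1 + 2 * ((prepPar p).M * (prepPar p).K)) :=
  numN_eq (show 1 + 2 * ((prepPar p).M * (prepPar p).K) ≤ p.B + (p.n + p.q + 2) + (prepPar p).M +
    (1 + 2 * ((prepPar p).M * (prepPar p).K)) by omega)

theorem prepPar_L : (prepPar p).L = p.top - (prepPar p).M := by
  simp only [prepPar]

theorem prepPar_eq : prepPar p = { p with
    B := (prepPar p).B
    R := p.B
    L := (prepPar p).L
    M := (prepPar p).M
    K := (prepPar p).K
    N := (prepPar p).N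
    T := (prepPar p).T } := by
  simp only [prepPar]

theorem prepPar_T : (prepPar p).T = sizeT (prepPar p) := by
  simp only [prepPar, sizeT]

theorem prepPar_B : (prepPar p).B = p.B + (p.n + p.q + 2) + (prepPar p).M +
    (1 + 2 * ((prepPar p).M * (prepPar p).K)) + (prepPar p).N := by
  simp only [prepPar]

end

/-! ### The input -/

section
variable {n : ℕ} (G : WGraph n) (D : HierDecomp n) (I : ℕ → Finset (Fin n) → Finset (Fin n))
  (J : Instance n) (q : ℕ) (ε ρ : ℝ)

/-- The data of an input, where `b` is the initial size bound. -/
def inputPar (b : ℕ) : Par := { par (inputState G D I J q ε ρ) with B := b }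

variable {G D I J q ε ρ} {b : ℕ}

theorem inputPar_inW {a : ℕ} : (inputPar G D I J q ε ρ b).inW a = 1 ↔
    ∃ v : Fin n, (v : ℕ) = a ∧ v ∈ D.W := by
  exact ite_eq_one_iff

theorem inputPar_inF {a : ℕ} : (inputPar G D I J q ε ρ b).inF a = 1 ↔
    ∃ v : Fin n, (v : ℕ) = a ∧ v ∈ J.F := by
  exact ite_eq_one_iff

theorem inputPar_join {u v : Fin n} (hu : u ∈ D.W) (hv : v ∈ D.W) :
    (inputPar G D I J q ε ρ b).join u v = D.joinLevel u v := by
  change (if h : (u : ℕ) < n ∧ (v : ℕ) < n then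
        if (⟨u, h.1⟩ : Fin n) ∈ D.W ∧ (⟨v, h.2⟩ : Fin n) ∈ D.W then
          D.joinLevel ⟨u, h.1⟩ ⟨v, h.2⟩ else 0
      else 0) = _
  simp [hu, hv]

theorem inputPar_itf {a i a' : ℕ} : (inputPar G D I J q ε ρ b).itf a i a' = 1 ↔
    1 ≤ i ∧ i ≤ D.top ∧ ∃ B ∈ (D.part i).parts, (∃ v : Fin n, (v : ℕ) = a ∧ v ∈ B) ∧
      ∃ u : Fin n, (u : ℕ) = a' ∧ u ∈ I i B := by
  exact ite_eq_one_iff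

theorem inputPar_dist (u v : Fin n) : (inputPar G D I J q ε ρ b).dist u v = G.dist u v := by
  change (if h : (u : ℕ) < n ∧ (v : ℕ) < n then G.dist ⟨u, h.1⟩ ⟨v, h.2⟩ else 0) = _
  simp

theorem inputPar_dem (v : Fin n) : (inputPar G D I J q ε ρ b).dem v = J.demand v := by
  change (if h : (v : ℕ) < n then (J.demand ⟨v, h⟩ : ℝ) else 0) = _
  simp

theorem inputPar_dem_nonneg (a : ℕ) : 0 ≤ (inputPar G D I J q ε ρ b).dem a := by
  change 0 ≤ (if h : a < n then (J.demand ⟨a, h⟩ : ℝ) else 0)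
  split_ifs <;> positivity

theorem inputPar_dem_eq_zero {a : ℕ} (ha : ¬ a < n) : (inputPar G D I J q ε ρ b).dem a = 0 := by
  change (if h : a < n then (J.demand ⟨a, h⟩ : ℝ) else 0) = 0
  rw [dif_neg ha]

theorem inputPar_dist_nonneg (a a' : ℕ) : 0 ≤ (inputPar G D I J q ε ρ b).dist a a' := by
  change 0 ≤ (if h : a < n ∧ a' < n then G.dist ⟨a, h.1⟩ ⟨a', h.2⟩ else 0)
  split_ifs
  · exact G.dist_nonneg _ _
  · exact le_rfl

theorem inputPar_pow {i : ℕ} (hi : i ≤ D.top) : (inputPar G D I J q ε ρ b).pow i = 2 ^ i := by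
  change (if i ≤ D.top then (2 : ℝ) ^ i else 0) = _
  rw [if_pos hi]

theorem inputPar_pow_nonneg (i : ℕ) : 0 ≤ (inputPar G D I J q ε ρ b).pow i := by
  change 0 ≤ (if i ≤ D.top then (2 : ℝ) ^ i else 0)
  split_ifs <;> positivity

theorem inputPar_w_nonneg (a : ℕ) : 0 ≤ (inputPar G D I J q ε ρ b).w a := by
  change 0 ≤ (if h : a < n then
        match J.objective with
        | .kClustering _ => 0
        | .facilityLocation w => (w ⟨a, h⟩ : ℝ)
      else 0)
  split_ifs with h
  · split
    · exact le_rfl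
    · next w _ => exact (w ⟨a, h⟩).2.le
  · exact le_rfl

/-- The rounded distances, for the numbers of the vertices. -/
def rdistNat (G : WGraph n) (D : HierDecomp n) (I : ℕ → Finset (Fin n) → Finset (Fin n)) (ρ : ℝ)
    (a a' : ℕ) : ℝ≥0∞ :=
  if h : a < n ∧ a' < n then rdist G D I ρ ⟨a, h.1⟩ ⟨a', h.2⟩ else 0

theorem rdistNat_val (u v : Fin n) : rdistNat G D I ρ u v = rdist G D I ρ u v := by
  simp [rdistNat]

/-- On the level where `v` and `f` are joined, `u` is a candidate in the definition of `dist'`. On a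
higher level the `69` units of the rounding pay for the detour. -/
theorem inputPar_rd_le {h c : ℕ} (hI : HasInterfaces G D I h ρ c) (hρ : 0 < ρ)
    {v f i u g : ℕ} (hvW : (inputPar G D I J q ε ρ b).inW v = 1)
    (hfW : (inputPar G D I J q ε ρ b).inW f = 1)
    (hj : (inputPar G D I J q ε ρ b).join v f ≤ i) (hu : (inputPar G D I J q ε ρ b).itf v i u = 1)
    (hg : 1 ≤ g)
    (hd : (inputPar G D I J q ε ρ b).dist u f ≤
      (inputPar G D I J q ε ρ b).ρ * g * (inputPar G D I J q ε ρ b).pow i) :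
    rdistNat G D I ρ v f ≤ toE (via (inputPar G D I J q ε ρ b) v i u g) := by
  obtain ⟨v, rfl, hv⟩ := inputPar_inW.1 hvW
  obtain ⟨f, rfl, hf⟩ := inputPar_inW.1 hfW
  obtain ⟨hi1, hi2, B, hB, ⟨v', hv', hvB⟩, u, rfl, huI⟩ := inputPar_itf.1 hu
  obtain rfl := Fin.ext hv'
  rw [inputPar_join hv hf] at hj
  rw [via, inputPar_dist, inputPar_pow hi2]
  rw [inputPar_dist, inputPar_pow hi2] at hd
  change _ ≤ ρ * _ * _ at hd
  change _ ≤ toE (_ + (69 + (g : ℝ)) * ρ * _)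
  have hvu := G.dist_nonneg v' u
  rw [rdistNat_val, toE_of_nonneg (by positivity)]
  by_cases hne : v' = f
  · subst hne
    rw [rdist_self]
    exact bot_le
  rcases hj.eq_or_lt with rfl | hlt
  · have hfB : f ∈ B := by
      obtain ⟨B', hB', h1, h2⟩ := D.samePart_joinLevel hv hf
      rwa [D.part_eq hB hB' hvB h1]
    refine (rdist_le hne hB hvB hfB huI).trans (ENNReal.ofReal_le_ofReal ?_)
    have := roundUp_le hρ hg hd
    linarith
  -- As `i` exceeds the join level `j`, `138 ρ 2^j ≤ 69 ρ 2^i`; the triangle inequality through `u`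
  -- and the bound on `dist u f` by `g` units do the rest.
  · refine (rdist_le_dist_add hI hρ hne hv hf).trans (ENNReal.ofReal_le_ofReal ?_)
    have h1 := G.dist_triangle v' u f
    have h2 : (2 : ℝ) * 2 ^ D.joinLevel v' f ≤ 2 ^ i := by
      rw [← pow_succ']
      exact pow_le_pow_right₀ (by norm_num) hlt
    have h3 := mul_le_mul_of_nonneg_left h2 hρ.le
    linarith

/-- The interface point and the multiplier that attain `dist'` serve as `u` and `g`; what needs an
argument is that `g` is at most `R`. -/
theorem inputPar_le_rd {h c : ℕ} (hI : HasInterfaces G D I h ρ c) (hρ : 0 < ρ) (hρ' : ρ ≤ 1 / 2)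
    {R : ℕ} (hR : ¬ ((R : ℝ) * ρ < 101 ∧ 2 ≤ n)) {v f : ℕ}
    (hvW : (inputPar G D I J q ε ρ b).inW v = 1) (hfW : (inputPar G D I J q ε ρ b).inW f = 1)
    (hne : v ≠ f) : ∃ u g : ℕ, (inputPar G D I J q ε ρ b).itf v
        ((inputPar G D I J q ε ρ b).join v f) u = 1 ∧ 1 ≤ g ∧ g ≤ R ∧
      (inputPar G D I J q ε ρ b).dist u f ≤ (inputPar G D I J q ε ρ b).ρ * g *
        (inputPar G D I J q ε ρ b).pow ((inputPar G D I J q ε ρ b).join v f) ∧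
      toE (via (inputPar G D I J q ε ρ b) v ((inputPar G D I J q ε ρ b).join v f) u g) ≤
        rdistNat G D I ρ v f := by
  obtain ⟨v, rfl, hv⟩ := inputPar_inW.1 hvW
  obtain ⟨f, rfl, hf⟩ := inputPar_inW.1 hfW
  have hne : v ≠ f := fun h => hne (by rw [h])
  have hn : 2 ≤ n := by
    have := v.2
    have := f.2
    have : (v : ℕ) ≠ f := fun h => hne (Fin.ext h)
    omega
  have hR : 101 ≤ (R : ℝ) * ρ := by
    by_contra hc
    exact hR ⟨not_le.1 hc, hn⟩
  have hjt := D.joinLevel_le_top hv hf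
  obtain ⟨B, hB, hvB, hfB, u, hu, heq⟩ := exists_rdist_eq hI hne hv hf
  obtain ⟨g, hg, hd, hr⟩ := (isLeast_roundUp hρ (D.joinLevel v f) (G.dist u f)).1
  have hvu := G.dist_nonneg v u
  refine ⟨u, g, ?_, hg, ?_, ?_, ?_⟩
  · rw [inputPar_join hv hf, inputPar_itf]
    exact ⟨D.one_le_joinLevel hv hf hne, hjt, B, hB, ⟨v, rfl, hvB⟩, u, rfl, hu⟩
  · have h1 := rdist_le_dist_add hI hρ hne hv hf
    have h2 := G.dist_nonneg v f
    rw [heq, ENNReal.ofReal_le_ofReal_iff (by positivity), hr] at h1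
    have h3 := (G.dist_le_diam hvB hfB).trans (hI.diam_le _ hjt B hB)
    have h4 : (0 : ℝ) < 2 ^ D.joinLevel v f := by positivity
    rw [pow_add] at h3
    -- The diameter of the part contributes `2 ^ 5 = 32`, and `138 ρ ≤ 69` because `ρ ≤ 1 / 2`.
    have h5 : (69 + (g : ℝ)) * ρ * 2 ^ D.joinLevel v f ≤ 101 * 2 ^ D.joinLevel v f := by
      nlinarith
    have h6 := le_of_mul_le_mul_right h5 h4
    have h7 : (g : ℝ) * ρ < R * ρ := by linarith
    exact_mod_cast (lt_of_mul_lt_mul_right h7 hρ.le).le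
  · rw [inputPar_join hv hf, inputPar_pow hjt, inputPar_dist]
    exact hd
  · rw [inputPar_join hv hf, via, inputPar_pow hjt, inputPar_dist, rdistNat_val, heq]
    change toE (_ + (69 + (g : ℝ)) * ρ * _) ≤ _
    rw [hr, toE_of_nonneg (by positivity)]

end

/-! ### Correctness on inputs -/

theorem rank_lt_countN {p : Par} (hI : ∀ v i u, p.itf v i u = 1 → u < p.n) {v i u : ℕ}
    (hu : p.itf v i u = 1) : rank p v i u < countN p.n fun u => p.itf v i u = 1 := by
  rw [rank, countN_eq, countN_eq]
  refine Finset.card_lt_card ((Finset.ssubset_iff_of_subset fun j hj => ?_).2 ⟨u, ?_, ?_⟩)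
  · simp only [Finset.mem_filter, Finset.mem_range] at hj ⊢
    exact ⟨hI v i j hj.2.2, hj.2.2⟩
  · simp only [Finset.mem_filter, Finset.mem_range]
    exact ⟨hI v i u hu, hu⟩
  · simp

section
variable {n : ℕ} {G : WGraph n} {D : HierDecomp n} {I : ℕ → Finset (Fin n) → Finset (Fin n)}
  {J : Instance n} {q : ℕ} {ε ρ : ℝ} {b : ℕ}

theorem inputPar_itf_lt (v i u : ℕ) (h : (inputPar G D I J q ε ρ b).itf v i u = 1) : u < n := by
  obtain ⟨-, -, _, -, -, u, rfl, -⟩ := inputPar_itf.1 h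
  exact u.2

theorem inputPar_inF_lt (f : ℕ) (h : (inputPar G D I J q ε ρ b).inF f = 1) : f < n := by
  obtain ⟨f, rfl, -⟩ := inputPar_inF.1 h
  exact f.2

theorem inputPar_join_of_inF (hJ : J.Coarse G D ε) {f f' : ℕ}
    (h1 : (inputPar G D I J q ε ρ b).inF f = 1) (h2 : (inputPar G D I J q ε ρ b).inF f' = 1)
    (hne : f ≠ f') : 1 ≤ (inputPar G D I J q ε ρ b).join f f' ∧
      (inputPar G D I J q ε ρ b).join f f' ≤ D.top := by
  obtain ⟨f, rfl, hf⟩ := inputPar_inF.1 h1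
  obtain ⟨f', rfl, hf'⟩ := inputPar_inF.1 h2
  have hf := hJ.facilities f hf
  have hf' := hJ.facilities f' hf'
  rw [inputPar_join hf hf']
  exact ⟨D.one_le_joinLevel hf hf' fun h => hne (by rw [h]), D.joinLevel_le_top hf hf'⟩

theorem facts_of_bounds {h c : ℕ} (hI : HasInterfaces G D I h ρ c) (hρ : 0 < ρ) (hρ' : ρ ≤ 1 / 2)
    (hJ : J.Coarse G D ε) (hq : 1 ≤ q) {B R L M K N T : ℕ} (hR : ¬ ((R : ℝ) * ρ < 101 ∧ 2 ≤ n))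
    (hM : ∀ f f', (inputPar G D I J q ε ρ R).inF f = 1 → (inputPar G D I J q ε ρ R).inF f' = 1 →
      f ≠ f' → D.top + 1 - (inputPar G D I J q ε ρ R).join f f' ≤ M) (hMtop : M ≤ D.top)
    (hL : L = D.top - M)
    (hK : ∀ v < n, ∀ l < M,
      (countN n fun u => (inputPar G D I J q ε ρ R).itf v (L + 1 + l) u = 1) ≤ K)
    (hN : N = (n + 1) * (R + 2) ^ (1 + 2 * (M * K)))
    (hB : B = R + (n + q + 2) + M + (1 + 2 * (M * K)) + N) :
    Facts { inputPar G D I J q ε ρ R with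
      B := B, R := R, L := L, M := M, K := K, N := N, T := T } (rdistNat G D I ρ) := by
  have iW : ∀ {a}, (inputPar G D I J q ε ρ R).inW a = 1 ↔ ∃ v : Fin n, (v : ℕ) = a ∧ v ∈ D.W :=
    inputPar_inW
  have iF : ∀ {a}, (inputPar G D I J q ε ρ R).inF a = 1 ↔ ∃ v : Fin n, (v : ℕ) = a ∧ v ∈ J.F :=
    inputPar_inF
  have ij : ∀ {u v : Fin n}, u ∈ D.W → v ∈ D.W →
    (inputPar G D I J q ε ρ R).join u v = D.joinLevel u v := inputPar_join
  have hit : ∀ v i u, (inputPar G D I J q ε ρ R).itf v i u = 1 → u < n := inputPar_itf_lt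
  have hdist : ∀ a a', 0 ≤ (inputPar G D I J q ε ρ R).dist a a' := inputPar_dist_nonneg
  have hpow : ∀ i, 0 ≤ (inputPar G D I J q ε ρ R).pow i := inputPar_pow_nonneg
  have hdem : ∀ a, 0 ≤ (inputPar G D I J q ε ρ R).dem a := inputPar_dem_nonneg
  have hw : ∀ a, 0 ≤ (inputPar G D I J q ε ρ R).w a := inputPar_w_nonneg
  have hrd := @inputPar_rd_le n G D I J q ε ρ R h c hI hρ
  have hle := @inputPar_le_rd n G D I J q ε ρ R h c hI hρ hρ' R hR
  refine
    { inW_of_inF := fun v hv₀ => ?_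
      inW_of_dem := fun v hv => ?_
      lt_n := fun v hv₀ => ?_
      join_self := fun v hv₀ => ?_
      join_comm := fun v u hv₀ hu₀ => ?_
      join_tri := fun u v w hu₀ hv₀ hw₀ => ?_
      join_le := fun u v hu₀ hv₀ => ?_
      itf_congr := fun v v' i u hv₀ hv'₀ hj hi => ?_
      itf_lt := hit
      rd_self := fun v hv₀ => ?_
      rd_le := fun v f i u g hv hf hj hu hg hd => hrd hv hf hj hu hg hd
      le_rd := fun v f hv hf hne => hle hv hf hne
      sep := fun f f' hf hf' hj => ?_
      levels := ?_
      rank_lt := fun v l u hv₀ hl hu => ?_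
      dist_nonneg := hdist
      ρ_nonneg := hρ.le
      pow_nonneg := hpow
      dem_nonneg := hdem
      w_nonneg := hw
      one_le_q := hq
      q_le := ?_
      n_lt := ?_
      R_lt := ?_
      M_le := ?_
      digits_le := ?_
      N_eq := hN
      N_le := ?_ }
  · obtain ⟨f, rfl, hf⟩ := iF.1 hv₀
    exact iW.2 ⟨f, rfl, hJ.facilities f hf⟩
  · have hvn : v < n := by
      by_contra hc
      exact hv.ne' (inputPar_dem_eq_zero (G := G) (D := D) (I := I) (q := q) (ε := ε) (ρ := ρ) (b := R) hc)
    refine iW.2 ⟨⟨v, hvn⟩, rfl, hJ.clients _ ?_⟩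
    have := hv.trans_eq (inputPar_dem (G := G) (D := D) (I := I) (q := q) (ε := ε) (ρ := ρ) (b := R) ⟨v, hvn⟩)
    exact_mod_cast this
  · obtain ⟨v, rfl, -⟩ := iW.1 hv₀
    exact v.2
  · obtain ⟨v, rfl, hv⟩ := iW.1 hv₀
    exact (ij hv hv).trans (D.joinLevel_self hv)
  · obtain ⟨v, rfl, hv⟩ := iW.1 hv₀
    obtain ⟨u, rfl, hu⟩ := iW.1 hu₀
    exact (ij hv hu).trans
      ((D.joinLevel_comm v u).trans (ij hu hv).symm)
  · obtain ⟨u, rfl, hu⟩ := iW.1 hu₀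
    obtain ⟨v, rfl, hv⟩ := iW.1 hv₀
    obtain ⟨w, rfl, hw⟩ := iW.1 hw₀
    change (inputPar G D I J q ε ρ R).join u w ≤
      max ((inputPar G D I J q ε ρ R).join u v) ((inputPar G D I J q ε ρ R).join v w)
    rw [inputPar_join hu hv, inputPar_join hv hw, inputPar_join hu hw]
    exact D.joinLevel_le_max hu hv hw
  · obtain ⟨u, rfl, hu⟩ := iW.1 hu₀
    obtain ⟨v, rfl, hv⟩ := iW.1 hv₀
    exact (ij hu hv).trans_le (D.joinLevel_le_top hu hv)
  · obtain ⟨v, rfl, hv⟩ := iW.1 hv₀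
    obtain ⟨v', rfl, hv'⟩ := iW.1 hv'₀
    have hj := (ij hv hv').symm.trans_le hj
    obtain ⟨hi1, hi2, B, hB, ⟨v₁, h1, h2⟩, hu⟩ :=
      (@inputPar_itf n G D I J q ε ρ R v i u).1 hi
    obtain rfl := Fin.ext h1
    refine (@inputPar_itf n G D I J q ε ρ R v' i u).2 ⟨hi1, hi2, B, hB, ⟨v', rfl, ?_⟩, hu⟩
    obtain ⟨B', hB', h3, h4⟩ := D.samePart_of_joinLevel_le hv hv' hj hi2
    rwa [D.part_eq hB hB' h2 h3]
  · obtain ⟨v, rfl, -⟩ := iW.1 hv₀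
    rw [rdistNat_val, rdist_self]
  -- Distinct facilities joined on level `L` or below would force `M ≥ top + 1 - L = M + 1`.
  · by_contra hne
    have h1 := @inputPar_join_of_inF n G D I J q ε ρ R hJ f f' hf hf' hne
    have h2 := hM f f' hf hf' hne
    have h3 : (inputPar G D I J q ε ρ R).join f f' ≤ L := hj
    omega
  · change L + M = D.top
    omega
  · obtain ⟨v, rfl, -⟩ := iW.1 hv₀
    exact (@rank_lt_countN { inputPar G D I J q ε ρ R with
      B := B, R := R, L := L, M := M, K := K, N := N, T := T } hit _ _ _ hu).trans_le (hK v v.2 l hl)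
  · change q ≤ B
    omega
  · change n < B
    omega
  · change R < B
    omega
  · change M ≤ B
    omega
  · change 1 + 2 * (M * K) ≤ B
    omega
  · change N ≤ B
    omega

theorem facts_prepPar {h c : ℕ} (hI : HasInterfaces G D I h ρ c) (hρ : 0 < ρ) (hρ' : ρ ≤ 1 / 2)
    (hJ : J.Coarse G D ε) (hq : 1 ≤ q) {R : ℕ} (hR : ¬ ((R : ℝ) * ρ < 101 ∧ 2 ≤ n)) :
    Facts (prepPar (inputPar G D I J q ε ρ R)) (rdistNat G D I ρ) := by
  have h1 := @le_prepPar_M (inputPar G D I J q ε ρ R) inputPar_inF_lt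
  have h2 := @le_prepPar_K (inputPar G D I J q ε ρ R) inputPar_itf_lt
  have h3 := prepPar_N (p := inputPar G D I J q ε ρ R)
  have h4 := prepPar_B (p := inputPar G D I J q ε ρ R)
  have h5 : (prepPar (inputPar G D I J q ε ρ R)).M ≤ D.top := by
    refine prepPar_M_le fun f f' hf hf' hne => ?_
    have := inputPar_join_of_inF hJ hf hf' hne
    change D.top + 1 - _ ≤ _
    omega
  have h6 : (prepPar (inputPar G D I J q ε ρ R)).L =
    D.top - (prepPar (inputPar G D I J q ε ρ R)).M := prepPar_L
  obtain ⟨B, L, M, K, N, T, he⟩ : ∃ B L M K N T, prepPar (inputPar G D I J q ε ρ R) =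
      { inputPar G D I J q ε ρ R with B := B, R := R, L := L, M := M, K := K, N := N, T := T } :=
    ⟨_, _, _, _, _, _, prepPar_eq⟩
  rw [he] at h1 h2 h3 h4 h5 h6 ⊢
  exact facts_of_bounds hI hρ hρ' hJ hq hR (fun f f' => @h1 f f') h5 h6
    (fun v hv l hl => h2 hv hl) h3 h4

end

/-! ### Solutions as sets of vertex numbers, and correctness of the output -/

section
variable {n : ℕ} {G : WGraph n} {D : HierDecomp n} {I : ℕ → Finset (Fin n) → Finset (Fin n)}
  {J : Instance n} {q : ℕ} {ε ρ : ℝ} {b : ℕ}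

theorem setValue_prepPar (p : Par) (rd : ℕ → ℕ → ℝ≥0∞) (S : Finset ℕ) :
    setValue (prepPar p) rd S = setValue p rd S := by
  simp only [setValue, prepPar]

theorem inputPar_w_of_kClustering {k : ℕ} (hJ : J.objective = .kClustering k) (v : Fin n) :
    (inputPar G D I J q ε ρ b).w v = 0 := by
  change (if h : (v : ℕ) < n then
        match J.objective with
        | .kClustering _ => 0
        | .facilityLocation w => (w ⟨v, h⟩ : ℝ)
      else 0) = 0
  simp [hJ]

theorem inputPar_w_of_facilityLocation {w : Fin n → Set.Ioi (0 : ℝ)}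
    (hJ : J.objective = .facilityLocation w) (v : Fin n) :
    (inputPar G D I J q ε ρ b).w v = w v := by
  change (if h : (v : ℕ) < n then
        match J.objective with
        | .kClustering _ => 0
        | .facilityLocation w => (w ⟨v, h⟩ : ℝ)
      else 0) = (w v : ℝ)
  simp [hJ]

/-- The input stores opening costs `0` for `k`-Clustering, so one value function covers both
problems. -/
theorem setValue_inputPar (S : Finset (Fin n)) :
    setValue (inputPar G D I J q ε ρ b) (rdistNat G D I ρ) (S.image Fin.val) =
      rvalue G D I ρ J q S := by
  have h1 : ∑ v ∈ Finset.range n, ENNReal.ofReal ((inputPar G D I J q ε ρ b).dem v) *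
      (⨅ f ∈ S.image Fin.val, rdistNat G D I ρ v f) ^ q = rcost G D I ρ J q S := by
    rw [Finset.sum_range, rcost]
    refine Finset.sum_congr rfl fun v _ => ?_
    rw [inputPar_dem, ENNReal.ofReal_natCast, Finset.iInf_finset_image, rdistSet]
    simp only [rdistNat_val]
  have h2 : ∑ f ∈ S.image Fin.val, ENNReal.ofReal ((inputPar G D I J q ε ρ b).w f) =
      ∑ f ∈ S, ENNReal.ofReal ((inputPar G D I J q ε ρ b).w f) :=
    Finset.sum_image fun x _ y _ h => Fin.ext h
  change ∑ v ∈ Finset.range n, ENNReal.ofReal ((inputPar G D I J q ε ρ b).dem v) *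
      (⨅ f ∈ S.image Fin.val, rdistNat G D I ρ v f) ^ q +
    ∑ f ∈ S.image Fin.val, ENNReal.ofReal ((inputPar G D I J q ε ρ b).w f) = _
  rw [h1, h2, rvalue]
  split
  · next k hk => simp [inputPar_w_of_kClustering hk]
  · next w hw => simp [inputPar_w_of_facilityLocation hw]

theorem inputPar_isSolution (S : Finset (Fin n)) : IsSolution J S ↔
    (∀ f ∈ S.image Fin.val, (inputPar G D I J q ε ρ b).inF f = 1) ∧
    ((inputPar G D I J q ε ρ b).kind = 0 →
      (S.image Fin.val).card ≤ (inputPar G D I J q ε ρ b).k) := by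
  rw [Finset.card_image_of_injective S Fin.val_injective]
  have h1 : (∀ f ∈ S.image Fin.val, (inputPar G D I J q ε ρ b).inF f = 1) ↔ S ⊆ J.F := by
    simp only [Finset.forall_mem_image, inputPar_inF]
    refine forall₂_congr fun f hf => ⟨fun ⟨v, hv, h⟩ => ?_, fun h => ⟨f, rfl, h⟩⟩
    rwa [← Fin.ext hv]
  rw [h1, IsSolution]
  refine and_congr Iff.rfl ?_
  change _ ↔ ((match J.objective with
      | .kClustering _ => 0
      | .facilityLocation _ => 1) = 0 → S.card ≤ match J.objective with
      | .kClustering k => k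
      | .facilityLocation _ => 0)
  split <;> simp

theorem one_le_prepPar_T (hJ : J.Coarse G D ε) (hX : 1 ≤ J.maxDemand) :
    1 ≤ (prepPar (inputPar G D I J q ε ρ b)).T := by
  obtain ⟨v, hv⟩ : ∃ v, 0 < J.demand v := by
    by_contra hc
    push Not at hc
    have : J.maxDemand ≤ 0 := Finset.sup_le fun v _ => hc v
    omega
  have h1 : (inputPar G D I J q ε ρ b).inW v = 1 := inputPar_inW.2 ⟨v, rfl, hJ.clients v hv⟩
  have h2 : n ≤ (prepPar (inputPar G D I J q ε ρ b)).B := by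
    rw [prepPar_B, show (inputPar G D I J q ε ρ b).n = n from rfl]
    omega
  rw [prepPar_T, sizeT, countN_eq, Nat.one_le_iff_ne_zero, Finset.card_ne_zero]
  refine ⟨v, ?_⟩
  simp only [Finset.mem_filter, Finset.mem_range]
  exact ⟨v.2.trans_le h2, by simpa only [prepPar] using h1⟩

theorem isOptimumRounded_solve {h c : ℕ} (hI : HasInterfaces G D I h ρ c) (hρ : 0 < ρ)
    (hρ' : ρ ≤ 1 / 2) (hX : 1 ≤ J.maxDemand) (hJ : J.Coarse G D ε) (hq : 1 ≤ q) {R : ℕ}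
    (hR : ¬ ((R : ℝ) * ρ < 101 ∧ 2 ≤ n)) {s : State}
    (hs : ∀ v, s.nat 5 v 0 0 =
      (solve (prep (put7 0 R (inputState G D I J q ε ρ)))).nat 5 v 0 0) :
    IsOptimumRounded G D I ρ J q (outputSet n s) := by
  have hp : par (prep (put7 0 R (inputState G D I J q ε ρ))) =
      prepPar (inputPar G D I J q ε ρ R) := by
    rw [par_prep, par_put7_0, inputPar]
  obtain ⟨o, tab, st, h1, h2, h3, h4, -⟩ :=
    solve_spec (prep (put7 0 R (inputState G D I J q ε ρ)))
  rw [hp] at h1 h2 h3 h4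
  have hF := facts_prepPar hI hρ hρ' hJ hq hR
  have hT1 : 1 ≤ (prepPar (inputPar G D I J q ε ρ R)).T := one_le_prepPar_T hJ hX
  have hT := prepPar_T (p := inputPar G D I J q ε ρ R)
  have hval := setValue_prepPar (inputPar G D I J q ε ρ R) (rdistNat G D I ρ)
  have e0 : (prepPar (inputPar G D I J q ε ρ R)).n = n := by
    simp only [prepPar]
    rfl
  have e1 : (prepPar (inputPar G D I J q ε ρ R)).inF = (inputPar G D I J q ε ρ R).inF := by
    simp only [prepPar]
  have e2 : (prepPar (inputPar G D I J q ε ρ R)).kind = (inputPar G D I J q ε ρ R).kind := by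
    simp only [prepPar]
  have e3 : (prepPar (inputPar G D I J q ε ρ R)).k = (inputPar G D I J q ε ρ R).k := by
    simp only [prepPar]
  clear hp
  generalize prepPar (inputPar G D I J q ε ρ R) = p at *
  generalize (solve (prep (put7 0 R (inputState G D I J q ε ρ)))).nat = N at *
  have hS : ∀ v, (v ∈ (outputSet n s).image Fin.val) ↔
      v < p.n ∧ markV p o tab st v = 1 := by
    intro v
    simp only [Finset.mem_image, outputSet, Finset.mem_filter, Finset.mem_univ, true_and, hs]
    constructor
    · rintro ⟨v, hv, rfl⟩
      have hvn : (v : ℕ) < p.n := by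
        rw [e0]
        exact v.2
      exact ⟨hvn, (h4 v (hvn.trans hF.n_lt)).symm.trans hv⟩
    · rintro ⟨hvn, hv⟩
      have hvn' : v < n := by rwa [e0] at hvn
      exact ⟨⟨v, hvn'⟩, (h4 v (hvn.trans hF.n_lt)).trans hv, rfl⟩
  obtain ⟨h5, h6, h7⟩ := optimal_of_tab hF hT1 hT h1 h2 h3 hS
  rw [e1, e2, e3] at h7
  rw [e1] at h5
  rw [e2, e3] at h6
  refine ⟨(inputPar_isSolution _).2 ⟨h5, h6⟩, fun S' hS' => ?_⟩
  obtain ⟨h8, h9⟩ := (inputPar_isSolution _).1 hS'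
  have := h7 _ h8 h9
  rwa [hval, hval, setValue_inputPar, setValue_inputPar] at this

end

/-! ### The running time -/

/-- The dominant term is `(R + 2) ^ E`, whose base is `2 ^ O(H)` and whose exponent is `O(log b * H
^ c)`; since `2 ^ (log₂ b) = b`, this is a power of `b` with exponent `O(H ^ (c + 1))`. Every
summand is compared with `N' = b ^ (37 H ^ (c + 1))`. -/
theorem size_le {b H : ℝ} {n q R M K c : ℕ} (hb : 2 ≤ b) (hH : 2 ≤ H) (hn : (n : ℝ) ≤ b)
    (hR : (R : ℝ) + 2 ≤ 104 * H) (hM : (M : ℝ) ≤ 3 * Real.logb 2 b) (hK : (K : ℝ) ≤ H ^ c) :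
    ((R + (n + q + 2) + M + (1 + 2 * (M * K)) + (n + 1) * (R + 2) ^ (1 + 2 * (M * K)) : ℕ) : ℝ) + 1
      ≤ (q + 10) * b ^ (37 * H ^ (c + 1)) := by
  set E := 1 + 2 * (M * K) with hE
  set ℓ := Real.logb 2 b with hℓ
  have hb0 : 0 < b := by linarith
  have hb1 : 1 ≤ b := by linarith
  have hbℓ : (2 : ℝ) ^ ℓ = b := Real.rpow_logb (by norm_num) (by norm_num) hb0
  have hℓ1 : 1 ≤ ℓ := by
    rw [hℓ, Real.le_logb_iff_rpow_le (by norm_num) hb0, Real.rpow_one]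
    exact hb
  have hHc : 1 ≤ H ^ c := one_le_pow₀ (by linarith)
  have hHc1 : 1 ≤ H ^ (c + 1) := one_le_pow₀ (by linarith)
  have hE1 : (E : ℝ) ≤ 7 * ℓ * H ^ c := by
    have h1 : (M : ℝ) * K ≤ 3 * ℓ * H ^ c := mul_le_mul hM hK (by positivity) (by linarith)
    have h2 : 1 ≤ ℓ * H ^ c := one_le_mul_of_one_le_of_one_le hℓ1 hHc
    rw [hE]
    push_cast
    linarith
  have lin_le : ∀ x : ℝ, 1 ≤ x → x ≤ 2 ^ x := by
    intro x hx
    have := one_add_mul_self_le_rpow_one_add (s := 1) (by norm_num) hx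
    norm_num at this
    linarith
  -- `104 H + 2` would already suffice; `128 = 2 ^ 7` is convenient, and `7 ≤ 4 H` because `H ≥ 2`.
  have hR2 : (R : ℝ) + 2 ≤ 2 ^ (5 * H) := by
    have h1 : (128 : ℝ) ≤ 2 ^ (4 * H) := by
      calc (128 : ℝ) = 2 ^ (7 : ℝ) := by norm_num
        _ ≤ 2 ^ (4 * H) := Real.rpow_le_rpow_of_exponent_le (by norm_num) (by linarith)
    calc (R : ℝ) + 2 ≤ 128 * H := by linarith
      _ ≤ 2 ^ (4 * H) * 2 ^ H := mul_le_mul h1 (lin_le H (by linarith)) (by linarith) (by positivity)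
      _ = 2 ^ (5 * H) := by rw [← Real.rpow_add (by norm_num)]; ring_nf
  have hRE : ((R : ℝ) + 2) ^ E ≤ b ^ (35 * H ^ (c + 1)) := by
    calc ((R : ℝ) + 2) ^ E ≤ ((2 : ℝ) ^ (5 * H)) ^ E := by gcongr
      _ = 2 ^ (5 * H * E) := by
        rw [Real.rpow_mul (by norm_num) (5 * H), Real.rpow_natCast]
      _ ≤ 2 ^ (5 * H * (7 * ℓ * H ^ c)) :=
        Real.rpow_le_rpow_of_exponent_le (by norm_num) (by gcongr)
      _ = 2 ^ (ℓ * (35 * H ^ (c + 1))) := by ring_nf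
      _ = b ^ (35 * H ^ (c + 1)) := by rw [Real.rpow_mul (by norm_num), hbℓ]
  set N' := b ^ (37 * H ^ (c + 1)) with hN'
  have hbN : b ≤ N' := by
    calc b = b ^ (1 : ℝ) := (Real.rpow_one b).symm
      _ ≤ N' := Real.rpow_le_rpow_of_exponent_le hb1 (by linarith)
  have hREN : ((R : ℝ) + 2) ^ E ≤ N' :=
    hRE.trans (Real.rpow_le_rpow_of_exponent_le hb1 (by linarith))
  -- The factor `n + 1 ≤ b ^ 2` accounts for the increase of the exponent from `35` to `37`, as `H ^
  -- (c + 1) ≥ 1`.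
  have hN : ((n : ℝ) + 1) * ((R : ℝ) + 2) ^ E ≤ N' := by
    calc ((n : ℝ) + 1) * ((R : ℝ) + 2) ^ E ≤ b ^ (2 : ℝ) * b ^ (35 * H ^ (c + 1)) := by
          refine mul_le_mul ?_ hRE (by positivity) (by positivity)
          rw [Real.rpow_two]
          nlinarith
      _ = b ^ (2 + 35 * H ^ (c + 1)) := (Real.rpow_add hb0 _ _).symm
      _ ≤ N' := Real.rpow_le_rpow_of_exponent_le hb1 (by linarith)
  have hRN : (R : ℝ) ≤ N' := by
    refine le_trans ?_ hREN
    have : (R : ℝ) + 2 ≤ ((R : ℝ) + 2) ^ E := le_self_pow₀ (by linarith [R.cast_nonneg (α := ℝ)])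
      (by omega)
    linarith
  have hEN : (E : ℝ) ≤ N' := by
    refine le_trans ?_ hREN
    calc (E : ℝ) ≤ 2 ^ E := by exact_mod_cast Nat.lt_two_pow_self.le
      _ ≤ ((R : ℝ) + 2) ^ E := by
        gcongr
        linarith [R.cast_nonneg (α := ℝ)]
  have hMN : (M : ℝ) ≤ 3 * N' := by
    have := lin_le ℓ hℓ1
    rw [hbℓ] at this
    linarith
  have hN1 : 1 ≤ N' := hb1.trans hbN
  have hqN : (q : ℝ) + 3 ≤ (q + 3) * N' := le_mul_of_one_le_right (by positivity) hN1
  -- In multiples of `N'`: `R`, `n`, the digits and the states count `1` each, `M` counts `3`, and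
  -- the constants with `q` count `q + 3`, in total `q + 10`.
  push_cast
  nlinarith

section
variable {n : ℕ} {G : WGraph n} {D : HierDecomp n} {I : ℕ → Finset (Fin n) → Finset (Fin n)}
  {J : Instance n} {q : ℕ} {ε ρ : ℝ} {R : ℕ}

theorem inputPar_K_le {h c : ℕ} (hI : HasInterfaces G D I h ρ c) (hρ : 0 < ρ) :
    ((prepPar (inputPar G D I J q ε ρ R)).K : ℝ) ≤ ((h : ℝ) / ρ) ^ c := by
  have h0 : 0 ≤ ((h : ℝ) / ρ) ^ c := by positivity
  refine (Nat.cast_le.2 (prepPar_K_le (k := ⌊((h : ℝ) / ρ) ^ c⌋₊) inputPar_itf_lt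
    fun v i => ?_)).trans (Nat.floor_le h0)
  rw [countN_eq]
  by_cases hv : 1 ≤ i ∧ i ≤ D.top ∧ ∃ B ∈ (D.part i).parts, ∃ v' : Fin n, (v' : ℕ) = v ∧ v' ∈ B
  · obtain ⟨h1, h2, B, hB, v', rfl, hv'⟩ := hv
    refine Nat.le_floor ((Nat.cast_le.2 ?_).trans (hI.concise i h1 h2 B hB))
    refine le_trans (Finset.card_le_card ?_) (Finset.card_image_le (f := Fin.val))
    intro u hu
    simp only [Finset.mem_filter] at hu
    obtain ⟨-, -, B', hB', ⟨v₁, h3, h4⟩, u, rfl, huI⟩ := inputPar_itf.1 hu.2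
    obtain rfl := Fin.ext h3
    rw [D.part_eq hB hB' hv' h4]
    exact Finset.mem_image_of_mem _ huI
  · refine le_of_eq_of_le ?_ (Nat.zero_le _)
    rw [Finset.card_eq_zero, Finset.eq_empty_iff_forall_notMem]
    intro u hu
    simp only [Finset.mem_filter] at hu
    obtain ⟨h1, h2, B, hB, hvB, -⟩ := inputPar_itf.1 hu.2
    exact hv ⟨h1, h2, B, hB, hvB⟩

/-- The part of the join level contains two facilities, so by coarseness this level lies above the
coarse level. -/
theorem top_sub_joinLevel_lt {h c : ℕ} (hI : HasInterfaces G D I h ρ c) (hJ : J.Coarse G D ε)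
    {f f' : Fin n} (hf : f ∈ J.F) (hf' : f' ∈ J.F) (hne : f ≠ f') :
    (D.top : ℝ) - D.joinLevel f f' < 2 * Real.logb 2 ((n : ℝ) * (J.maxDemand : ℝ) / ε) := by
  have hW := hJ.facilities f hf
  have hW' := hJ.facilities f' hf'
  obtain ⟨B, hB, h1, h2⟩ := D.samePart_joinLevel hW hW'
  have h3 : ¬ ((D.joinLevel f f' : ℕ) : ℤ) ≤ J.coarseLevel G D.W ε := by
    intro hle
    have h4 := hJ.sparse _ (D.joinLevel_le_top hW hW') hle B hB
    exact hne (Finset.card_le_one.1 h4 f (Finset.mem_inter.2 ⟨h1, hf⟩) f'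
      (Finset.mem_inter.2 ⟨h2, hf'⟩))
  rw [not_le, Instance.coarseLevel, Int.floor_lt, ← hI.levels] at h3
  push_cast at h3
  linarith

/-- Coarseness yields `2 log₂ b + 1`, where `b = n X / ε`; the summand `1` is absorbed because `b ≥
2`. -/
theorem inputPar_M_le {h c : ℕ} (hI : HasInterfaces G D I h ρ c) (hJ : J.Coarse G D ε)
    (hb : 2 ≤ (n : ℝ) * (J.maxDemand : ℝ) / ε) :
    ((prepPar (inputPar G D I J q ε ρ R)).M : ℝ) ≤
      3 * Real.logb 2 ((n : ℝ) * (J.maxDemand : ℝ) / ε) := by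
  have hℓ : 1 ≤ Real.logb 2 ((n : ℝ) * (J.maxDemand : ℝ) / ε) := by
    rw [Real.le_logb_iff_rpow_le (by norm_num) (by linarith), Real.rpow_one]
    exact hb
  refine (Nat.cast_le.2 (prepPar_M_le (m := ⌊3 * Real.logb 2
    ((n : ℝ) * (J.maxDemand : ℝ) / ε)⌋₊) fun f f' hf₀ hf₀' hne => ?_)).trans
      (Nat.floor_le (by linarith))
  obtain ⟨f, rfl, hf⟩ := inputPar_inF.1 hf₀
  obtain ⟨f', rfl, hf'⟩ := inputPar_inF.1 hf₀'
  have hW := hJ.facilities f hf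
  have hW' := hJ.facilities f' hf'
  have h1 := top_sub_joinLevel_lt hI hJ hf hf' fun h => hne (by rw [h])
  rw [inputPar_join hW hW', show (inputPar G D I J q ε ρ R).top = D.top from rfl]
  refine Nat.le_floor ?_
  rw [Nat.cast_sub ((D.joinLevel_le_top hW hW').trans (Nat.le_succ _))]
  push_cast
  linarith

theorem inputPar_M_eq_zero (hn : n = 1) : (prepPar (inputPar G D I J q ε ρ R)).M = 0 := by
  refine Nat.le_zero.1 (prepPar_M_le fun f f' hf hf' hne => ?_)
  have h1 := inputPar_inF_lt f hf
  have h2 := inputPar_inF_lt f' hf'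
  omega

end

/-- The bound for the rounded distances that the program finds. -/
theorem exists_bound {ρ : ℝ} (hρ : 0 < ρ) (n : ℕ) : ∃ R : ℕ,
    (∀ i < R, (i : ℝ) * ρ < 101 ∧ 2 ≤ n) ∧ ¬ ((R : ℝ) * ρ < 101 ∧ 2 ≤ n) ∧
      (n < 2 → R = 0) ∧ (R : ℝ) ≤ 101 / ρ + 1 := by
  by_cases hn : 2 ≤ n
  · refine ⟨⌈101 / ρ⌉₊, fun i hi => ⟨?_, hn⟩, fun hc => ?_, by omega,
      (Nat.ceil_lt_add_one (by positivity)).le⟩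
    · exact (lt_div_iff₀ hρ).1 (Nat.lt_ceil.1 hi)
    · exact absurd hc.1 (not_lt.2 ((div_le_iff₀ hρ).1 (Nat.le_ceil _)))
  · exact ⟨0, by simp, fun hc => hn hc.2, fun _ => rfl, by simp; positivity⟩

/-- The degree `e` of the running time goes into the exponent of `H`, since `37 e ≤ 2 ^ (37 e) ≤ H ^
(37 e)`. -/
theorem pow_mul_rpow_le {b H B : ℝ} {q c e : ℕ} (hb : 1 ≤ b) (hH : 2 ≤ H) (hB : 0 ≤ B)
    (h : B ≤ (q + 10) * b ^ (37 * H ^ (c + 1))) :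
    B ^ e ≤ (q + 10) ^ e * b ^ (H ^ (c + 1 + 37 * e)) := by
  have h1 : (37 * e : ℝ) ≤ H ^ (37 * e) := by
    calc (37 * e : ℝ) ≤ 2 ^ (37 * e) := by exact_mod_cast Nat.lt_two_pow_self.le
      _ ≤ H ^ (37 * e) := by gcongr
  calc B ^ e ≤ ((q + 10) * b ^ (37 * H ^ (c + 1))) ^ e := by gcongr
    _ = (q + 10) ^ e * b ^ (37 * H ^ (c + 1) * e) := by
      rw [mul_pow, ← Real.rpow_natCast (b ^ _), ← Real.rpow_mul (by linarith)]
    _ ≤ (q + 10) ^ e * b ^ (H ^ (c + 1 + 37 * e)) := by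
      gcongr
      rw [pow_add H (c + 1)]
      have : 0 ≤ H ^ (c + 1) := by positivity
      nlinarith

theorem inputPar_size_le {n : ℕ} {G : WGraph n} {D : HierDecomp n}
    {I : ℕ → Finset (Fin n) → Finset (Fin n)} {J : Instance n} {q : ℕ} {ε ρ : ℝ} {R h c : ℕ}
    (hI : HasInterfaces G D I h ρ c) (hh : 1 ≤ h) (hρ : 0 < ρ) (hρ' : ρ ≤ 1 / 2) (hε : 0 < ε)
    (hε' : ε ≤ 1) (hX : 1 ≤ J.maxDemand) (hJ : J.Coarse G D ε) (hR : n < 2 → R = 0)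
    (hR' : (R : ℝ) ≤ 101 / ρ + 1) :
    1 ≤ (n : ℝ) * (J.maxDemand : ℝ) / ε ∧ 2 ≤ (h : ℝ) / ρ ∧
    ((prepPar (inputPar G D I J q ε ρ R)).B : ℝ) + 1 ≤
      (q + 10) * ((n : ℝ) * (J.maxDemand : ℝ) / ε) ^ (37 * ((h : ℝ) / ρ) ^ (c + 1)) := by
  have hh' : (1 : ℝ) ≤ h := by exact_mod_cast hh
  have hX' : (1 : ℝ) ≤ J.maxDemand := by exact_mod_cast hX
  have hH : 2 ≤ (h : ℝ) / ρ := by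
    rw [le_div_iff₀ hρ]
    linarith
  have hnb : (n : ℝ) ≤ (n : ℝ) * (J.maxDemand : ℝ) / ε := by
    rw [le_div_iff₀ hε]
    have := n.cast_nonneg (α := ℝ)
    nlinarith
  have hn : 1 ≤ n := by
    by_contra hc
    obtain rfl : n = 0 := by omega
    exact absurd hX (by simp [Instance.maxDemand])
  have hn' : (1 : ℝ) ≤ n := by exact_mod_cast hn
  refine ⟨hn'.trans hnb, hH, ?_⟩
  have hB : (prepPar (inputPar G D I J q ε ρ R)).B = R + (n + q + 2) +
      (prepPar (inputPar G D I J q ε ρ R)).M + (1 + 2 * ((prepPar (inputPar G D I J q ε ρ R)).M *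
      (prepPar (inputPar G D I J q ε ρ R)).K)) + (n + 1) * (R + 2) ^ (1 + 2 *
      ((prepPar (inputPar G D I J q ε ρ R)).M * (prepPar (inputPar G D I J q ε ρ R)).K)) :=
    prepPar_B.trans (congrArg _ prepPar_N)
  rw [hB]
  rcases Nat.lt_or_ge n 2 with hlt | hge
  -- With one vertex `n X / ε` may be `1`, so only a constant is affordable; `R = M = 0` leaves the
  -- value `q + 9` on the left.
  · obtain rfl : n = 1 := by omega
    rw [hR hlt, inputPar_M_eq_zero rfl]
    have h1 := Real.one_le_rpow (hn'.trans hnb)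
      (show 0 ≤ 37 * ((h : ℝ) / ρ) ^ (c + 1) by positivity)
    have h2 : (q : ℝ) + 10 ≤ _ := le_mul_of_one_le_right (by positivity) h1
    refine le_trans ?_ h2
    push_cast
    norm_num
    linarith
  · have hge' : (2 : ℝ) ≤ n := by exact_mod_cast hge
    refine size_le (hge'.trans hnb) hH hnb ?_ (inputPar_M_le hI hJ (hge'.trans hnb))
      (inputPar_K_le hI hρ)
    have h1 : 101 / ρ ≤ 101 * ((h : ℝ) / ρ) := by
      rw [← mul_div_assoc]
      gcongr
      linarith
    linarith

end

end ClusterDP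

theorem mainTheorem4 :
    ∃ P : Prog, ∀ c : ℕ, ∃ C : ℕ, ∀ q : ℕ, 1 ≤ q → ∃ A : ℝ,
      ∀ (n : ℕ) (G : WGraph n) (h : ℕ), 1 ≤ h → G.highwayDim 8 ≤ h →
      ∀ ρ : ℝ, 0 < ρ → ρ ≤ 1 / 2 →
      ∀ ε : ℝ, 0 < ε → ε ≤ 1 →
      ∀ (D : HierDecomp n) (I : ℕ → Finset (Fin n) → Finset (Fin n)),
        HasInterfaces G D I h ρ c →
      ∀ J : Instance n, 1 ≤ J.maxDemand → J.Coarse G D ε →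
        ∃ (t : ℕ) (s : State),
          Exec P (inputState G D I J q ε ρ) t s ∧
          IsOptimumRounded G D I ρ J q (outputSet n s) ∧
          (t : ℝ) ≤ A * ((n : ℝ) * (J.maxDemand : ℝ) / ε) ^ (((h : ℝ) / ρ) ^ C) := by
  obtain ⟨P, T, ⟨-, c₀, e, hT⟩, hP⟩ := exists_program
  -- The constants `c₀` and `e` belong to the fixed program, so the exponent depends only on `c` and
  -- the factor only on `q`.
  refine ⟨P, fun c => ⟨c + 1 + 37 * e, fun q hq => ⟨c₀ * (q + 10) ^ e, ?_⟩⟩⟩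
  intro n G h hh _ ρ hρ hρ' ε hε hε' D I hI J hX hJ
  obtain ⟨R, hR₁, hR₂, hR₃, hR₄⟩ := exists_bound hρ n
  obtain ⟨t, s, hexec, hs, ht⟩ := hP (inputState G D I J q ε ρ) R rfl hR₁ hR₂
  refine ⟨t, s, hexec, isOptimumRounded_solve hI hρ hρ' hX hJ hq hR₂ hs, ?_⟩
  obtain ⟨hb, hH, hB⟩ := inputPar_size_le (q := q) hI hh hρ hρ' hε hε' hX hJ hR₃ hR₄
  have hp : par (prep (put7 0 R (inputState G D I J q ε ρ))) =
      prepPar (inputPar G D I J q ε ρ R) := by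
    rw [par_prep, par_put7_0, inputPar]
  rw [hp] at ht
  generalize (prepPar (inputPar G D I J q ε ρ R)).B = B at ht hB
  calc (t : ℝ) ≤ c₀ * ((B : ℝ) + 1) ^ e := by
        exact_mod_cast ht.trans (hT _)
    _ ≤ c₀ * ((q + 10) ^ e *
        ((n : ℝ) * (J.maxDemand : ℝ) / ε) ^ (((h : ℝ) / ρ) ^ (c + 1 + 37 * e))) := by
      gcongr
      exact pow_mul_rpow_le hb hH (by positivity) hB
    _ = _ := by ring
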